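/- Let $d\ge 1$, $s\in(0,1)$ and $\sigma\in\mathbb R$. For measurable $v,w:\mathbb R^d\to\mathbb R$ and $D\subseteq\mathbb R^d$ write $$|v|_{H^s(D)}^2=\int_D\int_D\frac{|v(x)-v(y)|^2}{|x-y|^{d+2s}}\,dy\,dx,\qquad (v,w)_s=\int_{\mathbb R^d}\int_{\mathbb R^d}\frac{(v(x)-v(y))(w(x)-w(y))}{|x-y|^{d+2s}}\,dy\,dx .$$ For an open set $\Omega\subset\mathbb R^d$ let $\widetilde H^s(\Omega)$ be the space of all $v\in L^2(\mathbb R^d)$ with $|v|_{H^s(\mathbb R^d)}<\infty$ and $\operatorname{supp} v\subseteq\overline\Omega$. **Theorem (local energy error estimate).** There is a constant $C>0$, depending only on $d$, $s$ and $\sigma$, such that the following holds. Let $\Omega\subset\mathbb R^d$ be bounded and open, and let $\mathcal T_h$ be a finite conforming triangulation of $\overline\Omega$ into closed nondegenerate $d$-simplices that is shape-regular with parameter $\sigma$, i.e. $h_T/\rho_T\le\sigma$ for all $T\in\mathcal T_h$, where $h_T$ is the diameter of $T$ and $\rho_T$ the diameter of the largest ball contained in $T$. Let $\mathbb V_h$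 be the space of continuous functions on $\mathbb R^d$ that are affine on each $T\in\mathcal T_h$ and vanish outside $\Omega$. Let $B_R=B(x_0,R)\subset\Omega$ with $R>0$, put $B_{R/2}=B(x_0,R/2)$ and $B_R^c=\mathbb R^d\setminus B_R$, let $h_R$ be the maximum of $h_T$ over all $T\in\mathcal T_h$ with $T\cap B_R\ne\emptyset$, and let $\mathbb V_h(B_R)$ be the set of functions in $\mathbb V_h$ that vanish outside $B_R$. Assume $16\,h_R\le R$. Let $u\in\widetilde H^s(\Omega)$, and let $\widetilde u_h\in\mathbb V_h$ satisfy the local Galerkin orthogonality $$(u-\widetilde u_h,\varphi_h)_s=0\qquad\text{for all }\varphi_h\in\mathbb V_h(B_R).$$ Then, for every $v_h\in\mathbb V_h$, $$\begin{aligned} |u-\widetilde u_h|^2_{H^s(B_{R/2})}\le{}& C\,|u-v_h|^2_{H^s(B_R)}+\frac{C}{R^{2s}}\|u-v_h\|^2_{L^2(B_R)}+C R^{d+2s}\left(\int_{B_R^c}\frac{|u(x)-v_h(x)|}{|x-x_0|^{d+2s}}\,dx\right)^2\\ &+\frac{C}{R^{2s}}\|u-\widetilde u_h\|^2_{L^2(B_R)}+C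 R^{d+2s}\left(\int_{B_R^c}\frac{|u(x)-\widetilde u_h(x)|}{|x-x_0|^{d+2s}}\,dx\right)^2 . \end{aligned}$$ -/

import Mathlib

open MeasureTheory Metric
open scoped ENNReal

noncomputable section

namespace FracFEM

/-- The fractional kernel `|x - y|^{-(d+2s)}` enters all definitions through its reciprocal
`|x - y|^{d+2s}`. -/
def kernelDenom {d : ℕ} (s : ℝ) (x y : EuclideanSpace ℝ (Fin d)) : ℝ :=
  ‖x - y‖ ^ ((d : ℝ) + 2 * s)

/-- The square `|v|²_{H^s(D)}` of the Sobolev-Slobodeckij seminorm on `D`, with values in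
`[0, ∞]`: the double integral over `D × D` of `|v(x) - v(y)|² / |x - y|^{d+2s}`. The normalization
constant `C_{d,s} / 2` is omitted. -/
def hsSeminormSq {d : ℕ} (s : ℝ) (D : Set (EuclideanSpace ℝ (Fin d)))
    (v : EuclideanSpace ℝ (Fin d) → ℝ) : ℝ≥0∞ :=
  ∫⁻ p in D ×ˢ D, ENNReal.ofReal (|v p.1 - v p.2| ^ 2 / kernelDenom s p.1 p.2)

/-- The bilinear form `(v, w)_s` on `H^s(ℝ^d)` (normalization constant omitted). The integrand is
integrable whenever `v` and `w` lie in `H^s(ℝ^d)`. -/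
def energyForm {d : ℕ} (s : ℝ) (v w : EuclideanSpace ℝ (Fin d) → ℝ) : ℝ :=
  ∫ p : EuclideanSpace ℝ (Fin d) × EuclideanSpace ℝ (Fin d),
    (v p.1 - v p.2) * (w p.1 - w p.2) / kernelDenom s p.1 p.2

/-- `v ∈ H^s(ℝ^d)`: square integrable with finite `H^s`-seminorm. -/
structure MemHs {d : ℕ} (s : ℝ) (v : EuclideanSpace ℝ (Fin d) → ℝ) : Prop where
  memLp : MemLp v 2 volume
  seminorm_lt_top : hsSeminormSq s Set.univ v < ∞

/-- `v` belongs to the zero-extension space of order `s` on `Ω`: it is in `H^s(ℝ^d)` and its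
(essential) support is contained in the closure of `Ω`. -/
structure MemHsTilde {d : ℕ} (s : ℝ) (Ω : Set (EuclideanSpace ℝ (Fin d)))
    (v : EuclideanSpace ℝ (Fin d) → ℝ) : Prop where
  memHs : MemHs s v
  support_subset : ∀ᵐ x ∂(volume : Measure (EuclideanSpace ℝ (Fin d))),
    x ∉ closure Ω → v x = 0

/-- A (conforming, finite) triangulation of `Ω`: a finite simplicial complex with underlying space
the closure of `Ω`. -/
structure IsTriangulation {d : ℕ} (K : Geometry.SimplicialComplex ℝ (EuclideanSpace ℝ (Fin d)))
    (Ω : Set (EuclideanSpace ℝ (Fin d))) : Prop where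
  finite_faces : K.faces.Finite
  space_eq : K.space = closure Ω

/-- The elements `T` of the mesh: the closed `d`-dimensional simplices of the complex. -/
def elements {d : ℕ} (K : Geometry.SimplicialComplex ℝ (EuclideanSpace ℝ (Fin d))) :
    Set (Set (EuclideanSpace ℝ (Fin d))) :=
  {T | ∃ t ∈ K.faces, t.card = d + 1 ∧ T = convexHull ℝ (t : Set (EuclideanSpace ℝ (Fin d)))}

/-- `ρ_T`: the diameter of the largest ball contained in `T`. -/
def inballDiam {d : ℕ} (T : Set (EuclideanSpace ℝ (Fin d))) : ℝ :=
  sSup {ρ : ℝ | 0 ≤ ρ ∧ ∃ c, closedBall c (ρ / 2) ⊆ T}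

/-- Shape regularity with parameter `σ`: `h_T / ρ_T ≤ σ` for every element `T`. -/
def IsShapeRegular {d : ℕ} (K : Geometry.SimplicialComplex ℝ (EuclideanSpace ℝ (Fin d)))
    (σ : ℝ) : Prop :=
  ∀ T ∈ elements K, diam T / inballDiam T ≤ σ

/-- `h_R`: the largest diameter of an element that meets the ball `B(x₀, R)`. -/
def localMeshSize {d : ℕ} (K : Geometry.SimplicialComplex ℝ (EuclideanSpace ℝ (Fin d)))
    (x₀ : EuclideanSpace ℝ (Fin d)) (R : ℝ) : ℝ :=
  sSup {ℓ : ℝ | ∃ T ∈ elements K, (T ∩ ball x₀ R).Nonempty ∧ ℓ = diam T}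

/-- The discrete space `V_h`: continuous functions that are affine on each element and vanish
outside `Ω`. -/
def feSpace {d : ℕ} (K : Geometry.SimplicialComplex ℝ (EuclideanSpace ℝ (Fin d)))
    (Ω : Set (EuclideanSpace ℝ (Fin d))) : Set (EuclideanSpace ℝ (Fin d) → ℝ) :=
  {v | Continuous v ∧ (∀ x, x ∉ Ω → v x = 0) ∧
    ∀ T ∈ elements K, ∃ f : EuclideanSpace ℝ (Fin d) →ᵃ[ℝ] ℝ, Set.EqOn v f T}

/-- The local discrete space `V_h(D)`: the functions of `V_h` that vanish outside `D`. -/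
def feSpaceOn {d : ℕ} (K : Geometry.SimplicialComplex ℝ (EuclideanSpace ℝ (Fin d)))
    (Ω D : Set (EuclideanSpace ℝ (Fin d))) : Set (EuclideanSpace ℝ (Fin d) → ℝ) :=
  {v | v ∈ feSpace K Ω ∧ ∀ x, x ∉ D → v x = 0}

/-- The square `‖w‖²_{L²(D)}`. -/
def l2NormSq {d : ℕ} (D : Set (EuclideanSpace ℝ (Fin d)))
    (w : EuclideanSpace ℝ (Fin d) → ℝ) : ℝ≥0∞ :=
  eLpNorm w 2 (volume.restrict D) ^ 2

/-- The nonlocal tail: the integral of `|w(x)| / |x - x₀|^{d+2s}` over the complement of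
`B(x₀, R)`. -/
def tail {d : ℕ} (s : ℝ) (x₀ : EuclideanSpace ℝ (Fin d)) (R : ℝ)
    (w : EuclideanSpace ℝ (Fin d) → ℝ) : ℝ≥0∞ :=
  ∫⁻ x in (ball x₀ R)ᶜ, ENNReal.ofReal (|w x| / kernelDenom s x x₀)

end FracFEM

end

/-!
# Local energy error estimates for fractional elliptic problems

Put `e = u - uh`, `f = u - vh` and `w = uh - vh = f - e`. By the triangle inequality the energy of `e`
on the half ball is bounded by those of `f` and `w`, so that only the discrete function `w` has to be
estimated. Two facts carry this.

*Localization* (`exists_energy_ball_le_of_orthogonal`). Let `φ` be a discrete function supported in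
the ball of radius `15 R / 16`. Since `(e, φ)_s = 0`, the part of the form over `B_R × B_R` is minus the
interaction of `B_R` with its complement. There `|x - y|` is comparable to `|y - x₀|`, because `φ`
vanishes near the boundary, and the interaction is bounded by local `L²` norms and the tail of `e`.
Hence `w` satisfies, on `B_R` alone, a variational inequality
`⟨w, φ⟩ ≤ |φ|² / 8 + M + C R^{-2s} ‖φ‖²`, where `M` collects terms of the asserted bound.

*Discrete Caccioppoli inequality* (`exists_caccioppoli`). A discrete function `w` subject to such an
inequality has energy at most `C (M + R^{-2s} ‖w‖²)` on the half ball.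

In dimension at least two (`exists_caccioppoli_of_two_le`) the test function is the nodal interpolant
`P` of `η² w`, with a cutoff `η`. Let `Q` be the interpolant of `η w`, write `I` for interpolation and
`Δ` for differences between two points `x` and `y`. As `I w = w`, for every constant `c`
`(ΔQ)² = Δw ΔP - Δw ΔI((η - c)² w) + (ΔI((η - c) w))²`.
No superapproximation estimate is needed: with `c` the value of `η` near `x`, the last two terms are at
most `C |x - y|² / R²` times the sum of the values at `x` and `y` of a function whose integral is
controlled by that of `w²` (`IsFat.exists_commutatorBound`, `IsFat.integral_nodalMajorant_le`). Against
the kernel this gives `C R^{-2s} ‖w‖²`. The bounds require elements with a common vertex to be of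
comparable size. Shape regularity implies this in dimension at least two (`IsFat.cellDiam_le`): a small
sphere around the vertex is connected, so one passes between any two of the boundedly many elements at
the vertex through elements that share an edge.

In dimension one all meshes are shape-regular, and neighbouring intervals need not be comparable.
There the test function is `w` minus its affine interpolant at two nodes, set to zero beyond them
(`cutAffine`). The error terms are values of `w` at the two nodes and interactions across them. At a
suitable node they are at most a small multiple of the energy on a larger interval plus lower order
terms (`exists_node_endpointEnergy_le`): either there is a long interval, on which an inverse estimate
applies, or all intervals nearby are short, and some node is no worse than the average over them. The
small multiple of the energy is absorbed by varying the radius (`exists_lineEnergy_half_le`).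
-/

/-! ### Radial integrals of the fractional kernel -/

section Radial

variable {E : Type*} [NormedAddCommGroup E] [NormedSpace ℝ E] [FiniteDimensional ℝ E]
  [MeasurableSpace E] [BorelSpace E] (μ : Measure E) [μ.IsAddHaarMeasure]

/-- Integration in polar coordinates for nonnegative radial functions. The radial density `g` is
specified separately, so that powers of the radius can be combined in it. -/
theorem lintegral_fun_norm_eq_of_radial [Nontrivial E] {f g : ℝ → ℝ}
    (hf0 : ∀ r, 0 < r → 0 ≤ f r)
    (hfg : ∀ r, 0 < r → r ^ (Module.finrank ℝ E - 1) * f r = g r)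
    (hg : IntegrableOn g (Set.Ioi 0)) :
    ∫⁻ z, ENNReal.ofReal (f ‖z‖) ∂μ =
      ENNReal.ofReal (Module.finrank ℝ E * μ.real (ball 0 1) * ∫ r in Set.Ioi 0, g r) := by
  have hg' : IntegrableOn (fun y : ℝ ↦ y ^ (Module.finrank ℝ E - 1) • f y) (Set.Ioi 0) :=
    hg.congr_fun (fun r hr => (hfg r hr).symm) measurableSet_Ioi
  have hi : Integrable (f ‖·‖) μ := (integrable_fun_norm_addHaar μ).2 hg'
  have hae : 0 ≤ᵐ[μ] fun z => f ‖z‖ := by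
    have : ∀ᵐ z ∂μ, z ≠ (0 : E) := by
      rw [ae_iff]; simp
    filter_upwards [this] with z hz
    exact hf0 _ (norm_pos_iff.2 hz)
  rw [← ofReal_integral_eq_lintegral_ofReal hi hae, integral_fun_norm_addHaar μ f]
  have e : ∫ y in Set.Ioi (0 : ℝ), y ^ (Module.finrank ℝ E - 1) • f y = ∫ r in Set.Ioi 0, g r :=
    setIntegral_congr_fun measurableSet_Ioi (fun r hr => hfg r hr)
  rw [e, nsmul_eq_mul, smul_eq_mul, mul_assoc]

theorem exists_lintegral_ball_norm_sq_div_le (hn : 1 ≤ Module.finrank ℝ E) {s : ℝ} (hs1 : s < 1) :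
    ∃ C : ℝ, 0 < C ∧ ∀ ρ : ℝ, 0 < ρ →
      ∫⁻ z in ball (0 : E) ρ, ENNReal.ofReal (‖z‖ ^ 2 / ‖z‖ ^ ((Module.finrank ℝ E : ℝ) + 2 * s)) ∂μ
        ≤ ENNReal.ofReal (C * ρ ^ (2 - 2 * s)) := by
  have : Nontrivial E := Module.nontrivial_of_finrank_pos (R := ℝ) (by omega)
  have hb : 0 < μ.real (ball (0 : E) 1) :=
    ENNReal.toReal_pos (measure_ball_pos μ _ one_pos).ne' measure_ball_lt_top.ne
  refine ⟨Module.finrank ℝ E * μ.real (ball (0 : E) 1) / (2 - 2 * s), ?_, fun ρ hρ => ?_⟩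
  · have : (0 : ℝ) < Module.finrank ℝ E := by exact_mod_cast hn
    have : 0 < 2 - 2 * s := by linarith
    positivity
  have hint : IntegrableOn (fun r : ℝ => r ^ (1 - 2 * s)) (Set.Ioo 0 ρ) :=
    (intervalIntegral.integrableOn_Ioo_rpow_iff hρ).2 (by linarith)
  have key := lintegral_fun_norm_eq_of_radial (E := E) μ
    (f := (Set.Iio ρ).indicator fun r => r ^ 2 / r ^ ((Module.finrank ℝ E : ℝ) + 2 * s))
    (g := (Set.Iio ρ).indicator fun r => r ^ (1 - 2 * s))
    (fun r hr => ?_) (fun r hr => ?_) ?_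
  · rw [← lintegral_indicator measurableSet_ball]
    have e1 : ∀ z : E, (ball (0 : E) ρ).indicator
        (fun z => ENNReal.ofReal (‖z‖ ^ 2 / ‖z‖ ^ ((Module.finrank ℝ E : ℝ) + 2 * s))) z =
        ENNReal.ofReal ((Set.Iio ρ).indicator
          (fun r => r ^ 2 / r ^ ((Module.finrank ℝ E : ℝ) + 2 * s)) ‖z‖) := by
      intro z
      by_cases hz : ‖z‖ < ρ <;> simp [Set.indicator, hz]
    simp_rw [e1]
    rw [key]
    apply le_of_eq
    congr 1
    rw [setIntegral_indicator measurableSet_Iio, Set.Ioi_inter_Iio, ← integral_Ioc_eq_integral_Ioo,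
      ← intervalIntegral.integral_of_le hρ.le, integral_rpow (Or.inl (by linarith)),
      Real.zero_rpow (by linarith)]
    rw [show 1 - 2 * s + 1 = 2 - 2 * s by ring]
    ring
  · by_cases h : r < ρ
    · simp only [Set.indicator, Set.mem_Iio, h, if_true]; positivity
    · simp [Set.indicator, h]
  · by_cases h : r < ρ
    · simp only [Set.indicator, Set.mem_Iio, h, if_true]
      rw [← Real.rpow_natCast r (Module.finrank ℝ E - 1), ← Real.rpow_natCast r 2,
        ← Real.rpow_sub hr, ← Real.rpow_add hr]
      congr 1
      push_cast [Nat.cast_sub hn]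
      ring
    · simp [Set.indicator, h]
  · rw [IntegrableOn, integrable_indicator_iff measurableSet_Iio, IntegrableOn,
      Measure.restrict_restrict measurableSet_Iio, Set.inter_comm, Set.Ioi_inter_Iio]
    exact hint

/-- The mass of the kernel outside a ball, which controls the interaction of a function supported
well inside the ball with the zero values outside. -/
theorem exists_lintegral_compl_ball_inv_le (hn : 1 ≤ Module.finrank ℝ E) {s : ℝ} (hs0 : 0 < s) :
    ∃ C : ℝ, 0 < C ∧ ∀ ρ : ℝ, 0 < ρ →
      ∫⁻ z in (ball (0 : E) ρ)ᶜ, ENNReal.ofReal (1 / ‖z‖ ^ ((Module.finrank ℝ E : ℝ) + 2 * s)) ∂μ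
        ≤ ENNReal.ofReal (C * ρ ^ (-(2 * s))) := by
  have : Nontrivial E := Module.nontrivial_of_finrank_pos (R := ℝ) (by omega)
  have hb : 0 < μ.real (ball (0 : E) 1) :=
    ENNReal.toReal_pos (measure_ball_pos μ _ one_pos).ne' measure_ball_lt_top.ne
  refine ⟨Module.finrank ℝ E * μ.real (ball (0 : E) 1) / (2 * s), ?_, fun ρ hρ => ?_⟩
  · have : (0 : ℝ) < Module.finrank ℝ E := by exact_mod_cast hn
    positivity
  have hint : IntegrableOn (fun r : ℝ => r ^ (-1 - 2 * s)) (Set.Ioi ρ) :=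
    integrableOn_Ioi_rpow_of_lt (by linarith) hρ
  have key := lintegral_fun_norm_eq_of_radial (E := E) μ
    (f := (Set.Ici ρ).indicator fun r => 1 / r ^ ((Module.finrank ℝ E : ℝ) + 2 * s))
    (g := (Set.Ici ρ).indicator fun r => r ^ (-1 - 2 * s))
    (fun r hr => ?_) (fun r hr => ?_) ?_
  · rw [← lintegral_indicator measurableSet_ball.compl]
    have e1 : ∀ z : E, (ball (0 : E) ρ)ᶜ.indicator
        (fun z => ENNReal.ofReal (1 / ‖z‖ ^ ((Module.finrank ℝ E : ℝ) + 2 * s))) z =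
        ENNReal.ofReal ((Set.Ici ρ).indicator
          (fun r => 1 / r ^ ((Module.finrank ℝ E : ℝ) + 2 * s)) ‖z‖) := by
      intro z
      by_cases hz : ρ ≤ ‖z‖ <;> simp [Set.indicator, hz]
    simp_rw [e1]
    rw [key]
    apply le_of_eq
    congr 1
    have hI : Set.Ioi (0 : ℝ) ∩ Set.Ici ρ = Set.Ici ρ :=
      Set.inter_eq_right.2 fun r hr => hρ.trans_le hr
    rw [setIntegral_indicator measurableSet_Ici, hI, integral_Ici_eq_integral_Ioi,
      integral_Ioi_rpow_of_lt (by linarith) hρ]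
    rw [show -1 - 2 * s + 1 = -(2 * s) by ring]
    field_simp
  · by_cases h : ρ ≤ r
    · simp only [Set.indicator, Set.mem_Ici, h, if_true]; positivity
    · simp [Set.indicator, h]
  · by_cases h : ρ ≤ r
    · simp only [Set.indicator, Set.mem_Ici, h, if_true]
      rw [← Real.rpow_natCast r (Module.finrank ℝ E - 1), one_div, ← Real.rpow_neg hr.le,
        ← Real.rpow_add hr]
      congr 1
      push_cast [Nat.cast_sub hn]
      ring
    · simp [Set.indicator, h]
  · rw [IntegrableOn, integrable_indicator_iff measurableSet_Ici, IntegrableOn,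
      Measure.restrict_restrict measurableSet_Ici, Set.inter_comm]
    have hI : Set.Ioi (0 : ℝ) ∩ Set.Ici ρ = Set.Ici ρ :=
      Set.inter_eq_right.2 fun r hr => hρ.trans_le hr
    rw [hI]
    exact (integrableOn_Ici_iff_integrableOn_Ioi (by simp)).2 hint

/-- Translation invariance turns a double integral of `g x * m (x - y)` over a product set into a
product of two single integrals. -/
theorem lintegral_prod_mul_sub_le {D D' S : Set E} {g m : E → ℝ≥0∞}
    (hS : MeasurableSet S) (hm : Measurable m)
    (hsub : ∀ x ∈ D, ∀ y ∈ D', x - y ∈ S) (hD : MeasurableSet D) (hD' : MeasurableSet D')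
    (hg : AEMeasurable g (μ.restrict D)) :
    ∫⁻ p in D ×ˢ D', g p.1 * m (p.1 - p.2) ∂(μ.prod μ) ≤
      (∫⁻ x in D, g x ∂μ) * ∫⁻ z in S, m z ∂μ := by
  rw [← Measure.prod_restrict, lintegral_prod, ← lintegral_mul_const'' _ hg]
  · refine setLIntegral_mono_ae' hD (Filter.Eventually.of_forall fun x hx => ?_)
    simp only
    rw [lintegral_const_mul _ (by fun_prop)]
    refine mul_le_mul' le_rfl ?_
    calc ∫⁻ y in D', m (x - y) ∂μ ≤ ∫⁻ y, S.indicator m (x - y) ∂μ := by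
          rw [← lintegral_indicator hD']
          refine lintegral_mono fun y => ?_
          by_cases hy : y ∈ D'
          · simp [Set.indicator, hy, hsub x hx y hy]
          · simp [Set.indicator, hy]
      _ = ∫⁻ z in S, m z ∂μ := by
          rw [lintegral_sub_left_eq_self (μ := μ) (S.indicator m) x, lintegral_indicator hS]
  · refine AEMeasurable.mul ?_ (by fun_prop)
    exact hg.comp_quasiMeasurePreserving Measure.quasiMeasurePreserving_fst

end Radial

/-! ### Weighted energies on a ball -/

theorem integrable_and_integral_le_of_lintegral_le {α : Type*} [MeasurableSpace α] {μ : Measure α}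
    {f : α → ℝ} {A : ℝ} (hA : 0 ≤ A) (hf : AEStronglyMeasurable f μ) (hf0 : 0 ≤ᵐ[μ] f)
    (h : ∫⁻ x, ENNReal.ofReal (f x) ∂μ ≤ ENNReal.ofReal A) :
    Integrable f μ ∧ ∫ x, f x ∂μ ≤ A := by
  have hi : Integrable f μ :=
    ⟨hf, (hasFiniteIntegral_iff_ofReal hf0).2 (h.trans_lt ENNReal.ofReal_lt_top)⟩
  refine ⟨hi, ?_⟩
  rw [integral_eq_lintegral_of_nonneg_ae hf0 hf]
  exact ENNReal.toReal_le_of_le_ofReal hA h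

section Energy

variable {E : Type*} [NormedAddCommGroup E] [NormedSpace ℝ E] [FiniteDimensional ℝ E]
  [MeasurableSpace E] [BorelSpace E] (μ : Measure E) [μ.IsAddHaarMeasure]

/-- The weight `|x - y|² / |x - y|^{n+2s}` is integrable near the diagonal, so that the double
integral of `|x - y|² (Z x + Z y) / |x - y|^{n+2s}` over a ball is controlled by the integral
of `Z`. -/
theorem exists_integral_norm_sq_div_mul_le (hn : 1 ≤ Module.finrank ℝ E) {s : ℝ} (hs1 : s < 1) :
    ∃ C : ℝ, 0 < C ∧ ∀ (x₀ : E) (R : ℝ), 0 < R → ∀ D : Set E, MeasurableSet D → D ⊆ ball x₀ R →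
      ∀ Z : E → ℝ, (∀ x ∈ D, 0 ≤ Z x) → IntegrableOn Z D μ →
        IntegrableOn (fun p : E × E =>
          ‖p.1 - p.2‖ ^ 2 / ‖p.1 - p.2‖ ^ ((Module.finrank ℝ E : ℝ) + 2 * s) * (Z p.1 + Z p.2))
          (D ×ˢ D) (μ.prod μ) ∧
        ∫ p in D ×ˢ D,
          ‖p.1 - p.2‖ ^ 2 / ‖p.1 - p.2‖ ^ ((Module.finrank ℝ E : ℝ) + 2 * s) * (Z p.1 + Z p.2)
          ∂(μ.prod μ) ≤ C * R ^ (2 - 2 * s) * ∫ x in D, Z x ∂μ := by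
  obtain ⟨C, hC, hrad⟩ := exists_lintegral_ball_norm_sq_div_le (E := E) μ hn hs1
  refine ⟨2 * C * 2 ^ (2 - 2 * s), by positivity, fun x₀ R hR D hD hDB Z hZ0 hZ => ?_⟩
  set m : E → ℝ≥0∞ := fun z =>
    ENNReal.ofReal (‖z‖ ^ 2 / ‖z‖ ^ ((Module.finrank ℝ E : ℝ) + 2 * s)) with hm
  have hmm : Measurable m := by fun_prop
  have hZi : 0 ≤ ∫ x in D, Z x ∂μ := setIntegral_nonneg hD hZ0
  have hZm : AEMeasurable (fun x => ENNReal.ofReal (Z x)) (μ.restrict D) :=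
    hZ.aemeasurable.ennreal_ofReal
  have hprod : (μ.prod μ).restrict (D ×ˢ D) = (μ.restrict D).prod (μ.restrict D) :=
    (Measure.prod_restrict D D).symm
  have hZ1 : AEStronglyMeasurable (fun p : E × E => Z p.1) ((μ.prod μ).restrict (D ×ˢ D)) := by
    rw [hprod]; exact hZ.aestronglyMeasurable.comp_fst
  have hZ2 : AEStronglyMeasurable (fun p : E × E => Z p.2) ((μ.prod μ).restrict (D ×ˢ D)) := by
    rw [hprod]; exact hZ.aestronglyMeasurable.comp_snd
  have hmeasD : ∀ᵐ p ∂((μ.prod μ).restrict (D ×ˢ D)), p ∈ D ×ˢ D :=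
    ae_restrict_mem (hD.prod hD)
  have hzD : ∀ᵐ x ∂(μ.restrict D), 0 ≤ Z x := by
    filter_upwards [ae_restrict_mem hD] with x hx using hZ0 x hx
  have hlin : ∫⁻ x in D, ENNReal.ofReal (Z x) ∂μ = ENNReal.ofReal (∫ x in D, Z x ∂μ) :=
    (ofReal_integral_eq_lintegral_ofReal hZ hzD).symm
  have hone : ∫⁻ p in D ×ˢ D, ENNReal.ofReal (Z p.1) * m (p.1 - p.2) ∂(μ.prod μ) ≤
      ENNReal.ofReal ((∫ x in D, Z x ∂μ) * (C * (2 * R) ^ (2 - 2 * s))) := by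
    refine (lintegral_prod_mul_sub_le μ (S := ball 0 (2 * R)) measurableSet_ball hmm ?_ hD hD
      hZm).trans ?_
    · intro x hx y hy
      have h1 := hDB hx; have h2 := hDB hy
      rw [mem_ball_zero_iff, ← dist_eq_norm]
      calc dist x y ≤ dist x x₀ + dist y x₀ := dist_triangle_right _ _ _
        _ < 2 * R := by linarith [mem_ball.1 h1, mem_ball.1 h2]
    · rw [hlin, ENNReal.ofReal_mul hZi]
      exact mul_le_mul' le_rfl (hrad _ (by positivity))
  have htwo : ∫⁻ p in D ×ˢ D, ENNReal.ofReal (Z p.2) * m (p.1 - p.2) ∂(μ.prod μ) =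
      ∫⁻ p in D ×ˢ D, ENNReal.ofReal (Z p.1) * m (p.1 - p.2) ∂(μ.prod μ) := by
    rw [hprod, ← lintegral_prod_swap]
    refine lintegral_congr fun p => ?_
    simp only [Prod.swap, hm]
    rw [norm_sub_rev]
  have := integrable_and_integral_le_of_lintegral_le (μ := (μ.prod μ).restrict (D ×ˢ D))
    (f := fun p : E × E =>
      ‖p.1 - p.2‖ ^ 2 / ‖p.1 - p.2‖ ^ ((Module.finrank ℝ E : ℝ) + 2 * s) * (Z p.1 + Z p.2))
    (A := 2 * C * 2 ^ (2 - 2 * s) * R ^ (2 - 2 * s) * ∫ x in D, Z x ∂μ)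
    (by positivity) ?_ ?_ ?_
  · exact this
  · refine AEStronglyMeasurable.mul ?_ (hZ1.add hZ2)
    exact (Measurable.aestronglyMeasurable (by fun_prop))
  · filter_upwards [hmeasD] with p hp
    have := hZ0 _ hp.1; have := hZ0 _ hp.2
    simp only [Pi.zero_apply]
    positivity
  · calc _ ≤ ∫⁻ p in D ×ˢ D, (ENNReal.ofReal (Z p.1) * m (p.1 - p.2) +
          ENNReal.ofReal (Z p.2) * m (p.1 - p.2)) ∂(μ.prod μ) := by
          refine lintegral_mono_ae ?_
          filter_upwards [hmeasD] with p hp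
          rw [ENNReal.ofReal_mul (by positivity), ENNReal.ofReal_add (hZ0 _ hp.1) (hZ0 _ hp.2),
            mul_comm, add_mul]
      _ = _ := lintegral_add_left' (by
          exact hZ1.aemeasurable.ennreal_ofReal.mul
            (hmm.comp (measurable_fst.sub measurable_snd)).aemeasurable) _
      _ ≤ _ := by
          rw [htwo, ← two_mul]
          refine (mul_le_mul' le_rfl hone).trans (le_of_eq ?_)
          rw [← ENNReal.ofReal_ofNat 2, ← ENNReal.ofReal_mul (by norm_num)]
          congr 1
          rw [Real.mul_rpow (by norm_num) hR.le]
          ring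

/-- A bounded Lipschitz function with bounded support has finite fractional energy. -/
theorem lintegral_energy_lt_top_of_lipschitz (hn : 1 ≤ Module.finrank ℝ E) {s : ℝ} (hs0 : 0 < s)
    (hs1 : s < 1) {v : E → ℝ} {L M ρ : ℝ} (hL : ∀ x y, |v x - v y| ≤ L * ‖x - y‖)
    (hM : ∀ x, |v x| ≤ M) (hsupp : ∀ x, x ∉ ball (0 : E) ρ → v x = 0) :
    ∫⁻ p : E × E, ENNReal.ofReal (|v p.1 - v p.2| ^ 2 /
      ‖p.1 - p.2‖ ^ ((Module.finrank ℝ E : ℝ) + 2 * s)) ∂(μ.prod μ) < ∞ := by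
  obtain ⟨C₁, hC₁, hrad₁⟩ := exists_lintegral_ball_norm_sq_div_le (E := E) μ hn hs1
  obtain ⟨C₂, hC₂, hrad₂⟩ := exists_lintegral_compl_ball_inv_le (E := E) μ hn hs0
  set k : E → ℝ := fun z => ‖z‖ ^ ((Module.finrank ℝ E : ℝ) + 2 * s) with hk
  set m : E → ℝ≥0∞ := fun z => ENNReal.ofReal (L ^ 2) * ENNReal.ofReal (‖z‖ ^ 2 / k z) with hm
  set m' : E → ℝ≥0∞ := fun z => ENNReal.ofReal (4 * M ^ 2) *
    (ball (0 : E) 1)ᶜ.indicator (fun z => ENNReal.ofReal (1 / k z)) z with hm'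
  set m'' : E → ℝ≥0∞ := fun z => (ball (0 : E) 1).indicator m z + m' z with hm''
  have hmm : Measurable m := by fun_prop
  have hmm' : Measurable m' := by
    refine Measurable.const_mul (Measurable.indicator (by fun_prop) measurableSet_ball.compl) _
  have hmm'' : Measurable m'' := (hmm.indicator measurableSet_ball).add hmm'
  have hint : ∫⁻ z, m'' z ∂μ < ∞ := by
    rw [lintegral_add_right _ hmm', lintegral_indicator measurableSet_ball,
      lintegral_const_mul _ (by fun_prop), lintegral_const_mul _
        (Measurable.indicator (by fun_prop) measurableSet_ball.compl),
      lintegral_indicator measurableSet_ball.compl]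
    refine ENNReal.add_lt_top.2 ⟨ENNReal.mul_lt_top ENNReal.ofReal_lt_top
      ((hrad₁ 1 one_pos).trans_lt ENNReal.ofReal_lt_top), ENNReal.mul_lt_top ENNReal.ofReal_lt_top
      ((hrad₂ 1 one_pos).trans_lt ENNReal.ofReal_lt_top)⟩
  set g : E → ℝ≥0∞ := (ball (0 : E) ρ).indicator 1 with hg
  have hgm : Measurable g := measurable_one.indicator measurableSet_ball
  have hone : ∫⁻ p : E × E, g p.1 * m'' (p.1 - p.2) ∂(μ.prod μ) < ∞ := by
    have := lintegral_prod_mul_sub_le μ (D := Set.univ) (D' := Set.univ) (S := Set.univ) (g := g)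
      MeasurableSet.univ hmm'' (fun _ _ _ _ => trivial) MeasurableSet.univ MeasurableSet.univ
      hgm.aemeasurable
    simp only [Set.univ_prod_univ, Measure.restrict_univ] at this
    refine this.trans_lt (ENNReal.mul_lt_top ?_ hint)
    rw [hg, lintegral_indicator_one measurableSet_ball]
    exact measure_ball_lt_top
  have hsymm : ∀ z, m'' (-z) = m'' z := by
    intro z
    simp only [hm'', hm', hm, hk, Set.indicator, mem_ball_zero_iff, Set.mem_compl_iff, norm_neg]
  have htwo : ∫⁻ p : E × E, g p.2 * m'' (p.1 - p.2) ∂(μ.prod μ) =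
      ∫⁻ p : E × E, g p.1 * m'' (p.1 - p.2) ∂(μ.prod μ) := by
    rw [← lintegral_prod_swap]
    refine lintegral_congr fun p => ?_
    simp only [Prod.swap]
    rw [← neg_sub, hsymm]
  have hpt : ∀ x y : E, ENNReal.ofReal (|v x - v y| ^ 2 / k (x - y)) ≤ m'' (x - y) := by
    intro x y
    by_cases hz : ‖x - y‖ < 1
    · simp only [hm'', hm', hm, Set.indicator, mem_ball_zero_iff, Set.mem_compl_iff, hz, if_true,
        not_true_eq_false, if_false, mul_zero, add_zero]
      rw [← ENNReal.ofReal_mul (by positivity), ← mul_div_assoc, ← mul_pow]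
      refine ENNReal.ofReal_le_ofReal ?_
      have hk0 : 0 ≤ k (x - y) := by simp only [hk]; positivity
      have := hL x y
      gcongr
    · simp only [hm'', hm', hm, Set.indicator, mem_ball_zero_iff, Set.mem_compl_iff, hz, if_true,
        not_false_eq_true, if_false, zero_add]
      rw [← ENNReal.ofReal_mul (by positivity), mul_one_div]
      refine ENNReal.ofReal_le_ofReal ?_
      have hk0 : 0 ≤ k (x - y) := by simp only [hk]; positivity
      have h2 : |v x - v y| ≤ 2 * M := by
        calc |v x - v y| ≤ |v x| + |v y| := abs_sub _ _
          _ ≤ _ := by linarith [hM x, hM y]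
      have : |v x - v y| ^ 2 ≤ 4 * M ^ 2 := by
        calc _ ≤ (2 * M) ^ 2 := by gcongr
          _ = _ := by ring
      gcongr
  calc _ ≤ ∫⁻ p : E × E, (g p.1 * m'' (p.1 - p.2) + g p.2 * m'' (p.1 - p.2)) ∂(μ.prod μ) := by
        refine lintegral_mono fun p => ?_
        by_cases h1 : p.1 ∈ ball (0 : E) ρ
        · refine (hpt p.1 p.2).trans ?_
          simp [hg, Set.indicator_of_mem h1]
        · by_cases h2 : p.2 ∈ ball (0 : E) ρ
          · refine (hpt p.1 p.2).trans ?_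
            simp [hg, Set.indicator_of_mem h2]
          · simp [hsupp _ h1, hsupp _ h2]
    _ < ∞ := by
        rw [lintegral_add_left (by fun_prop), htwo]
        exact ENNReal.add_lt_top.2 ⟨hone, hone⟩

end Energy

/-! ### From global to local Galerkin orthogonality -/

section LocalGalerkin

open FracFEM

variable {d : ℕ}

theorem measurable_kernelDenom (s : ℝ) :
    Measurable fun p : EuclideanSpace ℝ (Fin d) × EuclideanSpace ℝ (Fin d) =>
      kernelDenom s p.1 p.2 := by
  unfold kernelDenom; fun_prop

theorem kernelDenom_nonneg (s : ℝ) (x y : EuclideanSpace ℝ (Fin d)) : 0 ≤ kernelDenom s x y := by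
  unfold kernelDenom; positivity

theorem kernelDenom_comm (s : ℝ) (x y : EuclideanSpace ℝ (Fin d)) :
    kernelDenom s x y = kernelDenom s y x := by
  unfold kernelDenom; rw [norm_sub_rev]

theorem kernelDenom_pos {s : ℝ} {x y : EuclideanSpace ℝ (Fin d)} (h : x ≠ y) :
    0 < kernelDenom s x y := by
  have : 0 < ‖x - y‖ := norm_pos_iff.2 (sub_ne_zero.2 h)
  unfold kernelDenom; positivity

theorem FracFEM.MemHs.integrable_energy {s : ℝ} {v w : EuclideanSpace ℝ (Fin d) → ℝ}
    (hv : MemHs s v) (hw : MemHs s w) :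
    Integrable fun p : EuclideanSpace ℝ (Fin d) × EuclideanSpace ℝ (Fin d) =>
      (v p.1 - v p.2) * (w p.1 - w p.2) / kernelDenom s p.1 p.2 := by
  have meas : ∀ {v : EuclideanSpace ℝ (Fin d) → ℝ}, MemHs s v → AEStronglyMeasurable
      (fun p : EuclideanSpace ℝ (Fin d) × EuclideanSpace ℝ (Fin d) => v p.1 - v p.2) := fun hv =>
    hv.memLp.aestronglyMeasurable.comp_fst.sub hv.memLp.aestronglyMeasurable.comp_snd
  have hk := (measurable_kernelDenom (d := d) s).inv.aestronglyMeasurable (μ := volume)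
  have sq : ∀ {v : EuclideanSpace ℝ (Fin d) → ℝ}, MemHs s v → Integrable
      (fun p : EuclideanSpace ℝ (Fin d) × EuclideanSpace ℝ (Fin d) =>
        |v p.1 - v p.2| ^ 2 / kernelDenom s p.1 p.2) := by
    intro v hv
    have h0 : ∀ p : EuclideanSpace ℝ (Fin d) × EuclideanSpace ℝ (Fin d),
        0 ≤ |v p.1 - v p.2| ^ 2 / kernelDenom s p.1 p.2 := fun p =>
      div_nonneg (by positivity) (kernelDenom_nonneg _ _ _)
    refine ⟨by simp only [div_eq_mul_inv]; exact ((meas hv).norm.pow 2).mul hk, ?_⟩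
    rw [hasFiniteIntegral_iff_ofReal (Filter.Eventually.of_forall h0)]
    simpa [hsSeminormSq] using hv.seminorm_lt_top
  refine ((sq hv).add (sq hw)).mono'
    (by simp only [div_eq_mul_inv]; exact ((meas hv).mul (meas hw)).mul hk) ?_
  refine Filter.Eventually.of_forall fun p => ?_
  have hk0 := kernelDenom_nonneg s p.1 p.2
  simp only [Pi.add_apply]
  rw [norm_div, norm_mul, Real.norm_eq_abs, Real.norm_eq_abs, Real.norm_eq_abs, abs_of_nonneg hk0,
    ← add_div]
  gcongr
  nlinarith [sq_nonneg (|v p.1 - v p.2| - |w p.1 - w p.2|), abs_nonneg (v p.1 - v p.2),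
    abs_nonneg (w p.1 - w p.2)]

/-- If `φ` is supported well inside `B = ball x₀ R` and `(e, φ)_s = 0`, then the part of the energy
form over `B × B` is bounded by local `L²` norms and the nonlocal tail of `e`. -/
theorem exists_abs_energy_ball_le (hd : 1 ≤ d) {s : ℝ} (hs0 : 0 < s) :
    ∃ C : ℝ, 0 < C ∧ ∀ (x₀ : EuclideanSpace ℝ (Fin d)) (R : ℝ), 0 < R →
      ∀ e φ : EuclideanSpace ℝ (Fin d) → ℝ, MemHs s e → MemHs s φ →
      (∀ x, x ∉ ball x₀ (15 / 16 * R) → φ x = 0) → energyForm s e φ = 0 → tail s x₀ R e ≠ ∞ →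
      -∫ p in ball x₀ R ×ˢ ball x₀ R,
          (e p.1 - e p.2) * (φ p.1 - φ p.2) / kernelDenom s p.1 p.2 ≤
        C * (R ^ (-(2 * s)) * ∫ x in ball x₀ R, φ x ^ 2) +
        C * (R ^ (-(2 * s)) * (∫ x in ball x₀ R, e x ^ 2) +
          R ^ ((d : ℝ) + 2 * s) * (tail s x₀ R e).toReal ^ 2) := by
  have hfr : Module.finrank ℝ (EuclideanSpace ℝ (Fin d)) = d := finrank_euclideanSpace_fin
  obtain ⟨C₂, hC₂, hrad⟩ := exists_lintegral_compl_ball_inv_le (E := EuclideanSpace ℝ (Fin d))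
    volume (by rw [hfr]; exact hd) hs0
  rw [hfr] at hrad
  set ω : ℝ := volume.real (ball (0 : EuclideanSpace ℝ (Fin d)) 1) with hω
  have hω0 : 0 ≤ ω := measureReal_nonneg
  set c : ℝ := 16 ^ ((d : ℝ) + 2 * s) with hc
  have hc0 : 0 < c := by positivity
  refine ⟨2 * c * (C₂ + ω + 1), by positivity, fun x₀ R hR e φ he hφ hsupp horth htail => ?_⟩
  set B := ball x₀ R with hB
  have hBm : MeasurableSet B := measurableSet_ball
  set τ := (tail s x₀ R e).toReal with hτ
  have hτ0 : 0 ≤ τ := ENNReal.toReal_nonneg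
  set F : EuclideanSpace ℝ (Fin d) × EuclideanSpace ℝ (Fin d) → ℝ := fun p =>
    (e p.1 - e p.2) * (φ p.1 - φ p.2) / kernelDenom s p.1 p.2 with hF
  have hFi : Integrable F := he.integrable_energy hφ
  have hφ0 : ∀ x, x ∉ B → φ x = 0 := fun x hx => hsupp x fun h => hx (ball_subset_ball
    (by linarith) h)
  have hFswap : ∀ p, F p.swap = F p := by
    intro p
    simp only [hF, Prod.fst_swap, Prod.snd_swap]
    rw [kernelDenom_comm]; ring
  -- the tail weight
  set k₀ : EuclideanSpace ℝ (Fin d) → ℝ := fun y => 1 / kernelDenom s y x₀ with hk₀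
  have hk₀0 : ∀ y, 0 ≤ k₀ y := fun y => by
    have := kernelDenom_nonneg s y x₀
    simp only [hk₀]; positivity
  have hk₀m : Measurable k₀ := by
    simp only [hk₀, kernelDenom]; fun_prop
  have hk₀i : IntegrableOn k₀ Bᶜ ∧ ∫ y in Bᶜ, k₀ y ≤ C₂ * R ^ (-(2 * s)) := by
    refine integrable_and_integral_le_of_lintegral_le (by positivity)
      hk₀m.aestronglyMeasurable (Filter.Eventually.of_forall hk₀0) ?_
    refine le_trans (le_of_eq ?_) (hrad R hR)
    rw [← lintegral_indicator hBm.compl, ← lintegral_indicator measurableSet_ball.compl]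
    refine Eq.trans ?_ (lintegral_sub_right_eq_self _ x₀)
    refine lintegral_congr fun y => ?_
    simp only [Set.indicator, hB, Set.mem_compl_iff, mem_ball_iff_norm, sub_zero, hk₀, kernelDenom]
  -- integrability of the factors
  have hesq : IntegrableOn (fun x => e x ^ 2) B := he.memLp.integrable_sq.integrableOn
  have hφsq : IntegrableOn (fun x => φ x ^ 2) B := hφ.memLp.integrable_sq.integrableOn
  have : IsFiniteMeasure (volume.restrict B) := ⟨by simp [hB, measure_ball_lt_top]⟩
  have hφ1 : IntegrableOn (fun x => |φ x|) B := by
    have : IntegrableOn φ B := (hφ.memLp.restrict B).integrable (by norm_num)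
    exact this.abs
  have hti : IntegrableOn (fun y => |e y| * k₀ y) Bᶜ ∧ ∫ y in Bᶜ, |e y| * k₀ y ≤ τ := by
    refine integrable_and_integral_le_of_lintegral_le hτ0 ?_ ?_ ?_
    · exact he.memLp.aestronglyMeasurable.restrict.norm.mul hk₀m.aestronglyMeasurable
    · exact Filter.Eventually.of_forall fun y => mul_nonneg (abs_nonneg _) (hk₀0 y)
    · rw [hτ, ENNReal.ofReal_toReal htail]
      simp only [tail, hk₀, mul_one_div]
      exact le_rfl
  -- By orthogonality the diagonal block is minus the rest. On the rest `φ` is nonzero only where exactly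
  -- one of the points is in `B`, and the two such blocks contribute equally.
  have hsplit : (∫ p in B ×ˢ B, F p) + ∫ p in (B ×ˢ B)ᶜ, F p = 0 := by
    rw [integral_add_compl (hBm.prod hBm) hFi]; exact horth
  have hoff : ∫ p in (B ×ˢ B)ᶜ, F p = 2 * ∫ p in B ×ˢ Bᶜ, F p := by
    have h1 : ∫ p in (B ×ˢ B)ᶜ, F p = ∫ p in (B ×ˢ Bᶜ) ∪ (Bᶜ ×ˢ B), F p := by
      refine setIntegral_eq_of_subset_of_forall_sdiff_eq_zero (hBm.prod hBm).compl ?_ ?_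
      · rintro ⟨x, y⟩ (h | h) h'
        · exact h.2 h'.2
        · exact h.1 h'.1
      · rintro ⟨x, y⟩ ⟨h1, h2⟩
        have hx : x ∉ B := fun hx => h2 (Or.inl ⟨hx, fun hy => h1 ⟨hx, hy⟩⟩)
        have hy : y ∉ B := fun hy => h2 (Or.inr ⟨hx, hy⟩)
        simp [hF, hφ0 x hx, hφ0 y hy]
    rw [h1, setIntegral_union _ (hBm.compl.prod hBm) hFi.integrableOn hFi.integrableOn]
    · have h2 : ∫ p in Bᶜ ×ˢ B, F p = ∫ p in B ×ˢ Bᶜ, F p := by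
        rw [Measure.volume_eq_prod, ← setIntegral_prod_swap]
        simp_rw [hFswap]
      rw [h2]; ring
    · rw [Set.disjoint_left]
      rintro ⟨x, y⟩ h h'
      exact h'.1 h.1
  -- For `x` in the ball of radius `15 R / 16` and `y` outside `B`, `|y - x₀| ≤ 16 |x - y|`, so that the
  -- kernel is bounded by a function of `y` alone.
  set H : EuclideanSpace ℝ (Fin d) × EuclideanSpace ℝ (Fin d) → ℝ := fun p =>
    c * ((φ p.1 ^ 2 + e p.1 ^ 2) * k₀ p.2 + |φ p.1| * (|e p.2| * k₀ p.2)) with hH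
  have hprod : (volume : Measure (EuclideanSpace ℝ (Fin d) × EuclideanSpace ℝ (Fin d))).restrict
      (B ×ˢ Bᶜ) = (volume.restrict B).prod (volume.restrict Bᶜ) :=
    (Measure.prod_restrict B Bᶜ).symm
  have hA1 : Integrable (fun p : EuclideanSpace ℝ (Fin d) × EuclideanSpace ℝ (Fin d) =>
      (φ p.1 ^ 2 + e p.1 ^ 2) * k₀ p.2) ((volume.restrict B).prod (volume.restrict Bᶜ)) :=
    (hφsq.add hesq).mul_prod hk₀i.1
  have hA2 : Integrable (fun p : EuclideanSpace ℝ (Fin d) × EuclideanSpace ℝ (Fin d) =>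
      |φ p.1| * (|e p.2| * k₀ p.2)) ((volume.restrict B).prod (volume.restrict Bᶜ)) :=
    hφ1.mul_prod hti.1
  have hpt : ∀ p ∈ B ×ˢ Bᶜ, F p ≤ H p := by
    rintro ⟨x, y⟩ ⟨hx, hy⟩
    simp only at hx hy
    simp only [hF, hH, hφ0 y hy, sub_zero]
    by_cases hx' : x ∈ ball x₀ (15 / 16 * R)
    · have hyx : x₀ ≠ y := by
        rintro rfl
        exact hy (mem_ball_self hR)
      have hy' : R ≤ ‖y - x₀‖ := by
        by_contra hlt
        exact hy (mem_ball_iff_norm.2 (not_le.1 hlt))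
      have hx'' : ‖x - x₀‖ < 15 / 16 * R := mem_ball_iff_norm.1 hx'
      have h16 : ‖y - x₀‖ ≤ 16 * ‖x - y‖ := by
        have : ‖y - x₀‖ ≤ ‖x - x₀‖ + ‖x - y‖ := by
          calc ‖y - x₀‖ = ‖(x - x₀) - (x - y)‖ := by congr 1; abel
            _ ≤ _ := norm_sub_le _ _
        linarith
      have hxy : x ≠ y := by
        rintro rfl
        simp only [sub_self, norm_zero, mul_zero] at h16
        linarith
      have hkk : 1 / kernelDenom s x y ≤ c * k₀ y := by
        have hp1 := kernelDenom_pos (s := s) hxy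
        have hp2 := kernelDenom_pos (s := s) hyx.symm
        have : kernelDenom s y x₀ ≤ c * kernelDenom s x y := by
          simp only [kernelDenom, hc]
          rw [← Real.mul_rpow (by norm_num) (norm_nonneg _)]
          exact Real.rpow_le_rpow (norm_nonneg _) h16 (by positivity)
        simp only [hk₀]
        rw [mul_one_div, div_le_div_iff₀ hp1 hp2]
        linarith
      calc (e x - e y) * φ x / kernelDenom s x y
          = ((e x - e y) * φ x) * (1 / kernelDenom s x y) := by ring
        _ ≤ ((|e x| + |e y|) * |φ x|) * (c * k₀ y) := by
            refine mul_le_mul ?_ hkk ?_ (by positivity)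
            · calc (e x - e y) * φ x ≤ |(e x - e y) * φ x| := le_abs_self _
                _ = |e x - e y| * |φ x| := abs_mul _ _
                _ ≤ _ := by gcongr; exact abs_sub _ _
            · have := kernelDenom_nonneg s x y
              positivity
        _ ≤ _ := by
            have h1 : |e x| * |φ x| ≤ φ x ^ 2 + e x ^ 2 := by
              rw [← sq_abs (φ x), ← sq_abs (e x)]
              nlinarith [sq_nonneg (|e x| - |φ x|), abs_nonneg (e x), abs_nonneg (φ x)]
            have h2 := mul_le_mul_of_nonneg_right h1 (mul_nonneg hc0.le (hk₀0 y))
            nlinarith [h2]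
    · rw [hsupp x hx']
      simp only [mul_zero, zero_div]
      have := hk₀0 y
      positivity
  have hFH : ∫ p in B ×ˢ Bᶜ, F p ≤ ∫ p in B ×ˢ Bᶜ, H p := by
    refine setIntegral_mono_on hFi.integrableOn ?_ (hBm.prod hBm.compl) hpt
    rw [IntegrableOn, hprod]
    exact (hA1.add hA2).const_mul c
  have hHint : ∫ p in B ×ˢ Bᶜ, H p = c * (((∫ x in B, φ x ^ 2) + ∫ x in B, e x ^ 2) *
      (∫ y in Bᶜ, k₀ y) + (∫ x in B, |φ x|) * ∫ y in Bᶜ, |e y| * k₀ y) := by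
    rw [hprod, integral_const_mul, integral_add hA1 hA2]
    congr 2
    · rw [integral_prod_mul (fun x => φ x ^ 2 + e x ^ 2) k₀, integral_add hφsq hesq]
    · rw [integral_prod_mul (fun x => |φ x|) (fun y => |e y| * k₀ y)]
  set X := ∫ x in B, φ x ^ 2 with hX
  set Y := ∫ x in B, e x ^ 2 with hY
  have hX0 : 0 ≤ X := setIntegral_nonneg hBm fun x _ => sq_nonneg _
  have hY0 : 0 ≤ Y := setIntegral_nonneg hBm fun x _ => sq_nonneg _
  have hmix : (∫ x in B, |φ x|) * τ ≤ R ^ (-(2 * s)) * X + ω * (R ^ ((d : ℝ) + 2 * s) * τ ^ 2) := by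
    have hvol : volume.real B = R ^ d * ω := by
      rw [hB, hω, Measure.real, Measure.addHaar_ball_of_pos _ _ hR, hfr, ENNReal.toReal_mul,
        ENNReal.toReal_ofReal (by positivity), Measure.real]
    have hfin : volume B ≠ ∞ := measure_ball_lt_top.ne
    have h1 : ∫ x in B, |φ x| * τ ≤ ∫ x in B, (R ^ (-(2 * s)) * φ x ^ 2 + R ^ (2 * s) * τ ^ 2) := by
      refine setIntegral_mono_on (hφ1.mul_const _)
        ((hφsq.const_mul _).add (integrableOn_const hfin)) hBm fun x _ => ?_
      have hp : 0 < R ^ s := by positivity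
      have e1 : R ^ (-(2 * s)) = ((R ^ s)⁻¹) ^ 2 := by
        rw [← Real.rpow_neg hR.le, ← Real.rpow_natCast, ← Real.rpow_mul hR.le]
        congr 1; push_cast; ring
      have e2 : R ^ (2 * s) = (R ^ s) ^ 2 := by
        rw [← Real.rpow_natCast, ← Real.rpow_mul hR.le]
        congr 1; push_cast; ring
      rw [e1, e2, ← sq_abs (φ x)]
      have e3 : |φ x| * τ = ((R ^ s)⁻¹ * |φ x|) * (R ^ s * τ) := by field_simp
      rw [e3]
      nlinarith [sq_nonneg ((R ^ s)⁻¹ * |φ x| - R ^ s * τ), sq_nonneg ((R ^ s)⁻¹ * |φ x|),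
        sq_nonneg (R ^ s * τ)]
    rw [integral_mul_const, integral_add (hφsq.const_mul _) (integrableOn_const hfin),
      integral_const_mul, setIntegral_const, hvol, smul_eq_mul] at h1
    refine h1.trans (le_of_eq ?_)
    rw [Real.rpow_add hR, Real.rpow_natCast]
    ring
  have hφ1' : 0 ≤ ∫ x in B, |φ x| := setIntegral_nonneg hBm fun x _ => abs_nonneg _
  have hfinal : ∫ p in B ×ˢ Bᶜ, H p ≤ c * ((X + Y) * (C₂ * R ^ (-(2 * s))) +
      (R ^ (-(2 * s)) * X + ω * (R ^ ((d : ℝ) + 2 * s) * τ ^ 2))) := by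
    rw [hHint]
    have h1 := mul_le_mul_of_nonneg_left hk₀i.2 (add_nonneg hX0 hY0)
    have h2 := (mul_le_mul_of_nonneg_left hti.2 hφ1').trans hmix
    gcongr
  have hr1 : 0 ≤ R ^ (-(2 * s)) := by positivity
  have hr2 : 0 ≤ R ^ ((d : ℝ) + 2 * s) * τ ^ 2 := by positivity
  have heq : -∫ p in B ×ˢ B, F p = 2 * ∫ p in B ×ˢ Bᶜ, F p := by linarith
  rw [heq]
  have hrX : 0 ≤ R ^ (-(2 * s)) * X := mul_nonneg hr1 hX0
  have hrY : 0 ≤ R ^ (-(2 * s)) * Y := mul_nonneg hr1 hY0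
  have : 2 * ∫ p in B ×ˢ Bᶜ, F p ≤ 2 * (c * ((X + Y) * (C₂ * R ^ (-(2 * s))) +
      (R ^ (-(2 * s)) * X + ω * (R ^ ((d : ℝ) + 2 * s) * τ ^ 2)))) := by linarith
  refine this.trans ?_
  set r := R ^ (-(2 * s))
  set t := R ^ ((d : ℝ) + 2 * s) * τ ^ 2
  have hpos : 0 ≤ 2 * c * (ω * (r * X) + (ω + 1) * (r * Y) + (C₂ + 1) * t) := by positivity
  clear_value r t X Y ω c
  linarith

/-- Local form of the Galerkin equation: testing `w = f - e` with `φ`, where `(e, φ)_s = 0`, the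
energy form over `B × B` sees only `f` on `B` and lower order terms. -/
theorem exists_energy_ball_le_of_orthogonal (hd : 1 ≤ d) {s : ℝ} (hs0 : 0 < s) :
    ∃ C : ℝ, 0 < C ∧ ∀ (x₀ : EuclideanSpace ℝ (Fin d)) (R : ℝ), 0 < R →
      ∀ e w φ : EuclideanSpace ℝ (Fin d) → ℝ, MemHs s e → MemHs s w → MemHs s φ →
      (∀ x, x ∉ ball x₀ (15 / 16 * R) → φ x = 0) → energyForm s e φ = 0 → tail s x₀ R e ≠ ∞ →
      ∫ p in ball x₀ R ×ˢ ball x₀ R,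
          (w p.1 - w p.2) * (φ p.1 - φ p.2) / kernelDenom s p.1 p.2 ≤
        1 / 8 * (∫ p in ball x₀ R ×ˢ ball x₀ R, (φ p.1 - φ p.2) ^ 2 / kernelDenom s p.1 p.2) +
        (2 * (∫ p in ball x₀ R ×ˢ ball x₀ R,
            ((e + w) p.1 - (e + w) p.2) ^ 2 / kernelDenom s p.1 p.2) +
          C * (R ^ (-(2 * s)) * (∫ x in ball x₀ R, e x ^ 2) +
            R ^ ((d : ℝ) + 2 * s) * (tail s x₀ R e).toReal ^ 2)) +
        C * (R ^ (-(2 * s)) * ∫ x in ball x₀ R, φ x ^ 2) := by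
  obtain ⟨C, hC, h⟩ := exists_abs_energy_ball_le (d := d) hd hs0
  refine ⟨C, hC, fun x₀ R hR e w φ he hw hφ hsupp horth htail => ?_⟩
  have h1 := h x₀ R hR e φ he hφ hsupp horth htail
  have iw := (hw.integrable_energy hφ).integrableOn (s := ball x₀ R ×ˢ ball x₀ R)
  have ie := (he.integrable_energy hφ).integrableOn (s := ball x₀ R ×ˢ ball x₀ R)
  have iφ := (hφ.integrable_energy hφ).integrableOn (s := ball x₀ R ×ˢ ball x₀ R)
  have iee := (he.integrable_energy he).integrableOn (s := ball x₀ R ×ˢ ball x₀ R)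
  have iew := (he.integrable_energy hw).integrableOn (s := ball x₀ R ×ˢ ball x₀ R)
  have iww := (hw.integrable_energy hw).integrableOn (s := ball x₀ R ×ˢ ball x₀ R)
  have if' : IntegrableOn (fun p : EuclideanSpace ℝ (Fin d) × EuclideanSpace ℝ (Fin d) =>
      ((e + w) p.1 - (e + w) p.2) ^ 2 / kernelDenom s p.1 p.2) (ball x₀ R ×ˢ ball x₀ R) := by
    refine ((iee.add (iew.const_mul 2)).add iww).congr
      (Filter.Eventually.of_forall fun p => ?_)
    simp only [Pi.add_apply]; ring
  have iφ' : IntegrableOn (fun p : EuclideanSpace ℝ (Fin d) × EuclideanSpace ℝ (Fin d) =>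
      (φ p.1 - φ p.2) ^ 2 / kernelDenom s p.1 p.2) (ball x₀ R ×ˢ ball x₀ R) := by
    refine iφ.congr (Filter.Eventually.of_forall fun p => ?_)
    simp only; ring
  have h2 : (∫ p in ball x₀ R ×ˢ ball x₀ R,
        (w p.1 - w p.2) * (φ p.1 - φ p.2) / kernelDenom s p.1 p.2) +
      ∫ p in ball x₀ R ×ˢ ball x₀ R,
        (e p.1 - e p.2) * (φ p.1 - φ p.2) / kernelDenom s p.1 p.2 ≤
      1 / 8 * (∫ p in ball x₀ R ×ˢ ball x₀ R, (φ p.1 - φ p.2) ^ 2 / kernelDenom s p.1 p.2) +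
      2 * ∫ p in ball x₀ R ×ˢ ball x₀ R,
            ((e + w) p.1 - (e + w) p.2) ^ 2 / kernelDenom s p.1 p.2 := by
    rw [← integral_add iw ie, ← integral_const_mul, ← integral_const_mul,
      ← integral_add (iφ'.const_mul _) (if'.const_mul _)]
    refine integral_mono (iw.add ie) ((iφ'.const_mul _).add (if'.const_mul _)) fun p => ?_
    have hk0 := kernelDenom_nonneg s p.1 p.2
    simp only [Pi.add_apply]
    rw [← add_div, ← mul_div_assoc, ← mul_div_assoc, ← add_div]
    refine div_le_div_of_nonneg_right ?_ hk0
    nlinarith [sq_nonneg ((φ p.1 - φ p.2) - 4 * ((e p.1 + w p.1) - (e p.2 + w p.2)))]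
  linarith

end LocalGalerkin

/-! ### Simplices and piecewise affine interpolation -/

section Simplices

variable {d : ℕ}

theorem exists_affineMap_eq_on_of_affineIndependent {t : Finset (EuclideanSpace ℝ (Fin d))}
    (ht : AffineIndependent ℝ ((↑) : t → EuclideanSpace ℝ (Fin d))) (hc : t.card = d + 1)
    (v : EuclideanSpace ℝ (Fin d) → ℝ) :
    ∃ A : EuclideanSpace ℝ (Fin d) →ᵃ[ℝ] ℝ, ∀ p ∈ t, A p = v p := by
  have htop : affineSpan ℝ (Set.range ((↑) : t → EuclideanSpace ℝ (Fin d))) = ⊤ := by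
    rw [ht.affineSpan_eq_top_iff_card_eq_finrank_add_one]
    simp [hc]
  let b : AffineBasis t ℝ (EuclideanSpace ℝ (Fin d)) := ⟨_, ht, htop⟩
  refine ⟨∑ i : t, v i • b.coord i, fun p hp => ?_⟩
  have : ∀ i : t, (b.coord i) p = if i = ⟨p, hp⟩ then 1 else 0 := fun i =>
    b.coord_apply i ⟨p, hp⟩
  have e : (∑ i : t, v i • b.coord i) p = ∑ i : t, v i * b.coord i p := by
    classical
    induction (Finset.univ : Finset t) using Finset.induction_on with
    | empty => simp
    | insert i s hi ih => rw [Finset.sum_insert hi, Finset.sum_insert hi, ← ih]; simp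
  rw [e]
  simp [this]

theorem exists_weights_of_mem_convexHull {t : Finset (EuclideanSpace ℝ (Fin d))}
    {x : EuclideanSpace ℝ (Fin d)} (hx : x ∈ convexHull ℝ (t : Set (EuclideanSpace ℝ (Fin d)))) :
    ∃ c : EuclideanSpace ℝ (Fin d) → ℝ, (∀ p ∈ t, 0 ≤ c p) ∧ ∑ p ∈ t, c p = 1 ∧
      ∀ A : EuclideanSpace ℝ (Fin d) →ᵃ[ℝ] ℝ, A x = ∑ p ∈ t, c p * A p := by
  rw [Finset.mem_convexHull'] at hx
  obtain ⟨c, hc0, hc1, rfl⟩ := hx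
  refine ⟨c, hc0, hc1, fun A => ?_⟩
  have h1 : ∀ y, A y = A.linear y + A 0 := fun y => by
    conv_lhs => rw [A.decomp]
    simp
  have h2 : ∑ p ∈ t, c p * A p = ∑ p ∈ t, (c p * A.linear p + c p * A 0) :=
    Finset.sum_congr rfl fun p _ => by rw [h1 p, mul_add]
  rw [h2, h1, map_sum, Finset.sum_add_distrib, ← Finset.sum_mul, hc1, one_mul]
  simp_rw [map_smul, smul_eq_mul]

theorem AffineMap.eqOn_convexHull_of_eqOn {s : Set (EuclideanSpace ℝ (Fin d))}
    {A A' : EuclideanSpace ℝ (Fin d) →ᵃ[ℝ] ℝ} (h : Set.EqOn A A' s) :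
    Set.EqOn A A' (convexHull ℝ s) := by
  have hconv : Convex ℝ {x | A x = A' x} := by
    have : {x | A x = A' x} = (A - A') ⁻¹' {0} := by
      ext x; simp [sub_eq_zero]
    rw [this]
    exact (convex_singleton (𝕜 := ℝ) (0 : ℝ)).affine_preimage (A - A')
  exact convexHull_min h hconv

theorem volume_convexHull_eq_zero {t : Finset (EuclideanSpace ℝ (Fin d))}
    (ht : AffineIndependent ℝ ((↑) : t → EuclideanSpace ℝ (Fin d))) (hc : t.card ≠ d + 1) :
    volume (convexHull ℝ (t : Set (EuclideanSpace ℝ (Fin d)))) = 0 := by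
  have hne : affineSpan ℝ (t : Set (EuclideanSpace ℝ (Fin d))) ≠ ⊤ := by
    have h := ht.affineSpan_eq_top_iff_card_eq_finrank_add_one
    simp only [Subtype.range_coe_subtype, Finset.setOfPred_mem, Fintype.card_coe,
      finrank_euclideanSpace_fin] at h
    intro h'
    exact hc (h.1 h')
  exact measure_mono_null (convexHull_subset_affineSpan _) (Measure.addHaar_affineSubspace _ _ hne)

/-- A continuous function which is Lipschitz on each of finitely many closed sets covering a
segment is Lipschitz along that segment. -/
theorem abs_sub_le_of_segment_subset_biUnion {F : Type*} [NormedAddCommGroup F] [NormedSpace ℝ F]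
    {ι : Type*} (I : Finset ι) (S : ι → Set F) (hS : ∀ i ∈ I, IsClosed (S i)) {x y : F}
    (hcov : segment ℝ x y ⊆ ⋃ i ∈ I, S i) {f : F → ℝ} (hf : ContinuousOn f (segment ℝ x y)) {L : ℝ}
    (hL : ∀ i ∈ I, ∀ a ∈ S i, ∀ b ∈ S i, a ∈ segment ℝ x y → b ∈ segment ℝ x y →
      |f a - f b| ≤ L * ‖a - b‖) :
    |f x - f y| ≤ L * ‖x - y‖ := by
  set γ : ℝ → F := fun t => AffineMap.lineMap x y t with hγ
  have hγc : Continuous γ := AffineMap.lineMap_continuous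
  have hmem : ∀ t ∈ Set.Icc (0 : ℝ) 1, γ t ∈ segment ℝ x y := fun t ht => by
    rw [segment_eq_image_lineMap]; exact ⟨t, ht, rfl⟩
  have hγd : ∀ a b : ℝ, ‖γ a - γ b‖ = |a - b| * ‖x - y‖ := fun a b => by
    rw [← dist_eq_norm, hγ, dist_lineMap_lineMap, Real.dist_eq, dist_eq_norm]
  set s : Set ℝ := {t | |f (γ t) - f (γ 0)| ≤ L * ‖x - y‖ * t} with hs
  have h01 : (0 : ℝ) ≤ 1 := zero_le_one
  have hfγ : ContinuousOn (fun t => f (γ t)) (Set.Icc 0 1) := hf.comp hγc.continuousOn hmem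
  have hclosed : IsClosed (s ∩ Set.Icc 0 1) := by
    have h := ContinuousOn.preimage_isClosed_of_isClosed
      (f := fun t => L * ‖x - y‖ * t - |f (γ t) - f (γ 0)|) (s := Set.Icc (0 : ℝ) 1) (t := Set.Ici 0)
      ((by fun_prop : ContinuousOn (fun t : ℝ => L * ‖x - y‖ * t) _).sub
        (hfγ.sub continuousOn_const).abs) isClosed_Icc isClosed_Ici
    convert! h using 1
    ext t
    simp [hs, and_comm]
  have hsub : Set.Icc (0 : ℝ) 1 ⊆ s := by
    refine hclosed.Icc_subset_of_forall_exists_gt ?_ ?_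
    · simp [hs]
    · rintro t ⟨hts, ht0, ht1⟩ z hz
      -- some set of the cover contains points of the curve arbitrarily close to `t` from the right
      have hfreq : ∃ i ∈ I, ∃ᶠ t' in nhdsWithin t (Set.Ioi t), γ t' ∈ S i := by
        by_contra hcon
        push Not at hcon
        have h1 : ∀ᶠ t' in nhdsWithin t (Set.Ioi t), ∀ i ∈ I, γ t' ∉ S i :=
          (Filter.eventually_all_finset I).2 hcon
        have h2 : ∀ᶠ t' in nhdsWithin t (Set.Ioi t), t' ∈ Set.Ioo t 1 := Ioo_mem_nhdsGT ht1
        obtain ⟨t', h3, h4⟩ := (h1.and h2).exists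
        obtain ⟨i, hi, hti⟩ := Set.mem_iUnion₂.1 (hcov (hmem t' ⟨ht0.trans h4.1.le, h4.2.le⟩))
        exact h3 i hi hti
      obtain ⟨i, hi, hfr⟩ := hfreq
      have htS : γ t ∈ S i := by
        have hcl : IsClosed (γ ⁻¹' S i) := (hS i hi).preimage hγc
        refine hcl.mem_of_frequently_of_tendsto hfr (Filter.Tendsto.mono_left Filter.tendsto_id
          nhdsWithin_le_nhds)
      have hm : ∀ᶠ t' in nhdsWithin t (Set.Ioi t), t' ∈ Set.Ioo t (min z 1) :=
        Ioo_mem_nhdsGT (lt_min hz ht1)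
      obtain ⟨t', h3, h4⟩ := (hfr.and_eventually hm).exists
      have h5 : t' < z := h4.2.trans_le (min_le_left _ _)
      have h6 : t' < 1 := h4.2.trans_le (min_le_right _ _)
      refine ⟨t', ?_, h4.1, h5.le⟩
      have h7 := hL i hi _ h3 _ htS (hmem t' ⟨ht0.trans h4.1.le, h6.le⟩) (hmem t ⟨ht0, ht1.le⟩)
      rw [hγd, abs_of_pos (sub_pos.2 h4.1)] at h7
      have h8 : |f (γ t) - f (γ 0)| ≤ L * ‖x - y‖ * t := hts
      change |f (γ t') - f (γ 0)| ≤ L * ‖x - y‖ * t'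
      calc _ ≤ |f (γ t') - f (γ t)| + |f (γ t) - f (γ 0)| := abs_sub_le _ _ _
        _ ≤ _ := by linarith
  have h := hsub (Set.right_mem_Icc.2 h01)
  simp only [hs, Set.mem_ofPred_eq, hγ, AffineMap.lineMap_apply_one, AffineMap.lineMap_apply_zero,
    mul_one] at h
  rwa [abs_sub_comm] at h

/-- An affine function bounded on a ball has a controlled slope. -/
theorem AffineMap.abs_sub_le_of_closedBall {F : Type*} [NormedAddCommGroup F] [NormedSpace ℝ F]
    (A : F →ᵃ[ℝ] ℝ) {c : F} {r M : ℝ} (hr : 0 < r) (hA : ∀ z ∈ closedBall c r, |A z| ≤ M) (x y : F) :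
    |A x - A y| ≤ M / r * ‖x - y‖ := by
  rcases eq_or_ne x y with rfl | hxy
  · simp
  have hn : 0 < ‖x - y‖ := norm_pos_iff.2 (sub_ne_zero.2 hxy)
  set u : F := (r / ‖x - y‖) • (x - y) with hu
  have hun : ‖u‖ = r := by
    rw [hu, norm_smul, Real.norm_of_nonneg (by positivity), div_mul_cancel₀ _ hn.ne']
  have h1 := hA (c + u) (by simp [mem_closedBall, hun])
  have h2 := hA (c - u) (by simp [mem_closedBall, hun])
  have e1 : A (c + u) - A (c - u) = 2 * (r / ‖x - y‖) * (A x - A y) := by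
    have hl : ∀ a b : F, A a - A b = A.linear (a - b) := fun a b => by
      have := A.linearMap_vsub a b
      simpa using this.symm
    rw [hl, hl, show c + u - (c - u) = (2 : ℝ) • u by rw [two_smul]; abel, hu, map_smul, map_smul]
    simp only [smul_eq_mul]; ring
  have h3 : |A (c + u) - A (c - u)| ≤ 2 * M := (abs_sub _ _).trans (by linarith)
  rw [e1, abs_mul, abs_of_pos (by positivity)] at h3
  have h4 : 2 * (r / ‖x - y‖) * |A x - A y| * (‖x - y‖ / (2 * r)) ≤ 2 * M * (‖x - y‖ / (2 * r)) :=
    mul_le_mul_of_nonneg_right h3 (by positivity)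
  calc |A x - A y| = 2 * (r / ‖x - y‖) * |A x - A y| * (‖x - y‖ / (2 * r)) := by field_simp
    _ ≤ _ := h4
    _ = _ := by field_simp

end Simplices

noncomputable section Interpolation

open FracFEM

variable {d : ℕ}

/-- The vertex sets of the elements of a finite mesh. -/
def cells (K : Geometry.SimplicialComplex ℝ (EuclideanSpace ℝ (Fin d))) (hK : K.faces.Finite) :
    Finset (Finset (EuclideanSpace ℝ (Fin d))) :=
  {t ∈ hK.toFinset | t.card = d + 1}

variable {K : Geometry.SimplicialComplex ℝ (EuclideanSpace ℝ (Fin d))} {hK : K.faces.Finite}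
  {Ω : Set (EuclideanSpace ℝ (Fin d))} {t t' : Finset (EuclideanSpace ℝ (Fin d))}
  {x p : EuclideanSpace ℝ (Fin d)}

theorem mem_cells : t ∈ cells K hK ↔ t ∈ K.faces ∧ t.card = d + 1 := by
  simp [cells]

theorem convexHull_mem_elements (ht : t ∈ cells K hK) :
    convexHull ℝ (t : Set (EuclideanSpace ℝ (Fin d))) ∈ elements K :=
  ⟨t, (mem_cells.1 ht).1, (mem_cells.1 ht).2, rfl⟩

theorem mem_of_mem_convexHull_cells (ht : t ∈ cells K hK) (ht' : t' ∈ cells K hK) (hp : p ∈ t)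
    (hpt' : p ∈ convexHull ℝ (t' : Set (EuclideanSpace ℝ (Fin d)))) : p ∈ t' := by
  have hv : p ∈ K.vertices := by
    rw [K.vertices_eq]; exact Set.mem_biUnion (mem_cells.1 ht).1 hp
  exact (K.vertex_mem_convexHull_iff hv (mem_cells.1 ht').1).1 hpt'

theorem isCompact_convexHull_finset (t : Finset (EuclideanSpace ℝ (Fin d))) :
    IsCompact (convexHull ℝ (t : Set (EuclideanSpace ℝ (Fin d)))) :=
  t.finite_toSet.isCompact_convexHull ℝ

theorem dist_le_diam_convexHull {x y : EuclideanSpace ℝ (Fin d)}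
    (hx : x ∈ convexHull ℝ (t : Set (EuclideanSpace ℝ (Fin d))))
    (hy : y ∈ convexHull ℝ (t : Set (EuclideanSpace ℝ (Fin d)))) :
    ‖x - y‖ ≤ diam (convexHull ℝ (t : Set (EuclideanSpace ℝ (Fin d)))) := by
  rw [← dist_eq_norm]
  exact dist_le_diam_of_mem (isCompact_convexHull_finset t).isBounded hx hy

theorem mem_convexHull_of_mem (hp : p ∈ t) :
    p ∈ convexHull ℝ (t : Set (EuclideanSpace ℝ (Fin d))) :=
  subset_convexHull ℝ _ hp

/-- Every point of the triangulated set lies in an element: the lower dimensional faces are null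
sets, and the elements cover a closed set. -/
theorem exists_cell_of_mem_closure (hT : IsTriangulation K Ω) (hΩ : IsOpen Ω)
    (hx : x ∈ closure Ω) :
    ∃ t ∈ cells K hK, x ∈ convexHull ℝ (t : Set (EuclideanSpace ℝ (Fin d))) := by
  set U : Set (EuclideanSpace ℝ (Fin d)) :=
    ⋃ t ∈ cells K hK, convexHull ℝ (t : Set (EuclideanSpace ℝ (Fin d))) with hU
  have hUc : IsClosed U :=
    isClosed_biUnion_finset fun t _ => (isCompact_convexHull_finset t).isClosed
  set N : Set (EuclideanSpace ℝ (Fin d)) :=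
    ⋃ t ∈ {t | t ∈ K.faces ∧ t.card ≠ d + 1}, convexHull ℝ (t : Set (EuclideanSpace ℝ (Fin d)))
    with hN
  have hN0 : volume N = 0 := by
    rw [hN, measure_biUnion_null_iff]
    · exact fun t ht => volume_convexHull_eq_zero (K.indep ht.1) ht.2
    · exact (hK.subset fun t ht => ht.1).countable
  have hsub : Ω \ U ⊆ N := by
    rintro y ⟨hy, hyU⟩
    have : y ∈ K.space := by rw [hT.space_eq]; exact subset_closure hy
    obtain ⟨t, ht, hyt⟩ := Geometry.SimplicialComplex.mem_space_iff.1 this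
    refine Set.mem_biUnion (x := t) ⟨ht, fun hc => hyU ?_⟩ hyt
    exact Set.mem_biUnion (mem_cells.2 ⟨ht, hc⟩) hyt
  have hempty : Ω \ U = ∅ := by
    have ho : IsOpen (Ω \ U) := hΩ.sdiff hUc
    exact (ho.measure_eq_zero_iff volume).1 (measure_mono_null hsub hN0)
  have : closure Ω ⊆ U := closure_minimal (Set.sdiff_eq_empty.1 hempty) hUc
  simpa [hU] using this hx

/-- The affine function with the nodal values of `v` on the vertex set `t`. -/
def nodalAffine (t : Finset (EuclideanSpace ℝ (Fin d))) (v : EuclideanSpace ℝ (Fin d) → ℝ) :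
    EuclideanSpace ℝ (Fin d) →ᵃ[ℝ] ℝ :=
  open Classical in
  if h : ∃ A : EuclideanSpace ℝ (Fin d) →ᵃ[ℝ] ℝ, ∀ p ∈ t, A p = v p then h.choose else 0

theorem nodalAffine_apply (ht : t ∈ cells K hK) (v : EuclideanSpace ℝ (Fin d) → ℝ) (hp : p ∈ t) :
    nodalAffine t v p = v p := by
  have h := exists_affineMap_eq_on_of_affineIndependent (K.indep (mem_cells.1 ht).1)
    (mem_cells.1 ht).2 v
  rw [nodalAffine, dif_pos h]
  exact h.choose_spec p hp

variable (K hK) in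
/-- The piecewise affine interpolant of the nodal values of `v`, extended by zero outside of the
triangulated set. -/
def interp (v : EuclideanSpace ℝ (Fin d) → ℝ) (x : EuclideanSpace ℝ (Fin d)) : ℝ :=
  open Classical in
  if h : ∃ t ∈ cells K hK, x ∈ convexHull ℝ (t : Set (EuclideanSpace ℝ (Fin d))) then
    nodalAffine h.choose v x else 0

theorem interp_eq_of_affine (ht : t ∈ cells K hK) {v : EuclideanSpace ℝ (Fin d) → ℝ}
    {A : EuclideanSpace ℝ (Fin d) →ᵃ[ℝ] ℝ} (hA : ∀ p ∈ t, A p = v p)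
    (hx : x ∈ convexHull ℝ (t : Set (EuclideanSpace ℝ (Fin d)))) :
    interp K hK v x = A x := by
  have h : ∃ t ∈ cells K hK, x ∈ convexHull ℝ (t : Set (EuclideanSpace ℝ (Fin d))) := ⟨t, ht, hx⟩
  rw [interp, dif_pos h]
  have h1 := h.choose_spec.1
  have h2 := h.choose_spec.2
  have h3 := K.inter_subset_convexHull (mem_cells.1 h1).1 (mem_cells.1 ht).1 ⟨h2, hx⟩
  refine AffineMap.eqOn_convexHull_of_eqOn (fun p hp => ?_) h3
  rw [nodalAffine_apply h1 v hp.1, hA p hp.2]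

theorem interp_eq_nodalAffine (ht : t ∈ cells K hK) (v : EuclideanSpace ℝ (Fin d) → ℝ)
    (hx : x ∈ convexHull ℝ (t : Set (EuclideanSpace ℝ (Fin d)))) :
    interp K hK v x = nodalAffine t v x :=
  interp_eq_of_affine ht (fun _ hp => nodalAffine_apply ht v hp) hx

/-- Barycentric coordinates: the interpolant at a point of an element is a convex combination of
the nodal values, with weights independent of the interpolated function. -/
theorem exists_weights_interp (ht : t ∈ cells K hK)
    (hx : x ∈ convexHull ℝ (t : Set (EuclideanSpace ℝ (Fin d)))) :
    ∃ c : EuclideanSpace ℝ (Fin d) → ℝ, (∀ p ∈ t, 0 ≤ c p) ∧ ∑ p ∈ t, c p = 1 ∧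
      ∀ v, interp K hK v x = ∑ p ∈ t, c p * v p := by
  obtain ⟨c, hc0, hc1, hc⟩ := exists_weights_of_mem_convexHull hx
  refine ⟨c, hc0, hc1, fun v => ?_⟩
  rw [interp_eq_nodalAffine ht v hx, hc]
  exact Finset.sum_congr rfl fun p hp => by rw [nodalAffine_apply ht v hp]

theorem abs_interp_le (ht : t ∈ cells K hK)
    (hx : x ∈ convexHull ℝ (t : Set (EuclideanSpace ℝ (Fin d)))) {v : EuclideanSpace ℝ (Fin d) → ℝ}
    {M : ℝ} (hv : ∀ p ∈ t, |v p| ≤ M) : |interp K hK v x| ≤ M := by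
  obtain ⟨c, hc0, hc1, hc⟩ := exists_weights_interp ht hx
  rw [hc]
  calc |∑ p ∈ t, c p * v p| ≤ ∑ p ∈ t, |c p * v p| := Finset.abs_sum_le_sum_abs _ _
    _ ≤ ∑ p ∈ t, c p * M := Finset.sum_le_sum fun p hp => by
        rw [abs_mul, abs_of_nonneg (hc0 p hp)]
        exact mul_le_mul_of_nonneg_left (hv p hp) (hc0 p hp)
    _ = M := by rw [← Finset.sum_mul, hc1, one_mul]

theorem interp_eq_zero_of_notMem
    (h : ∀ t ∈ cells K hK, x ∉ convexHull ℝ (t : Set (EuclideanSpace ℝ (Fin d))))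
    (v : EuclideanSpace ℝ (Fin d) → ℝ) : interp K hK v x = 0 := by
  rw [interp, dif_neg]
  rintro ⟨t, ht, hx⟩
  exact h t ht hx

theorem interp_linear_comb (u v w : EuclideanSpace ℝ (Fin d) → ℝ) (a b : ℝ)
    (h : ∀ p, u p = a * v p + b * w p) (x : EuclideanSpace ℝ (Fin d)) :
    interp K hK u x = a * interp K hK v x + b * interp K hK w x := by
  by_cases hx : ∃ t ∈ cells K hK, x ∈ convexHull ℝ (t : Set (EuclideanSpace ℝ (Fin d)))
  · obtain ⟨t, ht, hx⟩ := hx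
    obtain ⟨c, -, -, hc⟩ := exists_weights_interp ht hx
    simp_rw [hc, h, Finset.mul_sum, ← Finset.sum_add_distrib]
    exact Finset.sum_congr rfl fun p _ => by ring
  · push Not at hx
    simp [interp_eq_zero_of_notMem hx]

theorem interp_self_of_mem_feSpace {w : EuclideanSpace ℝ (Fin d) → ℝ} (hw : w ∈ feSpace K Ω)
    (ht : t ∈ cells K hK) (hx : x ∈ convexHull ℝ (t : Set (EuclideanSpace ℝ (Fin d)))) :
    interp K hK w x = w x := by
  obtain ⟨A, hA⟩ := hw.2.2 _ (convexHull_mem_elements ht)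
  rw [interp_eq_of_affine ht (fun p hp => (hA (mem_convexHull_of_mem hp)).symm) hx, hA hx]

theorem continuousOn_interp (hT : IsTriangulation K Ω) (hΩ : IsOpen Ω)
    (v : EuclideanSpace ℝ (Fin d) → ℝ) : ContinuousOn (interp K hK v) (closure Ω) := by
  have h : ContinuousOn (interp K hK v) (⋃ t : cells K hK,
      convexHull ℝ ((t : Finset (EuclideanSpace ℝ (Fin d))) : Set (EuclideanSpace ℝ (Fin d)))) := by
    refine LocallyFinite.continuousOn_iUnion (locallyFinite_of_finite _)
      (fun t => (isCompact_convexHull_finset _).isClosed) fun t => ?_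
    have : Set.EqOn (interp K hK v) (nodalAffine t.1 v) (convexHull ℝ (t.1 : Set _)) :=
      fun y hy => interp_eq_nodalAffine t.2 v hy
    exact ((nodalAffine t.1 v).continuous_of_finiteDimensional).continuousOn.congr this
  refine h.mono fun y hy => ?_
  obtain ⟨t, ht, hyt⟩ := exists_cell_of_mem_closure (hK := hK) hT hΩ hy
  exact Set.mem_iUnion.2 ⟨⟨t, ht⟩, hyt⟩

/-- If the nodal values are concentrated in a ball whose neighbouring elements stay well inside
`ball x₀ R ⊆ Ω`, the interpolant is a local discrete function. -/
theorem interp_mem_feSpaceOn (hT : IsTriangulation K Ω) (hΩ : IsOpen Ω)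
    {x₀ : EuclideanSpace ℝ (Fin d)} {R r h : ℝ} (hB : ball x₀ R ⊆ Ω) (hrR : r + h ≤ R) (h0 : 0 ≤ h)
    (hh : ∀ t ∈ cells K hK, ∀ q ∈ t, q ∈ ball x₀ R →
      diam (convexHull ℝ (t : Set (EuclideanSpace ℝ (Fin d)))) ≤ h)
    {v : EuclideanSpace ℝ (Fin d) → ℝ} (hv : ∀ q, q ∉ ball x₀ r → v q = 0) :
    interp K hK v ∈ feSpaceOn K Ω (ball x₀ R) ∧ ∀ x, x ∉ ball x₀ (r + h) → interp K hK v x = 0 := by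
  have hzero : ∀ x, x ∉ ball x₀ (r + h) → interp K hK v x = 0 := by
    intro x hx
    by_cases hxt : ∃ t ∈ cells K hK, x ∈ convexHull ℝ (t : Set (EuclideanSpace ℝ (Fin d)))
    · obtain ⟨t, ht, hxt⟩ := hxt
      have : ∀ q ∈ t, |v q| ≤ 0 := by
        intro q hq
        by_cases hqr : q ∈ ball x₀ r
        · exfalso
          have h1 := hh t ht q hq (ball_subset_ball (by linarith) hqr)
          have h2 := dist_le_diam_convexHull hxt (mem_convexHull_of_mem hq)
          apply hx
          rw [mem_ball] at hqr ⊢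
          rw [← dist_eq_norm] at h2
          linarith [dist_triangle x q x₀]
        · simp [hv q hqr]
      exact abs_nonpos_iff.1 (abs_interp_le ht hxt this)
    · push Not at hxt
      exact interp_eq_zero_of_notMem hxt v
  refine ⟨⟨⟨?_, fun x hx => hzero x fun h' => hx (hB (ball_subset_ball hrR h')), ?_⟩,
    fun x hx => hzero x fun h' => hx (ball_subset_ball hrR h')⟩, hzero⟩
  · rw [← continuousOn_univ]
    have hc2 : ContinuousOn (interp K hK v) (ball x₀ (r + h))ᶜ :=
      continuousOn_const.congr (f := fun _ => (0 : ℝ)) fun x hx => hzero x hx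
    refine ((continuousOn_interp hT hΩ v).union_of_isClosed hc2 isClosed_closure
      isOpen_ball.isClosed_compl).mono fun x _ => ?_
    by_cases hx : x ∈ ball x₀ (r + h)
    · exact Or.inl (subset_closure (hB (ball_subset_ball hrR hx)))
    · exact Or.inr hx
  · rintro T ⟨t, ht, hc, rfl⟩
    exact ⟨nodalAffine t v, fun x hx => interp_eq_nodalAffine (mem_cells.2 ⟨ht, hc⟩) v hx⟩

/-- Discrete functions are Lipschitz. -/
theorem exists_lipschitz_of_mem_feSpace (hT : IsTriangulation K Ω) (hΩ : IsOpen Ω)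
    {w : EuclideanSpace ℝ (Fin d) → ℝ} (hw : w ∈ feSpace K Ω) :
    ∃ L : ℝ, 0 ≤ L ∧ ∀ x y, |w x - w y| ≤ L * ‖x - y‖ := by
  have hlip : ∀ T ∈ elements K, ∃ L : ℝ, 0 ≤ L ∧ ∀ x ∈ T, ∀ y ∈ T, |w x - w y| ≤ L * ‖x - y‖ := by
    intro T hTe
    obtain ⟨A, hA⟩ := hw.2.2 T hTe
    refine ⟨‖A.linear.toContinuousLinearMap‖, norm_nonneg _, fun x hx y hy => ?_⟩
    rw [hA hx, hA hy]
    have : A x - A y = A.linear.toContinuousLinearMap (x - y) := by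
      have := A.linearMap_vsub x y
      simpa using this.symm
    rw [this, ← Real.norm_eq_abs]
    exact A.linear.toContinuousLinearMap.le_opNorm (x - y)
  choose! L hL0 hL using hlip
  have hfin : K.faces.Finite := hT.finite_faces
  -- the cover consists of the elements and, for the index `none`, the complement of `Ω`
  set S : Option (cells K hfin) → Set (EuclideanSpace ℝ (Fin d)) := fun i =>
    i.elim Ωᶜ fun t => convexHull ℝ (t.1 : Set (EuclideanSpace ℝ (Fin d))) with hS
  set Lmax : ℝ := ∑ t ∈ cells K hfin, L (convexHull ℝ (t : Set (EuclideanSpace ℝ (Fin d)))) with hLm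
  have hLmax : ∀ t ∈ cells K hfin, L (convexHull ℝ (t : Set (EuclideanSpace ℝ (Fin d)))) ≤ Lmax :=
    fun t ht => Finset.single_le_sum
      (f := fun t : Finset (EuclideanSpace ℝ (Fin d)) => L (convexHull ℝ (t : Set _)))
      (fun t ht => hL0 _ (convexHull_mem_elements ht)) ht
  have hLmax0 : 0 ≤ Lmax := Finset.sum_nonneg fun t ht => hL0 _ (convexHull_mem_elements ht)
  refine ⟨Lmax, hLmax0, fun x y => ?_⟩
  refine abs_sub_le_of_segment_subset_biUnion Finset.univ S ?_ ?_ hw.1.continuousOn ?_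
  · rintro (_ | t) -
    · exact hΩ.isClosed_compl
    · exact (isCompact_convexHull_finset _).isClosed
  · intro z _
    by_cases hz : z ∈ Ω
    · obtain ⟨t, ht, hzt⟩ := exists_cell_of_mem_closure (hK := hfin) hT hΩ (subset_closure hz)
      have hzS : z ∈ S (some ⟨t, ht⟩) := hzt
      exact Set.mem_biUnion (Finset.mem_univ _) hzS
    · exact Set.mem_biUnion (x := none) (Finset.mem_univ _) hz
  · rintro (_ | t) - a ha b hb - -
    · rw [hw.2.1 a ha, hw.2.1 b hb, sub_zero, abs_zero]
      positivity
    · refine (hL _ (convexHull_mem_elements t.2) a ha b hb).trans ?_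
      exact mul_le_mul_of_nonneg_right (hLmax t.1 t.2) (norm_nonneg _)

/-- Discrete functions have finite fractional energy, for all `s < 1`, since they are Lipschitz with
bounded support. -/
theorem memHs_of_mem_feSpace (hd : 1 ≤ d) {s : ℝ} (hs0 : 0 < s) (hs1 : s < 1)
    (hT : IsTriangulation K Ω) (hΩ : IsOpen Ω) {w : EuclideanSpace ℝ (Fin d) → ℝ}
    (hw : w ∈ feSpace K Ω) : MemHs s w := by
  have hfin : K.faces.Finite := hT.finite_faces
  have hcomp : IsCompact (closure Ω) := by
    rw [← hT.space_eq]
    exact hfin.isCompact_biUnion fun t _ => isCompact_convexHull_finset t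
  obtain ⟨ρ, hρ⟩ := hcomp.isBounded.subset_ball (0 : EuclideanSpace ℝ (Fin d))
  obtain ⟨L, hL0, hL⟩ := exists_lipschitz_of_mem_feSpace hT hΩ hw
  have hcs : HasCompactSupport w :=
    HasCompactSupport.intro hcomp fun x hx => hw.2.1 x fun h => hx (subset_closure h)
  obtain ⟨M, hM⟩ := hw.1.bounded_above_of_compact_support hcs
  refine ⟨hw.1.memLp_of_hasCompactSupport hcs, ?_⟩
  have hfr : Module.finrank ℝ (EuclideanSpace ℝ (Fin d)) = d := finrank_euclideanSpace_fin
  have := lintegral_energy_lt_top_of_lipschitz (E := EuclideanSpace ℝ (Fin d)) volume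
    (by rw [hfr]; exact hd) hs0 hs1 hL hM
    (fun x hx => hw.2.1 x fun h => hx (hρ (subset_closure h)))
  rw [hfr] at this
  rw [hsSeminormSq, Set.univ_prod_univ, Measure.restrict_univ]
  exact this

end Interpolation

/-! ### Shape regularity and comparability of neighbouring elements -/

section ShapeRegular

open FracFEM

variable {d : ℕ}
variable {K : Geometry.SimplicialComplex ℝ (EuclideanSpace ℝ (Fin d))} {hK : K.faces.Finite}
  {Ω : Set (EuclideanSpace ℝ (Fin d))} {t t' : Finset (EuclideanSpace ℝ (Fin d))}
  {x p : EuclideanSpace ℝ (Fin d)} {μ : ℝ}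

/-- The diameter `h_T` of the simplex `T` with vertex set `t`. -/
noncomputable def cellDiam (t : Finset (EuclideanSpace ℝ (Fin d))) : ℝ :=
  diam (convexHull ℝ (t : Set (EuclideanSpace ℝ (Fin d))))

/-- Quantitative nondegeneracy of all elements: each contains a ball whose radius is at least `μ`
times the diameter of the element. -/
structure IsFat (K : Geometry.SimplicialComplex ℝ (EuclideanSpace ℝ (Fin d)))
    (hK : K.faces.Finite) (μ : ℝ) : Prop where
  pos : 0 < μ
  diam_pos : ∀ t ∈ cells K hK, 0 < cellDiam t
  exists_ball : ∀ t ∈ cells K hK, ∃ c, closedBall c (μ * cellDiam t) ⊆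
    convexHull ℝ (t : Set (EuclideanSpace ℝ (Fin d)))

/-- Shape regularity provides balls inside the elements. The constant `1 / (4 σ)` replaces the optimal
radius `1 / (2 σ)`, so that it does not matter whether the supremum in `inballDiam` is attained. -/
theorem IsShapeRegular.isFat (hd : 1 ≤ d) {σ : ℝ} (hσ : IsShapeRegular K σ)
    (hne : (cells K hK).Nonempty) : 0 < σ ∧ IsFat K hK (1 / (4 * σ)) := by
  have hnt : Nontrivial (EuclideanSpace ℝ (Fin d)) :=
    Module.nontrivial_of_finrank_pos (R := ℝ) (by rw [finrank_euclideanSpace_fin]; omega)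
  obtain ⟨v, hv⟩ := exists_norm_eq (EuclideanSpace ℝ (Fin d)) (zero_le_one (α := ℝ))
  have key : ∀ t ∈ cells K hK, 0 < cellDiam t ∧ 0 < σ ∧ ∃ c, closedBall c (1 / (4 * σ) * cellDiam t)
      ⊆ convexHull ℝ (t : Set (EuclideanSpace ℝ (Fin d))) := by
    intro t ht
    set T := convexHull ℝ (t : Set (EuclideanSpace ℝ (Fin d))) with hT
    set P : Set ℝ := {ρ : ℝ | 0 ≤ ρ ∧ ∃ c, closedBall c (ρ / 2) ⊆ T} with hP
    have hle : ∀ ρ ∈ P, ρ ≤ cellDiam t := by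
      rintro ρ ⟨hρ, c, hc⟩
      have h1 : c + (ρ / 2) • v ∈ T := hc (by
        simp [mem_closedBall, norm_smul, hv, abs_of_nonneg hρ])
      have h2 : c - (ρ / 2) • v ∈ T := hc (by
        simp [mem_closedBall, norm_smul, hv, abs_of_nonneg hρ])
      have h3 := dist_le_diam_convexHull h1 h2
      rw [show c + (ρ / 2) • v - (c - (ρ / 2) • v) = ρ • v by module, norm_smul, hv, mul_one,
        Real.norm_of_nonneg hρ] at h3
      exact h3
    have hbdd : BddAbove P := ⟨_, hle⟩
    have htop : affineSpan ℝ (t : Set (EuclideanSpace ℝ (Fin d))) = ⊤ := by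
      have h := (K.indep (mem_cells.1 ht).1).affineSpan_eq_top_iff_card_eq_finrank_add_one
      simp only [Subtype.range_coe_subtype, Finset.setOfPred_mem, Fintype.card_coe,
        finrank_euclideanSpace_fin] at h
      exact h.2 (mem_cells.1 ht).2
    obtain ⟨c, hc⟩ := interior_convexHull_nonempty_iff_affineSpan_eq_top.2 htop
    obtain ⟨ε, hε, hcε⟩ := Metric.nhds_basis_closedBall.mem_iff.1 (mem_interior_iff_mem_nhds.1 hc)
    have hmem : 2 * ε ∈ P := ⟨by positivity, c, by simpa using hcε⟩
    have hin : 0 < inballDiam T := lt_of_lt_of_le (by positivity) (le_csSup hbdd hmem)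
    have hdp : 0 < cellDiam t := lt_of_lt_of_le (by positivity) (hle _ hmem)
    have hreg := hσ T (convexHull_mem_elements ht)
    have hσ0 : 0 < σ := lt_of_lt_of_le (div_pos hdp hin) hreg
    refine ⟨hdp, hσ0, ?_⟩
    have hreg' : cellDiam t ≤ σ * inballDiam T := (div_le_iff₀ hin).1 hreg
    obtain ⟨ρ, ⟨hρ0, c', hc'⟩, hρ⟩ := exists_lt_of_lt_csSup ⟨_, hmem⟩
      (show inballDiam T / 2 < sSup P from half_lt_self hin)
    refine ⟨c', (closedBall_subset_closedBall ?_).trans hc'⟩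
    rw [one_div, inv_mul_le_iff₀ (by positivity)]
    nlinarith
  obtain ⟨t₀, ht₀⟩ := hne
  have hσ0 := (key t₀ ht₀).2.1
  exact ⟨hσ0, by positivity, fun t ht => (key t ht).1, fun t ht => (key t ht).2.2⟩

theorem IsFat.abs_interp_sub_le (hF : IsFat K hK μ) (ht : t ∈ cells K hK)
    {v : EuclideanSpace ℝ (Fin d) → ℝ} {M : ℝ} (hv : ∀ q ∈ t, |v q| ≤ M)
    {x y : EuclideanSpace ℝ (Fin d)} (hx : x ∈ convexHull ℝ (t : Set (EuclideanSpace ℝ (Fin d))))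
    (hy : y ∈ convexHull ℝ (t : Set (EuclideanSpace ℝ (Fin d)))) :
    |interp K hK v x - interp K hK v y| ≤ M / (μ * cellDiam t) * ‖x - y‖ := by
  obtain ⟨c, hc⟩ := hF.exists_ball t ht
  rw [interp_eq_nodalAffine ht v hx, interp_eq_nodalAffine ht v hy]
  refine (nodalAffine t v).abs_sub_le_of_closedBall (c := c)
    (mul_pos hF.pos (hF.diam_pos t ht)) (fun z hz => ?_) x y
  rw [← interp_eq_nodalAffine ht v (hc hz)]
  exact abs_interp_le ht (hc hz) hv

/-- Edges of an element are comparable to its diameter. -/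
theorem IsFat.le_edge (hF : IsFat K hK μ) (ht : t ∈ cells K hK) {p q : EuclideanSpace ℝ (Fin d)}
    (hp : p ∈ t) (hq : q ∈ t) (hpq : p ≠ q) : μ * cellDiam t ≤ ‖p - q‖ := by
  classical
  have hpos : 0 < μ * cellDiam t := mul_pos hF.pos (hF.diam_pos t ht)
  have h := hF.abs_interp_sub_le ht (v := fun z => if z = p then 1 else 0) (M := 1)
    (fun z _ => by split_ifs <;> simp) (mem_convexHull_of_mem hp) (mem_convexHull_of_mem hq)
  rw [interp_eq_nodalAffine ht _ (mem_convexHull_of_mem hp),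
    interp_eq_nodalAffine ht _ (mem_convexHull_of_mem hq), nodalAffine_apply ht _ hp,
    nodalAffine_apply ht _ hq, if_pos rfl, if_neg hpq.symm, sub_zero, abs_one, one_div,
    inv_mul_eq_div, le_div_iff₀ hpos, one_mul] at h
  exact h

theorem exists_ne_mem_cell (hd : 1 ≤ d) (ht : t ∈ cells K hK) (p : EuclideanSpace ℝ (Fin d)) :
    ∃ q ∈ t, q ≠ p :=
  Finset.exists_mem_ne (by rw [(mem_cells.1 ht).2]; omega) p

theorem IsFat.le_one (hd : 1 ≤ d) (hF : IsFat K hK μ) (ht : t ∈ cells K hK) : μ ≤ 1 := by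
  obtain ⟨p, hp⟩ : t.Nonempty := Finset.card_pos.1 (by rw [(mem_cells.1 ht).2]; omega)
  obtain ⟨q, hq, hqp⟩ := exists_ne_mem_cell hd ht p
  have h1 := hF.le_edge ht hq hp hqp
  have h2 := dist_le_diam_convexHull (mem_convexHull_of_mem hq) (mem_convexHull_of_mem hp)
  have h3 := hF.diam_pos t ht
  by_contra hlt
  push Not at hlt
  change ‖q - p‖ ≤ cellDiam t at h2
  nlinarith

/-- Distinct elements meet in a common face of lower dimension. -/
theorem volume_inter_cells_eq_zero (ht : t ∈ cells K hK) (ht' : t' ∈ cells K hK) (hne : t ≠ t') :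
    volume (convexHull ℝ (t : Set (EuclideanSpace ℝ (Fin d))) ∩ convexHull ℝ (t' : Set _)) = 0 := by
  classical
  have h1 := K.inter_subset_convexHull (mem_cells.1 ht).1 (mem_cells.1 ht').1
  rw [← Finset.coe_inter] at h1
  refine measure_mono_null h1 (volume_convexHull_eq_zero ?_ ?_)
  · exact (K.indep (mem_cells.1 ht).1).mono (Finset.coe_subset.2 Finset.inter_subset_left)
  · intro hc
    have e1 := Finset.eq_of_subset_of_card_le (Finset.inter_subset_left (s₁ := t) (s₂ := t'))
      (by rw [hc, (mem_cells.1 ht).2])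
    have e2 := Finset.eq_of_subset_of_card_le (Finset.inter_subset_right (s₁ := t) (s₂ := t'))
      (by rw [hc, (mem_cells.1 ht').2])
    exact hne (e1.symm.trans e2)

/-- Scaling the inscribed ball of an element towards one of its vertices. -/
theorem IsFat.exists_small_ball (hF : IsFat K hK μ) (ht : t ∈ cells K hK)
    (hp : p ∈ t) {r : ℝ} (hr0 : 0 ≤ r) (hr : r ≤ cellDiam t) :
    ∃ c, ‖c - p‖ ≤ r ∧ ∀ z ∈ closedBall c (μ * r), ∃ y ∈ convexHull ℝ
      (t : Set (EuclideanSpace ℝ (Fin d))), z = p + (r / cellDiam t) • (y - p) := by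
  obtain ⟨c, hc⟩ := hF.exists_ball t ht
  have hh := hF.diam_pos t ht
  rcases hr0.eq_or_lt with rfl | hr0
  · refine ⟨p, by simp, fun z hz => ⟨p, mem_convexHull_of_mem hp, ?_⟩⟩
    simpa using hz
  have hcT : c ∈ convexHull ℝ (t : Set (EuclideanSpace ℝ (Fin d))) :=
    hc (mem_closedBall_self (mul_pos hF.pos hh).le)
  have hcp := dist_le_diam_convexHull hcT (mem_convexHull_of_mem hp)
  change ‖c - p‖ ≤ cellDiam t at hcp
  refine ⟨p + (r / cellDiam t) • (c - p), ?_, fun z hz => ?_⟩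
  · rw [add_sub_cancel_left, norm_smul, Real.norm_of_nonneg (by positivity)]
    calc _ ≤ r / cellDiam t * cellDiam t := by gcongr
      _ = r := by field_simp
  · refine ⟨p + (cellDiam t / r) • (z - p), hc ?_, ?_⟩
    · rw [mem_closedBall, dist_eq_norm] at hz ⊢
      have e : p + (cellDiam t / r) • (z - p) - c =
          (cellDiam t / r) • (z - (p + (r / cellDiam t) • (c - p))) := by
        have : (cellDiam t / r) • (r / cellDiam t) • (c - p) = c - p := by
          rw [smul_smul, show cellDiam t / r * (r / cellDiam t) = 1 by field_simp, one_smul]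
        rw [show z - (p + (r / cellDiam t) • (c - p)) = (z - p) - (r / cellDiam t) • (c - p) by abel,
          smul_sub (cellDiam t / r) (z - p), this]
        abel
      rw [e, norm_smul, Real.norm_of_nonneg (by positivity)]
      calc _ ≤ cellDiam t / r * (μ * r) := by gcongr
        _ = _ := by field_simp
    · rw [add_sub_cancel_left, smul_smul, show r / cellDiam t * (cellDiam t / r) = 1 by field_simp,
        one_smul]
      abel

theorem segment_point_mem_convexHull (hp : p ∈ t) {y : EuclideanSpace ℝ (Fin d)} {θ : ℝ}
    (hy : y ∈ convexHull ℝ (t : Set (EuclideanSpace ℝ (Fin d)))) (h0 : 0 ≤ θ) (h1 : θ ≤ 1) :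
    p + θ • (y - p) ∈ convexHull ℝ (t : Set (EuclideanSpace ℝ (Fin d))) :=
  (convex_convexHull ℝ _).add_smul_sub_mem (mem_convexHull_of_mem hp) hy ⟨h0, h1⟩

/-- The number of elements at a vertex is bounded: near the vertex they contain disjoint balls of
comparable size. -/
theorem IsFat.card_cells_at_le (hd : 1 ≤ d) (hF : IsFat K hK μ) (p : EuclideanSpace ℝ (Fin d)) :
    (({t ∈ cells K hK | p ∈ t} : Finset _).card : ℝ) ≤ (2 / μ) ^ d := by
  classical
  set S : Finset (Finset (EuclideanSpace ℝ (Fin d))) := {t ∈ cells K hK | p ∈ t} with hS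
  have hSm : ∀ {t}, t ∈ S → t ∈ cells K hK ∧ p ∈ t := fun h => Finset.mem_filter.1 h
  rcases S.eq_empty_or_nonempty with h0 | hne
  · rw [h0]; have := hF.pos; simp; positivity
  obtain ⟨t₀, ht₀, hmin⟩ := S.exists_min_image cellDiam hne
  set r := cellDiam t₀ with hr
  have hr0 : 0 < r := hF.diam_pos _ (hSm ht₀).1
  have hμ1 := hF.le_one hd (hSm ht₀).1
  have hμ0 := hF.pos
  have hball : ∀ t ∈ S, ∃ c, ‖c - p‖ ≤ r ∧
      ball c (μ * r) ⊆ convexHull ℝ (t : Set (EuclideanSpace ℝ (Fin d))) := by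
    intro t ht
    obtain ⟨c, hc1, hc2⟩ := hF.exists_small_ball (hSm ht).1 (hSm ht).2 hr0.le (hmin t ht)
    refine ⟨c, hc1, fun z hz => ?_⟩
    obtain ⟨y, hy, rfl⟩ := hc2 z (ball_subset_closedBall hz)
    have := hF.diam_pos _ (hSm ht).1
    exact segment_point_mem_convexHull (hSm ht).2 hy (by positivity)
      ((div_le_one this).2 (hmin t ht))
  choose! c hc1 hc2 using hball
  have hdisj : Set.PairwiseDisjoint (S : Set (Finset (EuclideanSpace ℝ (Fin d))))
      fun t => ball (c t) (μ * r) := by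
    intro t ht t' ht' hne
    rw [Function.onFun, Set.disjoint_iff_inter_eq_empty]
    refine ((isOpen_ball.inter isOpen_ball).measure_eq_zero_iff volume).1 ?_
    exact measure_mono_null (Set.inter_subset_inter (hc2 t ht) (hc2 t' ht'))
      (volume_inter_cells_eq_zero (hSm ht).1 (hSm ht').1 hne)
  have hsub : (⋃ t ∈ S, ball (c t) (μ * r)) ⊆ ball p (2 * r) := by
    refine Set.iUnion₂_subset fun t ht z hz => ?_
    rw [mem_ball, dist_eq_norm] at hz ⊢
    calc ‖z - p‖ ≤ ‖z - c t‖ + ‖c t - p‖ := norm_sub_le_norm_sub_add_norm_sub _ _ _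
      _ < μ * r + r := by linarith [hc1 t ht]
      _ ≤ 2 * r := by nlinarith
  have hmeas := measure_mono (μ := volume) hsub
  rw [measure_biUnion_finset hdisj fun t _ => measurableSet_ball] at hmeas
  have hfr : Module.finrank ℝ (EuclideanSpace ℝ (Fin d)) = d := finrank_euclideanSpace_fin
  have hb0 : volume (ball (0 : EuclideanSpace ℝ (Fin d)) 1) ≠ 0 :=
    (measure_ball_pos volume _ one_pos).ne'
  have hbt : volume (ball (0 : EuclideanSpace ℝ (Fin d)) 1) ≠ ∞ := measure_ball_lt_top.ne
  rw [Finset.sum_congr rfl fun t _ => Measure.addHaar_ball_of_pos volume (c t) (mul_pos hμ0 hr0),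
    Measure.addHaar_ball_of_pos volume p (by positivity), Finset.sum_const, hfr, nsmul_eq_mul,
    ← mul_assoc, ENNReal.mul_le_mul_iff_left hb0 hbt, ← ENNReal.ofReal_natCast,
    ← ENNReal.ofReal_mul (by positivity), ENNReal.ofReal_le_ofReal_iff (by positivity),
    mul_pow, mul_pow, ← mul_assoc] at hmeas
  have h3 : (S.card : ℝ) * μ ^ d ≤ 2 ^ d := le_of_mul_le_mul_right hmeas (by positivity)
  rw [div_pow, le_div_iff₀ (by positivity)]
  exact h3

/-- In dimension at least two, the elements at an interior vertex are linked through common further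
vertices: a small sphere around the vertex is connected. -/
theorem exists_common_vertex (hd : 2 ≤ d) (hT : IsTriangulation K Ω) (hΩ : IsOpen Ω) (hp : p ∈ Ω)
    {A : Finset (Finset (EuclideanSpace ℝ (Fin d)))} (hA : A ⊆ {t ∈ cells K hK | p ∈ t})
    (hne : A.Nonempty) (hA' : A ≠ {t ∈ cells K hK | p ∈ t}) :
    ∃ t ∈ A, ∃ t' ∈ cells K hK, p ∈ t' ∧ t' ∉ A ∧ ∃ q, q ≠ p ∧ q ∈ t ∧ q ∈ t' := by
  classical
  by_contra hcon
  push Not at hcon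
  set S : Finset (Finset (EuclideanSpace ℝ (Fin d))) := {t ∈ cells K hK | p ∈ t} with hS
  have hSm : ∀ {t}, t ∈ S ↔ t ∈ cells K hK ∧ p ∈ t := Finset.mem_filter
  obtain ⟨t₁, ht₁S, ht₁A⟩ : ∃ t ∈ S, t ∉ A := by
    by_contra h
    push Not at h
    exact hA' (Finset.Subset.antisymm hA h)
  obtain ⟨t₀, ht₀⟩ := hne
  -- a sufficiently small radius
  have hpos : ∀ᶠ r in nhdsWithin (0 : ℝ) (Set.Ioi 0), 0 < r := self_mem_nhdsWithin
  have hC1 : ∀ᶠ r in nhdsWithin (0 : ℝ) (Set.Ioi 0), closedBall p r ⊆ Ω := by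
    obtain ⟨ε, hε, hεΩ⟩ := Metric.isOpen_iff.1 hΩ p hp
    filter_upwards [Ioo_mem_nhdsGT hε] with r hr
    exact (closedBall_subset_ball hr.2).trans hεΩ
  have hC2 : ∀ᶠ r in nhdsWithin (0 : ℝ) (Set.Ioi 0), ∀ t ∈ cells K hK, p ∉ t →
      ∀ x ∈ convexHull ℝ (t : Set (EuclideanSpace ℝ (Fin d))), r < ‖x - p‖ := by
    refine (Filter.eventually_all_finset _).2 fun t ht => ?_
    by_cases hpt : p ∈ t
    · exact Filter.Eventually.of_forall fun r h => absurd hpt h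
    have hpc : p ∉ convexHull ℝ (t : Set (EuclideanSpace ℝ (Fin d))) := fun h =>
      hpt (mem_of_mem_convexHull_cells (hSm.1 ht₁S).1 ht (hSm.1 ht₁S).2 h)
    obtain ⟨ε, hε, hεd⟩ := Metric.isOpen_iff.1
      (isCompact_convexHull_finset t).isClosed.isOpen_compl p hpc
    filter_upwards [Ioo_mem_nhdsGT hε] with r hr _ x hx
    by_contra hlt
    push Not at hlt
    exact hεd (mem_ball_iff_norm.2 (hlt.trans_lt hr.2)) hx
  have hC3 : ∀ᶠ r in nhdsWithin (0 : ℝ) (Set.Ioi 0), ∀ t ∈ S,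
      ∃ x ∈ convexHull ℝ (t : Set (EuclideanSpace ℝ (Fin d))), ‖x - p‖ = r := by
    refine (Filter.eventually_all_finset _).2 fun t ht => ?_
    obtain ⟨q, hq, hqp⟩ := exists_ne_mem_cell (by omega) (hSm.1 ht).1 p
    have hn : 0 < ‖q - p‖ := norm_pos_iff.2 (sub_ne_zero.2 hqp)
    filter_upwards [Ioo_mem_nhdsGT hn] with r hr
    refine ⟨p + (r / ‖q - p‖) • (q - p), segment_point_mem_convexHull (hSm.1 ht).2
      (mem_convexHull_of_mem hq) (div_nonneg hr.1.le hn.le) ((div_le_one hn).2 hr.2.le), ?_⟩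
    rw [add_sub_cancel_left, norm_smul, Real.norm_of_nonneg (div_nonneg hr.1.le hn.le),
      div_mul_cancel₀ _ hn.ne']
  obtain ⟨r, hr0, h1, h2, h3⟩ := (hpos.and (hC1.and (hC2.and hC3))).exists
  -- the elements of `A` and the remaining ones at `p` cover the connected sphere by two closed sets, so
  -- they share a point off `p`, hence a vertex other than `p`
  have hrank : 1 < Module.rank ℝ (EuclideanSpace ℝ (Fin d)) := by
    rw [← Module.finrank_eq_rank, finrank_euclideanSpace_fin]
    exact_mod_cast hd
  have hconn := isPreconnected_sphere hrank p r
  rw [isPreconnected_closed_iff] at hconn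
  have hclosed : ∀ B : Finset (Finset (EuclideanSpace ℝ (Fin d))),
      IsClosed (⋃ t ∈ B, convexHull ℝ (t : Set (EuclideanSpace ℝ (Fin d)))) := fun B =>
    isClosed_biUnion_finset fun t _ => (isCompact_convexHull_finset t).isClosed
  obtain ⟨x, hxs, hxA, hxB⟩ := hconn _ _ (hclosed A) (hclosed (S \ A)) (by
      intro x hx
      rw [mem_sphere_iff_norm] at hx
      have hxΩ : x ∈ closure Ω := subset_closure (h1 (mem_closedBall_iff_norm.2 hx.le))
      obtain ⟨t, ht, hxt⟩ := exists_cell_of_mem_closure (hK := hK) hT hΩ hxΩ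
      have hpt : p ∈ t := by
        by_contra hpt
        exact (h2 t ht hpt x hxt).ne' hx
      by_cases htA : t ∈ A
      · exact Or.inl (Set.mem_biUnion htA hxt)
      · exact Or.inr (Set.mem_biUnion (Finset.mem_sdiff.2 ⟨hSm.2 ⟨ht, hpt⟩, htA⟩) hxt))
    (by
      obtain ⟨x, hx, hxr⟩ := h3 t₀ (hA ht₀)
      exact ⟨x, mem_sphere_iff_norm.2 hxr, Set.mem_biUnion ht₀ hx⟩)
    (by
      obtain ⟨x, hx, hxr⟩ := h3 t₁ ht₁S
      exact ⟨x, mem_sphere_iff_norm.2 hxr,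
        Set.mem_biUnion (Finset.mem_sdiff.2 ⟨ht₁S, ht₁A⟩) hx⟩)
  obtain ⟨t, ht, hxt⟩ := Set.mem_iUnion₂.1 hxA
  obtain ⟨t', ht', hxt'⟩ := Set.mem_iUnion₂.1 hxB
  have ht'2 := Finset.mem_sdiff.1 ht'
  have hmem := K.inter_subset_convexHull (mem_cells.1 (hSm.1 (hA ht)).1).1
    (mem_cells.1 (hSm.1 ht'2.1).1).1 ⟨hxt, hxt'⟩
  have hsub : (t : Set (EuclideanSpace ℝ (Fin d))) ∩ t' ⊆ {p} := by
    rintro q ⟨hq, hq'⟩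
    by_contra hqp
    exact hcon t ht t' (hSm.1 ht'2.1).1 (hSm.1 ht'2.1).2 ht'2.2 q hqp hq hq'
  have := convexHull_mono hsub hmem
  rw [convexHull_singleton, Set.mem_singleton_iff] at this
  rw [mem_sphere_iff_norm, this, sub_self, norm_zero] at hxs
  exact hr0.ne hxs

/-- In dimension at least two, elements sharing an interior vertex have comparable diameters. -/
theorem IsFat.cellDiam_le (hd : 2 ≤ d) (hF : IsFat K hK μ) (hT : IsTriangulation K Ω)
    (hΩ : IsOpen Ω) (hp : p ∈ Ω) (ht : t ∈ cells K hK) (hpt : p ∈ t) (ht' : t' ∈ cells K hK)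
    (hpt' : p ∈ t') : cellDiam t' ≤ (1 / μ) ^ (⌊(2 / μ) ^ d⌋₊) * cellDiam t := by
  classical
  set S : Finset (Finset (EuclideanSpace ℝ (Fin d))) := {t ∈ cells K hK | p ∈ t} with hS
  have hSm : ∀ {t}, t ∈ S ↔ t ∈ cells K hK ∧ p ∈ t := Finset.mem_filter
  have hμ0 := hF.pos
  have hμ1 : 1 ≤ 1 / μ := (one_le_div hμ0).2 (hF.le_one (by omega) ht)
  have hh := hF.diam_pos t ht
  set A : ℕ → Finset (Finset (EuclideanSpace ℝ (Fin d))) := fun k =>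
    {t' ∈ S | cellDiam t' ≤ (1 / μ) ^ k * cellDiam t} with hA
  have hAm : ∀ {k t'}, t' ∈ A k ↔ t' ∈ S ∧ cellDiam t' ≤ (1 / μ) ^ k * cellDiam t :=
    Finset.mem_filter
  have hmono : ∀ k, A k ⊆ A (k + 1) := fun k t'' h => by
    rw [hAm] at h ⊢
    refine ⟨h.1, h.2.trans ?_⟩
    gcongr
    exact Nat.le_succ k
  have htA : ∀ k, t ∈ A k := fun k => hAm.2 ⟨hSm.2 ⟨ht, hpt⟩, le_mul_of_one_le_left hh.le
    (one_le_pow₀ hμ1)⟩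
  -- as long as `A k` is not the whole star, an element sharing a further vertex with one of `A k`, and
  -- hence an edge, joins at the next step
  have grow : ∀ k, A k = S ∨ k + 1 ≤ (A k).card := by
    intro k
    induction k with
    | zero => exact Or.inr (Finset.card_pos.2 ⟨t, htA 0⟩)
    | succ k ih =>
      by_cases hk : A k = S
      · left
        exact Finset.Subset.antisymm (Finset.filter_subset _ _) (hk ▸ hmono k)
      right
      have ih := ih.resolve_left hk
      obtain ⟨t₁, ht₁, t₂, ht₂, hpt₂, ht₂A, q, hqp, hq1, hq2⟩ :=
        exists_common_vertex hd hT hΩ hp (Finset.filter_subset _ _) ⟨t, htA k⟩ hk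
      have hnew : t₂ ∈ A (k + 1) := by
        refine hAm.2 ⟨hSm.2 ⟨ht₂, hpt₂⟩, ?_⟩
        have ht₁' := hAm.1 ht₁
        have e1 := hF.le_edge ht₂ hq2 hpt₂ hqp
        have e2 := dist_le_diam_convexHull (mem_convexHull_of_mem hq1)
          (mem_convexHull_of_mem (hSm.1 ht₁'.1).2)
        change ‖q - p‖ ≤ cellDiam t₁ at e2
        have e3 : cellDiam t₂ ≤ 1 / μ * cellDiam t₁ := by
          rw [div_mul_eq_mul_div, one_mul, le_div_iff₀ hμ0]; linarith
        calc cellDiam t₂ ≤ 1 / μ * cellDiam t₁ := e3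
          _ ≤ 1 / μ * ((1 / μ) ^ k * cellDiam t) := by gcongr; exact ht₁'.2
          _ = _ := by rw [pow_succ]; ring
      have hss : A k ⊂ A (k + 1) := ⟨hmono k, fun h => ht₂A (h hnew)⟩
      have := Finset.card_lt_card hss
      omega
  have hcard : S.card ≤ ⌊(2 / μ) ^ d⌋₊ := Nat.le_floor (hF.card_cells_at_le (by omega) p)
  rcases grow ⌊(2 / μ) ^ d⌋₊ with h | h
  · exact (hAm.1 (h ▸ hSm.2 ⟨ht', hpt'⟩ : t' ∈ A _)).2
  · have hsub : A ⌊(2 / μ) ^ d⌋₊ ⊆ S := Finset.filter_subset _ _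
    have := Finset.card_le_card hsub
    omega

/-- Points close to an element lie in elements sharing a vertex with it, and interpolants are
Lipschitz between such points. The vertex is one with a large barycentric coordinate; its hat
function cannot vanish within a distance comparable to the diameter. -/
theorem IsFat.exists_vertex_of_near (hF : IsFat K hK μ) (hT : IsTriangulation K Ω)
    (hΩ : IsOpen Ω) {Λ : ℝ} (hΛ0 : 0 < Λ) (ht : t ∈ cells K hK)
    (hΛ : ∀ p ∈ t, ∀ t' ∈ cells K hK, p ∈ t' → cellDiam t ≤ Λ * cellDiam t')
    (hx : x ∈ convexHull ℝ (t : Set (EuclideanSpace ℝ (Fin d)))) :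
    ∃ p ∈ t, ∀ y, segment ℝ x y ⊆ Ω → ‖x - y‖ ≤ μ / (2 * Λ * (d + 1)) * cellDiam t →
      (∀ t' ∈ cells K hK, y ∈ convexHull ℝ (t' : Set (EuclideanSpace ℝ (Fin d))) → p ∈ t') ∧
      ∀ (v : EuclideanSpace ℝ (Fin d) → ℝ) (M : ℝ), 0 ≤ M →
        (∀ t' ∈ cells K hK, p ∈ t' → ∀ q ∈ t', |v q| ≤ M) →
        |interp K hK v x - interp K hK v y| ≤ M * Λ / (μ * cellDiam t) * ‖x - y‖ := by
  classical
  have hμ0 := hF.pos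
  have hh := hF.diam_pos t ht
  obtain ⟨c, hc0, hc1, hc⟩ := exists_weights_interp ht hx
  obtain ⟨p, hp, hcp⟩ : ∃ p ∈ t, 1 / ((d : ℝ) + 1) ≤ c p := by
    have hcard : (t.card : ℝ) = d + 1 := by rw [(mem_cells.1 ht).2]; push_cast; ring
    refine Finset.exists_le_of_sum_le (f := fun _ => 1 / ((d : ℝ) + 1))
      (Finset.card_pos.1 (by rw [(mem_cells.1 ht).2]; omega)) ?_
    rw [hc1, Finset.sum_const, nsmul_eq_mul, hcard]
    field_simp
    exact le_rfl
  set e : EuclideanSpace ℝ (Fin d) → ℝ := fun z => if z = p then 1 else 0 with he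
  have he1 : ∀ z, |e z| ≤ 1 := fun z => by simp only [he]; split_ifs <;> simp
  have hex : interp K hK e x = c p := by
    rw [hc]; simp [he, hp]
  have hout : ∀ t' ∈ cells K hK, p ∉ t' → ∀ y ∈ convexHull ℝ (t' : Set _),
      interp K hK e y = 0 := by
    intro t' ht' hpt' y hy
    refine abs_nonpos_iff.1 (abs_interp_le ht' hy fun q hq => ?_)
    have : q ≠ p := fun h => hpt' (h ▸ hq)
    simp [he, this]
  have hslope : ∀ (t' : Finset (EuclideanSpace ℝ (Fin d))), t' ∈ cells K hK → p ∈ t' →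
      ∀ M : ℝ, 0 ≤ M → M / (μ * cellDiam t') ≤ M * Λ / (μ * cellDiam t) := by
    intro t' ht' hpt' M hM
    have hh' := hF.diam_pos t' ht'
    rw [div_le_div_iff₀ (by positivity) (by positivity)]
    have := mul_le_mul_of_nonneg_left (hΛ p hp t' ht' hpt') (mul_nonneg hM hμ0.le)
    linarith
  -- any interpolant is Lipschitz along a segment whose elements all contain `p`
  have hlip : ∀ (v : EuclideanSpace ℝ (Fin d) → ℝ) (M : ℝ), 0 ≤ M →
      ∀ y, segment ℝ x y ⊆ Ω →
      (∀ z ∈ segment ℝ x y, ∀ t' ∈ cells K hK, z ∈ convexHull ℝ (t' : Set _) →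
        (p ∈ t' ∧ ∀ q ∈ t', |v q| ≤ M) ∨ ∀ z' ∈ convexHull ℝ (t' : Set _), interp K hK v z' = 0) →
      |interp K hK v x - interp K hK v y| ≤ M * Λ / (μ * cellDiam t) * ‖x - y‖ := by
    intro v M hM y hseg hv
    refine abs_sub_le_of_segment_subset_biUnion (cells K hK)
      (fun t => convexHull ℝ (t : Set (EuclideanSpace ℝ (Fin d))))
      (fun t _ => (isCompact_convexHull_finset t).isClosed) ?_
      ((continuousOn_interp hT hΩ v).mono (hseg.trans subset_closure)) ?_
    · intro z hz
      obtain ⟨t', ht', hzt'⟩ := exists_cell_of_mem_closure (hK := hK) hT hΩ (subset_closure (hseg hz))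
      exact Set.mem_biUnion ht' hzt'
    · intro t' ht' a ha b hb has hbs
      rcases hv a has t' ht' ha with ⟨hpt', hvt'⟩ | hzero
      · refine (hF.abs_interp_sub_le ht' hvt' ha hb).trans ?_
        exact mul_le_mul_of_nonneg_right (hslope t' ht' hpt' M hM) (norm_nonneg _)
      · rw [hzero a ha, hzero b hb, sub_zero, abs_zero]
        positivity
  refine ⟨p, hp, fun y hseg hy => ?_⟩
  have hvert : ∀ z ∈ segment ℝ x y, ∀ t' ∈ cells K hK, z ∈ convexHull ℝ (t' : Set _) → p ∈ t' := by
    intro z hz t' ht' hzt'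
    by_contra hpt'
    have hxz : ‖x - z‖ ≤ ‖x - y‖ := by
      obtain ⟨θ, hθ, rfl⟩ := (segment_eq_image_lineMap ℝ x y ▸ hz : z ∈ _ '' _)
      rw [← dist_eq_norm, dist_left_lineMap, Real.norm_of_nonneg hθ.1, dist_eq_norm]
      exact mul_le_of_le_one_left (norm_nonneg _) hθ.2
    have hsz : segment ℝ x z ⊆ Ω := ((convex_segment x y).segment_subset
      (left_mem_segment ℝ x y) hz).trans hseg
    have h := hlip e 1 zero_le_one z hsz (fun z' _ t'' ht'' hz'' => by
      by_cases hpt'' : p ∈ t''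
      · exact Or.inl ⟨hpt'', fun q _ => he1 q⟩
      · exact Or.inr (hout t'' ht'' hpt''))
    rw [hex, hout t' ht' hpt' z hzt', sub_zero, abs_of_nonneg (hc0 p hp)] at h
    have h2 : 1 * Λ / (μ * cellDiam t) * ‖x - z‖ ≤ 1 / (2 * ((d : ℝ) + 1)) := by
      calc _ ≤ 1 * Λ / (μ * cellDiam t) * (μ / (2 * Λ * (d + 1)) * cellDiam t) := by
            gcongr; exact hxz.trans hy
        _ = _ := by field_simp
    have h3 : 1 / (2 * ((d : ℝ) + 1)) < 1 / ((d : ℝ) + 1) := by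
      apply one_div_lt_one_div_of_lt <;> nlinarith [(Nat.cast_nonneg d : (0 : ℝ) ≤ d)]
    linarith
  refine ⟨fun t' ht' hyt' => hvert y (right_mem_segment ℝ x y) t' ht' hyt', fun v M hM hv => ?_⟩
  exact hlip v M hM y hseg fun z hz t' ht' hzt' =>
    Or.inl ⟨hvert z hz t' ht' hzt', hv t' ht' (hvert z hz t' ht' hzt')⟩

end ShapeRegular

/-! ### Nodal values and local `L²` norms -/

section Nodal

open FracFEM

variable {d : ℕ}
variable {K : Geometry.SimplicialComplex ℝ (EuclideanSpace ℝ (Fin d))} {hK : K.faces.Finite}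
  {Ω : Set (EuclideanSpace ℝ (Fin d))} {t t' : Finset (EuclideanSpace ℝ (Fin d))}
  {x p : EuclideanSpace ℝ (Fin d)} {μ : ℝ} {w : EuclideanSpace ℝ (Fin d) → ℝ}

theorem interp_congr (ht : t ∈ cells K hK)
    (hx : x ∈ convexHull ℝ (t : Set (EuclideanSpace ℝ (Fin d))))
    {u v : EuclideanSpace ℝ (Fin d) → ℝ} (h : ∀ q ∈ t, u q = v q) :
    interp K hK u x = interp K hK v x := by
  obtain ⟨c, -, -, hc⟩ := exists_weights_interp ht hx
  rw [hc, hc]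
  exact Finset.sum_congr rfl fun q hq => by rw [h q hq]

/-- Nodal values are controlled by the `L²` norm over the element: close to a vertex where `|w|` is
maximal, `|w|` stays above half of the maximum. -/
theorem IsFat.sq_nodal_mul_le (hF : IsFat K hK μ) (hw : w ∈ feSpace K Ω) (ht : t ∈ cells K hK)
    {q : EuclideanSpace ℝ (Fin d)} (hq : q ∈ t) :
    w q ^ 2 * cellDiam t ^ d ≤ 4 / ((μ / 4) ^ d *
      volume.real (ball (0 : EuclideanSpace ℝ (Fin d)) 1)) *
      ∫ x in convexHull ℝ (t : Set (EuclideanSpace ℝ (Fin d))), w x ^ 2 := by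
  have hh := hF.diam_pos t ht
  have hμ0 := hF.pos
  have hω : 0 < volume.real (ball (0 : EuclideanSpace ℝ (Fin d)) 1) :=
    ENNReal.toReal_pos (measure_ball_pos volume _ one_pos).ne' measure_ball_lt_top.ne
  obtain ⟨q₀, hq₀, hmax⟩ := t.exists_max_image (fun q => |w q|) ⟨q, hq⟩
  obtain ⟨c, -, hc⟩ := hF.exists_small_ball ht hq₀ (r := cellDiam t / 4) (by positivity)
    (by linarith)
  have hθ : cellDiam t / 4 / cellDiam t = 1 / 4 := by field_simp
  rw [hθ] at hc
  obtain ⟨A, hA⟩ := hw.2.2 _ (convexHull_mem_elements ht)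
  have hsub : ball c (μ * (cellDiam t / 4)) ⊆
      convexHull ℝ (t : Set (EuclideanSpace ℝ (Fin d))) := by
    intro z hz
    obtain ⟨y, hy, rfl⟩ := hc z (ball_subset_closedBall hz)
    exact segment_point_mem_convexHull hq₀ hy (by norm_num) (by norm_num)
  have hlow : ∀ z ∈ ball c (μ * (cellDiam t / 4)), w q ^ 2 / 4 ≤ w z ^ 2 := by
    intro z hz
    have hz' := hsub hz
    obtain ⟨y, hy, hzy⟩ := hc z (ball_subset_closedBall hz)
    have hwy : |w y| ≤ |w q₀| := by
      rw [← interp_self_of_mem_feSpace hw ht hy]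
      exact abs_interp_le ht hy hmax
    have hwz : w z = 3 / 4 * w q₀ + 1 / 4 * w y := by
      rw [hA hz', hA (mem_convexHull_of_mem hq₀), hA hy, hzy]
      have e : q₀ + (1 / 4 : ℝ) • (y - q₀) = AffineMap.lineMap q₀ y (1 / 4 : ℝ) := by
        rw [AffineMap.lineMap_apply]; simp [add_comm]
      rw [e, AffineMap.apply_lineMap, AffineMap.lineMap_apply]
      simp only [vsub_eq_sub, smul_eq_mul, vadd_eq_add]
      ring
    have h1 : |w q₀| / 2 ≤ |w z| := by
      rw [hwz]
      have h2 : |3 / 4 * w q₀| ≤ |3 / 4 * w q₀ + 1 / 4 * w y| + |1 / 4 * w y| := by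
        calc |3 / 4 * w q₀| = |(3 / 4 * w q₀ + 1 / 4 * w y) - 1 / 4 * w y| := by ring_nf
          _ ≤ _ := abs_sub _ _
      rw [abs_mul, abs_mul, abs_of_pos (by norm_num : (0 : ℝ) < 3 / 4),
        abs_of_pos (by norm_num : (0 : ℝ) < 1 / 4)] at h2
      linarith
    have h3 : |w q| ≤ |w q₀| := hmax q hq
    rw [← sq_abs (w q), ← sq_abs (w z)]
    nlinarith [abs_nonneg (w q), abs_nonneg (w z)]
  have hint : IntegrableOn (fun x => w x ^ 2)
      (convexHull ℝ (t : Set (EuclideanSpace ℝ (Fin d)))) :=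
    (hw.1.pow 2).continuousOn.integrableOn_compact (isCompact_convexHull_finset t)
  have h1 : ∫ z in ball c (μ * (cellDiam t / 4)), w q ^ 2 / 4 ≤
      ∫ x in convexHull ℝ (t : Set (EuclideanSpace ℝ (Fin d))), w x ^ 2 := by
    refine (setIntegral_mono_on (integrableOn_const measure_ball_lt_top.ne) (hint.mono_set hsub)
      measurableSet_ball hlow).trans ?_
    exact setIntegral_mono_set hint (Filter.Eventually.of_forall fun _ => sq_nonneg _)
      hsub.eventuallyLE
  have hvol : volume.real (ball c (μ * (cellDiam t / 4))) = (μ * (cellDiam t / 4)) ^ d *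
      volume.real (ball (0 : EuclideanSpace ℝ (Fin d)) 1) := by
    rw [Measure.real, Measure.addHaar_ball_of_pos _ _ (by positivity), finrank_euclideanSpace_fin,
      ENNReal.toReal_mul, ENNReal.toReal_ofReal (by positivity), Measure.real]
  rw [setIntegral_const, hvol, smul_eq_mul] at h1
  rw [div_mul_eq_mul_div, le_div_iff₀ (by positivity)]
  have e : (μ * (cellDiam t / 4)) ^ d = (μ / 4) ^ d * cellDiam t ^ d := by
    rw [← mul_pow]; congr 1; ring
  rw [e] at h1
  nlinarith [h1]

/-- Elements overlap in null sets only, so integrals over them add up. -/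
theorem sum_setIntegral_cells_le {S : Finset (Finset (EuclideanSpace ℝ (Fin d)))}
    (hS : S ⊆ cells K hK) {B : Set (EuclideanSpace ℝ (Fin d))}
    (hSB : ∀ t ∈ S, convexHull ℝ (t : Set (EuclideanSpace ℝ (Fin d))) ⊆ B)
    (hw2 : IntegrableOn (fun x => w x ^ 2) B) :
    ∑ t ∈ S, ∫ x in convexHull ℝ (t : Set (EuclideanSpace ℝ (Fin d))), w x ^ 2 ≤
      ∫ x in B, w x ^ 2 := by
  have hsub : (⋃ t ∈ S, convexHull ℝ (t : Set (EuclideanSpace ℝ (Fin d)))) ⊆ B :=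
    Set.iUnion₂_subset hSB
  have hae : (S : Set (Finset (EuclideanSpace ℝ (Fin d)))).Pairwise
      (Function.onFun (AEDisjoint volume) fun t : Finset (EuclideanSpace ℝ (Fin d)) =>
        convexHull ℝ (t : Set (EuclideanSpace ℝ (Fin d)))) :=
    fun t ht t' ht' hne => volume_inter_cells_eq_zero (hS ht) (hS ht') hne
  have h := lintegral_biUnion_finset₀ (μ := volume) hae
    (fun t _ => (isCompact_convexHull_finset t).isClosed.measurableSet.nullMeasurableSet)
    (fun x => ENNReal.ofReal (w x ^ 2))
  have hi : ∀ {D : Set (EuclideanSpace ℝ (Fin d))}, D ⊆ B →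
      ∫ x in D, w x ^ 2 = (∫⁻ x in D, ENNReal.ofReal (w x ^ 2)).toReal := fun hD =>
    integral_eq_lintegral_of_nonneg_ae (Filter.Eventually.of_forall fun _ => sq_nonneg _)
      (hw2.mono_set hD).aestronglyMeasurable
  have hfin : ∫⁻ x in B, ENNReal.ofReal (w x ^ 2) < ∞ :=
    (hasFiniteIntegral_iff_ofReal (Filter.Eventually.of_forall fun _ => sq_nonneg _)).1 hw2.2
  rw [Finset.sum_congr rfl fun t ht => hi (hSB t ht), ← ENNReal.toReal_sum, ← h, hi le_rfl]
  · exact ENNReal.toReal_mono hfin.ne (lintegral_mono_set hsub)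
  · exact fun t ht => ((lintegral_mono_set (hSB t ht)).trans_lt hfin).ne

variable (K hK) in
/-- The vertices of the mesh in the ball of radius `14 R / 16`. -/
noncomputable def nearVertices (x₀ : EuclideanSpace ℝ (Fin d)) (R : ℝ) :
    Finset (EuclideanSpace ℝ (Fin d)) :=
  open Classical in {p ∈ (cells K hK).biUnion id | p ∈ ball x₀ (14 / 16 * R)}

variable (K hK) in
/-- The elements with vertex `p`. -/
noncomputable def cellsAt (p : EuclideanSpace ℝ (Fin d)) :
    Finset (Finset (EuclideanSpace ℝ (Fin d))) :=
  open Classical in {t ∈ cells K hK | p ∈ t}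

theorem mem_cellsAt : t ∈ cellsAt K hK p ↔ t ∈ cells K hK ∧ p ∈ t := by
  simp [cellsAt]

theorem mem_nearVertices {x₀ : EuclideanSpace ℝ (Fin d)} {R : ℝ} :
    p ∈ nearVertices K hK x₀ R ↔ (∃ t ∈ cells K hK, p ∈ t) ∧ p ∈ ball x₀ (14 / 16 * R) := by
  simp [nearVertices]

variable (K hK) in
/-- The sum of the squared nodal values of `w` over the star of the vertex `p`. -/
noncomputable def starSum (w : EuclideanSpace ℝ (Fin d) → ℝ) (p : EuclideanSpace ℝ (Fin d)) : ℝ :=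
  ∑ t ∈ cellsAt K hK p, ∑ q ∈ t, w q ^ 2

variable (K hK) in
/-- A majorant of `w²` that also dominates the squared nodal values of `w` in a neighbourhood of the
point, at points of the stars of the vertices in the ball of radius `14 R / 16`. -/
noncomputable def nodalMajorant (x₀ : EuclideanSpace ℝ (Fin d)) (R : ℝ)
    (w : EuclideanSpace ℝ (Fin d) → ℝ) (x : EuclideanSpace ℝ (Fin d)) : ℝ :=
  w x ^ 2 + ∑ p ∈ nearVertices K hK x₀ R, ∑ t ∈ cellsAt K hK p,
    (convexHull ℝ (t : Set (EuclideanSpace ℝ (Fin d)))).indicator (fun _ => starSum K hK w p) x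

theorem starSum_nonneg : 0 ≤ starSum K hK w p :=
  Finset.sum_nonneg fun _ _ => Finset.sum_nonneg fun _ _ => sq_nonneg _

theorem sq_le_starSum (ht : t ∈ cells K hK) (hp : p ∈ t) {q : EuclideanSpace ℝ (Fin d)}
    (hq : q ∈ t) : w q ^ 2 ≤ starSum K hK w p :=
  (Finset.single_le_sum (f := fun q => w q ^ 2) (fun _ _ => sq_nonneg _) hq).trans
    (Finset.single_le_sum (f := fun t : Finset (EuclideanSpace ℝ (Fin d)) => ∑ q ∈ t, w q ^ 2)
      (fun _ _ => Finset.sum_nonneg fun _ _ => sq_nonneg _) (mem_cellsAt.2 ⟨ht, hp⟩))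

theorem sq_le_nodalMajorant {x₀ : EuclideanSpace ℝ (Fin d)} {R : ℝ} :
    w x ^ 2 ≤ nodalMajorant K hK x₀ R w x :=
  le_add_of_nonneg_right <| Finset.sum_nonneg fun _ _ => Finset.sum_nonneg fun _ _ =>
    Set.indicator_nonneg (fun _ _ => starSum_nonneg) _

theorem nodalMajorant_nonneg {x₀ : EuclideanSpace ℝ (Fin d)} {R : ℝ} :
    0 ≤ nodalMajorant K hK x₀ R w x :=
  (sq_nonneg _).trans sq_le_nodalMajorant

theorem starSum_le_nodalMajorant {x₀ : EuclideanSpace ℝ (Fin d)} {R : ℝ}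
    (ht : t ∈ cells K hK) (hp : p ∈ t) (hpB : p ∈ ball x₀ (14 / 16 * R))
    (hx : x ∈ convexHull ℝ (t : Set (EuclideanSpace ℝ (Fin d)))) :
    starSum K hK w p ≤ nodalMajorant K hK x₀ R w x := by
  have h0 : ∀ p, ∀ t : Finset (EuclideanSpace ℝ (Fin d)),
      0 ≤ (convexHull ℝ (t : Set (EuclideanSpace ℝ (Fin d)))).indicator
        (fun _ => starSum K hK w p) x := fun p t => Set.indicator_nonneg (fun _ _ => starSum_nonneg) _
  refine le_add_of_nonneg_of_le (sq_nonneg _) ?_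
  refine le_trans ?_ (Finset.single_le_sum
    (f := fun p => ∑ t ∈ cellsAt K hK p,
      (convexHull ℝ (t : Set (EuclideanSpace ℝ (Fin d)))).indicator (fun _ => starSum K hK w p) x)
    (fun p _ => Finset.sum_nonneg fun t _ => h0 p t) (mem_nearVertices.2 ⟨⟨t, ht, hp⟩, hpB⟩))
  refine le_trans ?_ (Finset.single_le_sum
    (f := fun t : Finset (EuclideanSpace ℝ (Fin d)) =>
      (convexHull ℝ (t : Set (EuclideanSpace ℝ (Fin d)))).indicator (fun _ => starSum K hK w p) x)
    (fun t _ => h0 p t) (mem_cellsAt.2 ⟨ht, hp⟩))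
  simp [Set.indicator_of_mem hx]

/-- The majorant has the size of `w` in the local `L²` norm. -/
theorem IsFat.integral_nodalMajorant_le (hd : 1 ≤ d) (hF : IsFat K hK μ) (hw : w ∈ feSpace K Ω)
    {x₀ : EuclideanSpace ℝ (Fin d)} {R : ℝ} (hR : 0 < R) {Λ : ℝ} (hΛ0 : 0 < Λ)
    (hh : ∀ t ∈ cells K hK, ∀ z ∈ convexHull ℝ (t : Set (EuclideanSpace ℝ (Fin d))),
      z ∈ ball x₀ R → cellDiam t ≤ R / 16)
    (hΛ : ∀ p ∈ ball x₀ R, ∀ t ∈ cells K hK, p ∈ t → ∀ t' ∈ cells K hK, p ∈ t' →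
      cellDiam t ≤ Λ * cellDiam t') :
    IntegrableOn (nodalMajorant K hK x₀ R w) (ball x₀ R) ∧
    ∫ x in ball x₀ R, nodalMajorant K hK x₀ R w x ≤
      (1 + 4 * Λ ^ d * (d + 1) ^ 2 * (2 / μ) ^ d / (μ / 4) ^ d) * ∫ x in ball x₀ R, w x ^ 2 := by
  classical
  have hμ0 := hF.pos
  have hω : 0 < volume.real (ball (0 : EuclideanSpace ℝ (Fin d)) 1) :=
    ENNReal.toReal_pos (measure_ball_pos volume _ one_pos).ne' measure_ball_lt_top.ne
  set ω := volume.real (ball (0 : EuclideanSpace ℝ (Fin d)) 1) with hωd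
  have hw2 : IntegrableOn (fun x => w x ^ 2) (ball x₀ R) :=
    ((hw.1.pow 2).continuousOn.integrableOn_compact (isCompact_closedBall x₀ R)).mono_set
      ball_subset_closedBall
  have hmeas : ∀ t : Finset (EuclideanSpace ℝ (Fin d)),
      MeasurableSet (convexHull ℝ (t : Set (EuclideanSpace ℝ (Fin d)))) := fun t =>
    (isCompact_convexHull_finset t).isClosed.measurableSet
  have hii : ∀ (p : EuclideanSpace ℝ (Fin d)) (t : Finset (EuclideanSpace ℝ (Fin d))),
      IntegrableOn ((convexHull ℝ (t : Set (EuclideanSpace ℝ (Fin d)))).indicator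
        (fun _ => starSum K hK w p)) (ball x₀ R) := fun p t =>
    (integrableOn_const measure_ball_lt_top.ne).indicator (hmeas t)
  have hsi : IntegrableOn (fun x => ∑ p ∈ nearVertices K hK x₀ R, ∑ t ∈ cellsAt K hK p,
      (convexHull ℝ (t : Set (EuclideanSpace ℝ (Fin d)))).indicator
        (fun _ => starSum K hK w p) x) (ball x₀ R) :=
    integrable_finsetSum _ fun p _ => integrable_finsetSum _ fun t _ => hii p t
  refine ⟨hw2.add hsi, ?_⟩
  have hsplit : ∫ x in ball x₀ R, nodalMajorant K hK x₀ R w x = (∫ x in ball x₀ R, w x ^ 2) +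
      ∑ p ∈ nearVertices K hK x₀ R, ∑ t ∈ cellsAt K hK p, ∫ x in ball x₀ R,
        (convexHull ℝ (t : Set (EuclideanSpace ℝ (Fin d)))).indicator
        (fun _ => starSum K hK w p) x := by
    simp only [nodalMajorant]
    rw [integral_add hw2 hsi, integral_finsetSum _ fun p _ => integrable_finsetSum _
      fun t _ => hii p t]
    congr 1
    exact Finset.sum_congr rfl fun p _ => integral_finsetSum _ fun t _ => hii p t
  set I : Finset (EuclideanSpace ℝ (Fin d)) → ℝ := fun t =>
    ∫ x in convexHull ℝ (t : Set (EuclideanSpace ℝ (Fin d))), w x ^ 2 with hI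
  have hI0 : ∀ t, 0 ≤ I t := fun t => integral_nonneg fun _ => sq_nonneg _
  set c : ℝ := Λ ^ d * (d + 1) * (4 / (μ / 4) ^ d) with hc
  have hc0 : 0 < c := by positivity
  have hterm : ∀ p ∈ nearVertices K hK x₀ R, ∀ t ∈ cellsAt K hK p, ∫ x in ball x₀ R,
        (convexHull ℝ (t : Set (EuclideanSpace ℝ (Fin d)))).indicator
        (fun _ => starSum K hK w p) x ≤ c * ∑ t' ∈ cellsAt K hK p, I t' := by
    intro p hp t ht
    have ht' := mem_cellsAt.1 ht
    have hpB : p ∈ ball x₀ R := ball_subset_ball (by linarith) (mem_nearVertices.1 hp).2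
    have hvol : volume.real (ball x₀ R ∩ convexHull ℝ (t : Set (EuclideanSpace ℝ (Fin d)))) ≤
        cellDiam t ^ d * ω := by
      have : volume.real (closedBall p (cellDiam t)) = cellDiam t ^ d * ω := by
        have h := Measure.addHaar_closedBall (volume : Measure (EuclideanSpace ℝ (Fin d))) p
          (hF.diam_pos t ht'.1).le
        rw [Measure.real, h, finrank_euclideanSpace_fin, ENNReal.toReal_mul,
          ENNReal.toReal_ofReal (pow_nonneg (hF.diam_pos t ht'.1).le _), hωd, Measure.real]
      rw [← this]
      refine measureReal_mono (fun z hz => ?_) measure_closedBall_lt_top.ne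
      rw [mem_closedBall, dist_eq_norm]
      exact dist_le_diam_convexHull hz.2 (mem_convexHull_of_mem ht'.2)
    rw [setIntegral_indicator (hmeas t), setIntegral_const, smul_eq_mul]
    refine (mul_le_mul_of_nonneg_right hvol starSum_nonneg).trans ?_
    rw [starSum, Finset.mul_sum, Finset.mul_sum]
    refine Finset.sum_le_sum fun t' ht'' => ?_
    have ht'' := mem_cellsAt.1 ht''
    have hdd : cellDiam t ^ d ≤ Λ ^ d * cellDiam t' ^ d := by
      rw [← mul_pow]
      exact pow_le_pow_left₀ (hF.diam_pos t ht'.1).le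
        (hΛ p hpB t ht'.1 ht'.2 t' ht''.1 ht''.2) _
    have hcard : (t'.card : ℝ) = d + 1 := by rw [(mem_cells.1 ht''.1).2]; push_cast; ring
    calc cellDiam t ^ d * ω * ∑ q ∈ t', w q ^ 2
        ≤ Λ ^ d * cellDiam t' ^ d * ω * ∑ q ∈ t', w q ^ 2 := by
          gcongr
      _ = Λ ^ d * ω * ∑ q ∈ t', w q ^ 2 * cellDiam t' ^ d := by
          rw [← Finset.sum_mul]; ring
      _ ≤ Λ ^ d * ω * ∑ q ∈ t', 4 / ((μ / 4) ^ d * ω) * I t' := by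
          refine mul_le_mul_of_nonneg_left (Finset.sum_le_sum fun q hq => ?_) (by positivity)
          exact hF.sq_nodal_mul_le hw ht''.1 hq
      _ = c * I t' := by
          rw [Finset.sum_const, nsmul_eq_mul, hcard, hc]
          field_simp
  have hN : ∀ p, ((cellsAt K hK p).card : ℝ) ≤ (2 / μ) ^ d := fun p => by
    have := hF.card_cells_at_le hd p
    rw [cellsAt]; convert! this
  have hsum : ∑ p ∈ nearVertices K hK x₀ R, ∑ t ∈ cellsAt K hK p, ∫ x in ball x₀ R,
        (convexHull ℝ (t : Set (EuclideanSpace ℝ (Fin d)))).indicator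
        (fun _ => starSum K hK w p) x ≤
      (2 / μ) ^ d * c * ((d + 1) * ∫ x in ball x₀ R, w x ^ 2) := by
    calc _ ≤ ∑ p ∈ nearVertices K hK x₀ R, ∑ t ∈ cellsAt K hK p,
          c * ∑ t' ∈ cellsAt K hK p, I t' :=
          Finset.sum_le_sum fun p hp => Finset.sum_le_sum fun t ht => hterm p hp t ht
      _ ≤ ∑ p ∈ nearVertices K hK x₀ R, (2 / μ) ^ d * (c * ∑ t' ∈ cellsAt K hK p, I t') := by
          refine Finset.sum_le_sum fun p _ => ?_
          rw [Finset.sum_const, nsmul_eq_mul]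
          exact mul_le_mul_of_nonneg_right (hN p)
            (mul_nonneg hc0.le (Finset.sum_nonneg fun t _ => hI0 t))
      _ = (2 / μ) ^ d * c * ∑ p ∈ nearVertices K hK x₀ R, ∑ t' ∈ cellsAt K hK p, I t' := by
          rw [Finset.mul_sum]
          exact Finset.sum_congr rfl fun p _ => by ring
      _ ≤ (2 / μ) ^ d * c * ((d + 1) * ∫ x in ball x₀ R, w x ^ 2) := by
          refine mul_le_mul_of_nonneg_left ?_ (by positivity)
          set S : Finset (Finset (EuclideanSpace ℝ (Fin d))) :=
            {t ∈ cells K hK | ∃ p ∈ t, p ∈ nearVertices K hK x₀ R} with hS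
          -- every element is counted once for each of its at most `d + 1` near vertices
          have hcomm : ∑ p ∈ nearVertices K hK x₀ R, ∑ t' ∈ cellsAt K hK p, I t' =
              ∑ t' ∈ S, ∑ p ∈ t' with p ∈ nearVertices K hK x₀ R, I t' := by
            refine Finset.sum_comm' fun p t' => ?_
            simp only [hS, Finset.mem_filter, mem_cellsAt]
            constructor
            · rintro ⟨h1, h2, h3⟩; exact ⟨⟨h3, h1⟩, h2, p, h3, h1⟩
            · rintro ⟨⟨h1, h2⟩, h3, -⟩; exact ⟨h2, h3, h1⟩
          rw [hcomm]
          have hSB : ∀ t ∈ S, convexHull ℝ (t : Set (EuclideanSpace ℝ (Fin d))) ⊆ ball x₀ R := by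
            intro t ht z hz
            obtain ⟨htc, p, hpt, hpn⟩ := Finset.mem_filter.1 ht
            have hp14 := (mem_nearVertices.1 hpn).2
            have hd1 := hh t htc p (mem_convexHull_of_mem hpt)
              (ball_subset_ball (by linarith) hp14)
            have hd2 := dist_le_diam_convexHull hz (mem_convexHull_of_mem hpt)
            rw [← dist_eq_norm] at hd2
            change dist z p ≤ cellDiam t at hd2
            rw [mem_ball] at hp14 ⊢
            linarith [dist_triangle z p x₀]
          calc ∑ t' ∈ S, ∑ p ∈ t' with p ∈ nearVertices K hK x₀ R, I t'
              ≤ ∑ t' ∈ S, ((d : ℝ) + 1) * I t' := by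
                refine Finset.sum_le_sum fun t' ht' => ?_
                rw [Finset.sum_const, nsmul_eq_mul]
                refine mul_le_mul_of_nonneg_right ?_ (hI0 t')
                have h1 := Finset.card_filter_le t' (· ∈ nearVertices K hK x₀ R)
                rw [(mem_cells.1 (Finset.mem_filter.1 ht').1).2] at h1
                exact_mod_cast h1
            _ ≤ _ := by
                rw [← Finset.mul_sum]
                exact mul_le_mul_of_nonneg_left
                  (sum_setIntegral_cells_le (Finset.filter_subset _ _) hSB hw2) (by positivity)
  rw [hsplit]
  refine (add_le_add_right hsum _).trans (le_of_eq ?_)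
  rw [hc]; field_simp

end Nodal

/-! ### The discrete Caccioppoli inequality in dimension at least two -/

section Caccioppoli

open FracFEM

variable {d : ℕ}

/-- The cutoff function at the vertices: equal to `1` on the ball of radius `9 R / 16`, to `0` off the
ball of radius `11 R / 16`, and linear in the distance to the centre in between. -/
noncomputable def cutoff (x₀ : EuclideanSpace ℝ (Fin d)) (R : ℝ) (q : EuclideanSpace ℝ (Fin d)) : ℝ :=
  max 0 (min 1 (8 / R * (11 / 16 * R - ‖q - x₀‖)))

theorem cutoff_nonneg (x₀ : EuclideanSpace ℝ (Fin d)) (R : ℝ) (q : EuclideanSpace ℝ (Fin d)) :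
    0 ≤ cutoff x₀ R q := le_max_left _ _

theorem cutoff_le_one (x₀ : EuclideanSpace ℝ (Fin d)) (R : ℝ) (q : EuclideanSpace ℝ (Fin d)) :
    cutoff x₀ R q ≤ 1 := max_le zero_le_one (min_le_left _ _)

theorem abs_cutoff_le_one (x₀ : EuclideanSpace ℝ (Fin d)) (R : ℝ) (q : EuclideanSpace ℝ (Fin d)) :
    |cutoff x₀ R q| ≤ 1 := by
  rw [abs_of_nonneg (cutoff_nonneg _ _ _)]; exact cutoff_le_one _ _ _

theorem cutoff_eq_one {x₀ q : EuclideanSpace ℝ (Fin d)} {R : ℝ} (hR : 0 < R)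
    (hq : ‖q - x₀‖ ≤ 9 / 16 * R) : cutoff x₀ R q = 1 := by
  have : 1 ≤ 8 / R * (11 / 16 * R - ‖q - x₀‖) := by
    rw [div_mul_eq_mul_div, le_div_iff₀ hR]; linarith
  rw [cutoff, min_eq_left this, max_eq_right zero_le_one]

theorem cutoff_eq_zero {x₀ q : EuclideanSpace ℝ (Fin d)} {R : ℝ} (hR : 0 < R)
    (hq : 11 / 16 * R ≤ ‖q - x₀‖) : cutoff x₀ R q = 0 :=
  max_eq_left ((min_le_right _ _).trans
    (mul_nonpos_of_nonneg_of_nonpos (by positivity) (by linarith)))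

theorem abs_cutoff_sub_le {x₀ : EuclideanSpace ℝ (Fin d)} {R : ℝ} (hR : 0 < R)
    (p q : EuclideanSpace ℝ (Fin d)) : |cutoff x₀ R p - cutoff x₀ R q| ≤ 8 / R * ‖p - q‖ := by
  refine (abs_max_sub_max_le_max _ _ _ _).trans (max_le (by simp; positivity) ?_)
  refine (abs_min_sub_min_le_max _ _ _ _).trans (max_le (by simp; positivity) ?_)
  rw [← mul_sub, abs_mul, abs_of_pos (by positivity : 0 < 8 / R)]
  refine mul_le_mul_of_nonneg_left ?_ (by positivity)
  have := abs_norm_sub_norm_le (q - x₀) (p - x₀)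
  rw [show q - x₀ - (p - x₀) = q - p by abel, norm_sub_rev q p] at this
  rw [show 11 / 16 * R - ‖p - x₀‖ - (11 / 16 * R - ‖q - x₀‖) = ‖q - x₀‖ - ‖p - x₀‖ by ring]
  exact this

variable {K : Geometry.SimplicialComplex ℝ (EuclideanSpace ℝ (Fin d))} {hK : K.faces.Finite}
  {Ω : Set (EuclideanSpace ℝ (Fin d))} {t t' : Finset (EuclideanSpace ℝ (Fin d))}
  {x y z x₀ p : EuclideanSpace ℝ (Fin d)} {μ R : ℝ} {w : EuclideanSpace ℝ (Fin d) → ℝ}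

theorem norm_sub_le_cellDiam (ht : p ∈ t)
    (hx : x ∈ convexHull ℝ (t : Set (EuclideanSpace ℝ (Fin d)))) : ‖p - x‖ ≤ cellDiam t :=
  dist_le_diam_convexHull (mem_convexHull_of_mem ht) hx

/-- Multiplying the nodal values by a bounded function costs at most the bound, also outside the
region covered by the stars of the near vertices, if the multiplier is constant there. -/
theorem abs_interp_mul_le (hw : w ∈ feSpace K Ω) (ht : t ∈ cells K hK)
    (hz : z ∈ convexHull ℝ (t : Set (EuclideanSpace ℝ (Fin d)))) (hh : cellDiam t ≤ R / 16)
    {θ : EuclideanSpace ℝ (Fin d) → ℝ} {A : ℝ} (hθ : ∀ q ∈ t, |θ q| ≤ A)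
    (hout : 13 / 16 * R ≤ ‖z - x₀‖ → ∃ a, ∀ q ∈ t, θ q = a) :
    |interp K hK (fun q => θ q * w q) z| ≤ A * √(nodalMajorant K hK x₀ R w z) := by
  have hne : t.Nonempty := by
    rw [← Finset.card_pos, (mem_cells.1 ht).2]; omega
  obtain ⟨q₀, hq₀⟩ := hne
  have hA : 0 ≤ A := (abs_nonneg _).trans (hθ q₀ hq₀)
  rcases lt_or_ge ‖z - x₀‖ (13 / 16 * R) with hz' | hz'
  · refine abs_interp_le ht hz fun q hq => ?_
    rw [abs_mul]
    refine mul_le_mul (hθ q hq) ?_ (abs_nonneg _) hA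
    refine Real.abs_le_sqrt ((sq_le_starSum ht hq hq).trans (starSum_le_nodalMajorant ht hq ?_ hz))
    rw [mem_ball, dist_eq_norm]
    have h1 := norm_sub_le_cellDiam hq hz
    have h2 := norm_sub_le_norm_sub_add_norm_sub q z x₀
    linarith
  · obtain ⟨a, ha⟩ := hout hz'
    rw [interp_congr ht hz (v := fun q => a * w q) fun q hq => by rw [ha q hq],
      interp_linear_comb (fun q => a * w q) w w a 0 (fun q => by ring),
      interp_self_of_mem_feSpace hw ht hz, zero_mul, add_zero, abs_mul]
    exact mul_le_mul (ha q₀ hq₀ ▸ hθ q₀ hq₀) (Real.abs_le_sqrt sq_le_nodalMajorant)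
      (abs_nonneg _) hA

/-- The three commutator bounds between nodal interpolation and multiplication by the cutoff, with
the value `c` of the cutoff frozen. -/
def CommutatorBound (K : Geometry.SimplicialComplex ℝ (EuclideanSpace ℝ (Fin d)))
    (hK : K.faces.Finite) (η w : EuclideanSpace ℝ (Fin d) → ℝ) (x y : EuclideanSpace ℝ (Fin d))
    (c D : ℝ) : Prop :=
  |w x - w y| * |interp K hK (fun q => (η q - c) ^ 2 * w q) x -
      interp K hK (fun q => (η q - c) ^ 2 * w q) y| ≤ D ∧
  (interp K hK (fun q => (η q - c) * w q) x - interp K hK (fun q => (η q - c) * w q) y) ^ 2 ≤ D ∧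
  (interp K hK (fun q => (η q - c) * η q * w q) x -
      interp K hK (fun q => (η q - c) * η q * w q) y) ^ 2 ≤ D

theorem CommutatorBound.mono {η : EuclideanSpace ℝ (Fin d) → ℝ} {c D D' : ℝ}
    (h : CommutatorBound K hK η w x y c D) (hD : D ≤ D') : CommutatorBound K hK η w x y c D' :=
  ⟨h.1.trans hD, h.2.1.trans hD, h.2.2.trans hD⟩

theorem CommutatorBound.symm {η : EuclideanSpace ℝ (Fin d) → ℝ} {c D : ℝ}
    (h : CommutatorBound K hK η w x y c D) : CommutatorBound K hK η w y x c D := by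
  obtain ⟨h1, h2, h3⟩ := h
  refine ⟨?_, ?_, ?_⟩
  · rwa [abs_sub_comm (w y), abs_sub_comm (interp K hK _ y)]
  · rwa [← neg_sub, neg_sq]
  · rwa [← neg_sub, neg_sq]

/-- Pairs of points that are close compared with the local mesh size: both lie in the star of one
vertex, where everything is Lipschitz with a constant given by the nodal values. -/
theorem IsFat.commutatorBound_near (hF : IsFat K hK μ) (hT : IsTriangulation K Ω)
    (hΩ : IsOpen Ω) (hw : w ∈ feSpace K Ω) (hR : 0 < R) (hB : ball x₀ R ⊆ Ω) {Λ : ℝ} (hΛ0 : 0 < Λ)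
    (hΛ : ∀ p ∈ ball x₀ R, ∀ t ∈ cells K hK, p ∈ t → ∀ t' ∈ cells K hK, p ∈ t' →
      cellDiam t ≤ Λ * cellDiam t') (ht : t ∈ cells K hK)
    (hx : x ∈ convexHull ℝ (t : Set (EuclideanSpace ℝ (Fin d)))) (hh : cellDiam t ≤ R / 16)
    (hx13 : ‖x - x₀‖ < 13 / 16 * R) (hyB : y ∈ ball x₀ R)
    (hxy : ‖x - y‖ ≤ μ / (2 * Λ * (d + 1)) * cellDiam t) :
    ∃ c, 0 ≤ c ∧ c ≤ 1 ∧ CommutatorBound K hK (cutoff x₀ R) w x y c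
      (64 * Λ ^ 4 / μ ^ 2 * (‖x - y‖ ^ 2 / R ^ 2 * nodalMajorant K hK x₀ R w x)) := by
  have hμ0 := hF.pos
  have ht0 := hF.diam_pos t ht
  have hvB : ∀ q ∈ t, q ∈ ball x₀ (14 / 16 * R) := fun q hq => by
    rw [mem_ball, dist_eq_norm]
    have h1 := norm_sub_le_cellDiam hq hx
    have h2 := norm_sub_le_norm_sub_add_norm_sub q x x₀
    linarith
  have hvB' : ∀ q ∈ t, q ∈ ball x₀ R := fun q hq => ball_subset_ball (by linarith) (hvB q hq)
  obtain ⟨p, hp, hpy⟩ := hF.exists_vertex_of_near hT hΩ hΛ0 ht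
    (fun p hp t' ht' hpt' => hΛ p (hvB' p hp) t ht hp t' ht' hpt') hx
  have hxB : x ∈ ball x₀ R := by rw [mem_ball, dist_eq_norm]; linarith
  obtain ⟨-, hlip⟩ := hpy y (((convex_ball x₀ R).segment_subset hxB hyB).trans hB) hxy
  obtain ⟨ty, hty, hyt⟩ := exists_cell_of_mem_closure (hK := hK) hT hΩ (subset_closure (hB hyB))
  set S := starSum K hK w p with hS
  have hS0 : 0 ≤ S := starSum_nonneg
  have hSZ : S ≤ nodalMajorant K hK x₀ R w x := starSum_le_nodalMajorant ht hp (hvB p hp) hx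
  set h := cellDiam t with hh'
  set L := 8 / R * (Λ * h) with hL
  have hL0 : 0 ≤ L := by positivity
  have hwq : ∀ t' ∈ cells K hK, p ∈ t' → ∀ q ∈ t', |w q| ≤ √S := fun t' ht' hpt' q hq =>
    Real.abs_le_sqrt (sq_le_starSum ht' hpt' hq)
  have hηq : ∀ t' ∈ cells K hK, p ∈ t' → ∀ q ∈ t', |cutoff x₀ R q - cutoff x₀ R p| ≤ L :=
    fun t' ht' hpt' q hq => (abs_cutoff_sub_le hR q p).trans
      (mul_le_mul_of_nonneg_left ((norm_sub_le_cellDiam hq (mem_convexHull_of_mem hpt')).trans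
        (hΛ p (hvB' p hp) t' ht' hpt' t ht hp)) (by positivity))
  have e0 : |w x - w y| ≤ √S * Λ / (μ * h) * ‖x - y‖ := by
    rw [← interp_self_of_mem_feSpace hw ht hx, ← interp_self_of_mem_feSpace hw hty hyt]
    exact hlip w (√S) (Real.sqrt_nonneg _) hwq
  have e1 := hlip (fun q => (cutoff x₀ R q - cutoff x₀ R p) ^ 2 * w q) (L ^ 2 * √S) (by positivity)
    (fun t' ht' hpt' q hq => by
      rw [abs_mul, abs_pow]
      exact mul_le_mul (pow_le_pow_left₀ (abs_nonneg _) (hηq t' ht' hpt' q hq) 2)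
        (hwq t' ht' hpt' q hq) (abs_nonneg _) (by positivity))
  have e2 := hlip (fun q => (cutoff x₀ R q - cutoff x₀ R p) * w q) (L * √S) (by positivity)
    (fun t' ht' hpt' q hq => by
      rw [abs_mul]
      exact mul_le_mul (hηq t' ht' hpt' q hq) (hwq t' ht' hpt' q hq) (abs_nonneg _) (by positivity))
  have e3 := hlip (fun q => (cutoff x₀ R q - cutoff x₀ R p) * cutoff x₀ R q * w q) (L * √S)
    (by positivity)
    (fun t' ht' hpt' q hq => by
      rw [abs_mul, abs_mul]
      refine mul_le_mul ?_ (hwq t' ht' hpt' q hq) (abs_nonneg _) (by positivity)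
      exact (mul_le_of_le_one_right (abs_nonneg _) (abs_cutoff_le_one _ _ _)).trans
        (hηq t' ht' hpt' q hq))
  have key : (L * √S * Λ / (μ * h) * ‖x - y‖) ^ 2 ≤
      64 * Λ ^ 4 / μ ^ 2 * (‖x - y‖ ^ 2 / R ^ 2 * nodalMajorant K hK x₀ R w x) := by
    have e : (L * √S * Λ / (μ * h) * ‖x - y‖) ^ 2 =
        64 * Λ ^ 4 / μ ^ 2 * (‖x - y‖ ^ 2 / R ^ 2 * S) := by
      rw [hL]
      field_simp
      rw [Real.sq_sqrt hS0]
      ring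
    rw [e]
    gcongr
  refine ⟨cutoff x₀ R p, cutoff_nonneg _ _ _, cutoff_le_one _ _ _, ?_, ?_, ?_⟩
  · refine le_trans ((mul_le_mul e0 e1 (abs_nonneg _) (by positivity)).trans (le_of_eq ?_)) key
    ring
  · rw [← sq_abs]
    exact (pow_le_pow_left₀ (abs_nonneg _) e2 2).trans key
  · rw [← sq_abs]
    exact (pow_le_pow_left₀ (abs_nonneg _) e3 2).trans key

/-- Pairs of points that are distant compared with the local mesh sizes: the variation of the cutoff
over both elements is bounded by the distance of the points. -/
theorem commutatorBound_far (hw : w ∈ feSpace K Ω) (hR : 0 < R) {κ : ℝ} (hκ : 0 < κ)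
    (ht : t ∈ cells K hK) (hx : x ∈ convexHull ℝ (t : Set (EuclideanSpace ℝ (Fin d))))
    (hh : cellDiam t ≤ R / 16)
    (ht' : t' ∈ cells K hK) (hy : y ∈ convexHull ℝ (t' : Set (EuclideanSpace ℝ (Fin d))))
    (hh' : cellDiam t' ≤ R / 16)
    (hxy : κ * cellDiam t ≤ ‖x - y‖) (hxy' : κ * cellDiam t' ≤ ‖x - y‖) :
    CommutatorBound K hK (cutoff x₀ R) w x y (cutoff x₀ R x)
      (128 * (1 / κ + 1) ^ 2 * (‖x - y‖ ^ 2 / R ^ 2 *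
        (nodalMajorant K hK x₀ R w x + nodalMajorant K hK x₀ R w y))) := by
  set A := 8 / R * ((1 / κ + 1) * ‖x - y‖) with hA
  have hA0 : 0 ≤ A := by positivity
  have hbd : ∀ {z} {T : Finset (EuclideanSpace ℝ (Fin d))},
      z ∈ convexHull ℝ (T : Set (EuclideanSpace ℝ (Fin d))) →
      ‖z - x‖ ≤ ‖x - y‖ → κ * cellDiam T ≤ ‖x - y‖ → ∀ q ∈ T,
      |cutoff x₀ R q - cutoff x₀ R x| ≤ A := by
    intro z T hz hzx hT q hq
    refine (abs_cutoff_sub_le hR q x).trans (mul_le_mul_of_nonneg_left ?_ (by positivity))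
    have h1 := norm_sub_le_cellDiam hq hz
    have h2 := norm_sub_le_norm_sub_add_norm_sub q z x
    have h3 : cellDiam T ≤ 1 / κ * ‖x - y‖ := by
      rw [one_div, inv_mul_eq_div, le_div_iff₀ hκ]; linarith
    linarith
  have hzero : ∀ {z} {T : Finset (EuclideanSpace ℝ (Fin d))},
      z ∈ convexHull ℝ (T : Set (EuclideanSpace ℝ (Fin d))) → cellDiam T ≤ R / 16 →
      13 / 16 * R ≤ ‖z - x₀‖ → ∀ q ∈ T, cutoff x₀ R q = 0 := by
    intro z T hz hT hz13 q hq
    have h1 := norm_sub_le_cellDiam hq hz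
    have h2 := norm_sub_le_norm_sub_add_norm_sub z q x₀
    rw [norm_sub_rev z q] at h2
    exact cutoff_eq_zero hR (by linarith)
  have main : ∀ {z} {T : Finset (EuclideanSpace ℝ (Fin d))}, T ∈ cells K hK →
      z ∈ convexHull ℝ (T : Set (EuclideanSpace ℝ (Fin d))) → cellDiam T ≤ R / 16 →
      ‖z - x‖ ≤ ‖x - y‖ → κ * cellDiam T ≤ ‖x - y‖ →
      |interp K hK (fun q => (cutoff x₀ R q - cutoff x₀ R x) ^ 2 * w q) z| ≤
        A ^ 2 * √(nodalMajorant K hK x₀ R w z) ∧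
      |interp K hK (fun q => (cutoff x₀ R q - cutoff x₀ R x) * w q) z| ≤
        A * √(nodalMajorant K hK x₀ R w z) ∧
      |interp K hK (fun q => (cutoff x₀ R q - cutoff x₀ R x) * cutoff x₀ R q * w q) z| ≤
        A * √(nodalMajorant K hK x₀ R w z) := by
    intro z T hT hz hh hzx hκT
    refine ⟨abs_interp_mul_le hw hT hz hh (fun q hq => ?_)
        fun h => ⟨cutoff x₀ R x ^ 2, fun q hq => by rw [hzero hz hh h q hq]; ring⟩,
      abs_interp_mul_le hw hT hz hh (hbd hz hzx hκT)
        fun h => ⟨-cutoff x₀ R x, fun q hq => by rw [hzero hz hh h q hq]; ring⟩,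
      abs_interp_mul_le hw hT hz hh (fun q hq => ?_)
        fun h => ⟨0, fun q hq => by rw [hzero hz hh h q hq]; ring⟩⟩
    · rw [abs_pow]; exact pow_le_pow_left₀ (abs_nonneg _) (hbd hz hzx hκT q hq) 2
    · rw [abs_mul]
      exact (mul_le_of_le_one_right (abs_nonneg _) (abs_cutoff_le_one _ _ _)).trans
        (hbd hz hzx hκT q hq)
  obtain ⟨x1, x2, x3⟩ := main ht hx hh (by simp) hxy
  obtain ⟨y1, y2, y3⟩ := main ht' hy hh' (norm_sub_rev y x).le hxy'
  set a := √(nodalMajorant K hK x₀ R w x) with ha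
  set b := √(nodalMajorant K hK x₀ R w y) with hb
  have ha0 : 0 ≤ a := Real.sqrt_nonneg _
  have hb0 : 0 ≤ b := Real.sqrt_nonneg _
  have ha2 : a ^ 2 = nodalMajorant K hK x₀ R w x := Real.sq_sqrt nodalMajorant_nonneg
  have hb2 : b ^ 2 = nodalMajorant K hK x₀ R w y := Real.sq_sqrt nodalMajorant_nonneg
  have key : A ^ 2 * (a + b) ^ 2 ≤ 128 * (1 / κ + 1) ^ 2 * (‖x - y‖ ^ 2 / R ^ 2 *
        (nodalMajorant K hK x₀ R w x + nodalMajorant K hK x₀ R w y)) := by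
    rw [← ha2, ← hb2]
    have e : 128 * (1 / κ + 1) ^ 2 * (‖x - y‖ ^ 2 / R ^ 2 * (a ^ 2 + b ^ 2)) =
        A ^ 2 * (2 * (a ^ 2 + b ^ 2)) := by rw [hA]; field_simp; ring
    rw [e]
    exact mul_le_mul_of_nonneg_left (by nlinarith [sq_nonneg (a - b)]) (sq_nonneg _)
  refine ⟨?_, ?_, ?_⟩
  · have h0 : |w x - w y| ≤ a + b := (abs_sub _ _).trans
      (add_le_add (Real.abs_le_sqrt sq_le_nodalMajorant) (Real.abs_le_sqrt sq_le_nodalMajorant))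
    have h1 := (abs_sub (interp K hK (fun q => (cutoff x₀ R q - cutoff x₀ R x) ^ 2 * w q) x)
      (interp K hK (fun q => (cutoff x₀ R q - cutoff x₀ R x) ^ 2 * w q) y)).trans (add_le_add x1 y1)
    refine ((mul_le_mul h0 h1 (abs_nonneg _) (by positivity)).trans (le_of_eq ?_)).trans key
    ring
  · have h1 := (abs_sub _ _).trans (add_le_add x2 y2)
    rw [← sq_abs]
    refine ((pow_le_pow_left₀ (abs_nonneg _) h1 2).trans (le_of_eq ?_)).trans key
    ring
  · have h1 := (abs_sub _ _).trans (add_le_add x3 y3)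
    rw [← sq_abs]
    refine ((pow_le_pow_left₀ (abs_nonneg _) h1 2).trans (le_of_eq ?_)).trans key
    ring

/-- The commutator bounds for all pairs of points of the ball. The frozen value `c` is the cutoff at a
vertex common to elements of both points if they are close, and the cutoff at `x` otherwise. -/
theorem IsFat.exists_commutatorBound (hF : IsFat K hK μ) (hT : IsTriangulation K Ω)
    (hΩ : IsOpen Ω) (hw : w ∈ feSpace K Ω) (hR : 0 < R) (hB : ball x₀ R ⊆ Ω) {Λ : ℝ} (hΛ0 : 0 < Λ)
    (hΛ : ∀ p ∈ ball x₀ R, ∀ t ∈ cells K hK, p ∈ t → ∀ t' ∈ cells K hK, p ∈ t' →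
      cellDiam t ≤ Λ * cellDiam t')
    (hh : ∀ t ∈ cells K hK, ∀ z ∈ convexHull ℝ (t : Set (EuclideanSpace ℝ (Fin d))),
      z ∈ ball x₀ R → cellDiam t ≤ R / 16)
    (hκ1 : μ / (2 * Λ * (d + 1)) ≤ 1) (hx : x ∈ ball x₀ R) (hy : y ∈ ball x₀ R) :
    ∃ c, 0 ≤ c ∧ c ≤ 1 ∧ CommutatorBound K hK (cutoff x₀ R) w x y c
      ((64 * Λ ^ 4 / μ ^ 2 + 128 * (1 / (μ / (2 * Λ * (d + 1))) + 1) ^ 2) *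
        (‖x - y‖ ^ 2 / R ^ 2 *
        (nodalMajorant K hK x₀ R w x + nodalMajorant K hK x₀ R w y))) := by
  have hμ0 := hF.pos
  set κ := μ / (2 * Λ * (d + 1)) with hκ
  have hκ0 : 0 < κ := by positivity
  obtain ⟨t, ht, hxt⟩ := exists_cell_of_mem_closure (hK := hK) hT hΩ (subset_closure (hB hx))
  obtain ⟨t', ht', hyt⟩ := exists_cell_of_mem_closure (hK := hK) hT hΩ (subset_closure (hB hy))
  have h1 := hh t ht x hxt hx
  have h2 := hh t' ht' y hyt hy
  have hx' := hx
  have hy' := hy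
  rw [mem_ball, dist_eq_norm] at hx' hy'
  have hZx : 0 ≤ nodalMajorant K hK x₀ R w x := nodalMajorant_nonneg
  have hZy : 0 ≤ nodalMajorant K hK x₀ R w y := nodalMajorant_nonneg
  by_cases hout : 12 / 16 * R ≤ ‖x - x₀‖ ∧ 12 / 16 * R ≤ ‖y - x₀‖
  · -- all nodal values of the cutoff vanish on both elements
    have hz : ∀ {z} {T : Finset (EuclideanSpace ℝ (Fin d))},
      z ∈ convexHull ℝ (T : Set (EuclideanSpace ℝ (Fin d))) → cellDiam T ≤ R / 16 →
      12 / 16 * R ≤ ‖z - x₀‖ → ∀ q ∈ T, cutoff x₀ R q = 0 := by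
      intro z T hz hT hz13 q hq
      have h1 := norm_sub_le_cellDiam hq hz
      have h2 := norm_sub_le_norm_sub_add_norm_sub z q x₀
      rw [norm_sub_rev z q] at h2
      exact cutoff_eq_zero hR (by linarith)
    have hi : ∀ {z} {T : Finset (EuclideanSpace ℝ (Fin d))}, T ∈ cells K hK →
      z ∈ convexHull ℝ (T : Set (EuclideanSpace ℝ (Fin d))) → ∀ v : EuclideanSpace ℝ (Fin d) → ℝ,
      (∀ q ∈ T, v q = 0) → interp K hK v z = 0 := by
      intro z T hT hz v hv
      have := abs_interp_le (M := 0) hT hz (v := v) fun q hq => by rw [hv q hq, abs_zero]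
      exact abs_nonpos_iff.1 this
    have hzx := hz hxt h1 hout.1
    have hzy := hz hyt h2 hout.2
    have hD : 0 ≤ ((64 * Λ ^ 4 / μ ^ 2 + 128 * (1 / κ + 1) ^ 2) *
        (‖x - y‖ ^ 2 / R ^ 2 *
        (nodalMajorant K hK x₀ R w x + nodalMajorant K hK x₀ R w y))) := by positivity
    refine ⟨0, le_rfl, zero_le_one, ?_, ?_, ?_⟩
    · rw [hi ht hxt _ fun q hq => by rw [hzx q hq]; ring, hi ht' hyt _ fun q hq => by
        rw [hzy q hq]; ring]
      simpa using hD
    · rw [hi ht hxt _ fun q hq => by rw [hzx q hq]; ring, hi ht' hyt _ fun q hq => by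
        rw [hzy q hq]; ring]
      simpa using hD
    · rw [hi ht hxt _ fun q hq => by rw [hzx q hq]; ring, hi ht' hyt _ fun q hq => by
        rw [hzy q hq]; ring]
      simpa using hD
  have hor : ‖x - x₀‖ < 12 / 16 * R ∨ ‖y - x₀‖ < 12 / 16 * R := by
    by_contra hcon
    push Not at hcon
    exact hout hcon
  have htri := norm_sub_le_norm_sub_add_norm_sub x y x₀
  have htri' := norm_sub_le_norm_sub_add_norm_sub y x x₀
  rw [norm_sub_rev y x] at htri'
  have hmono : ∀ {a b : ℝ}, 0 ≤ a → 0 ≤ b →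
      64 * Λ ^ 4 / μ ^ 2 * (‖x - y‖ ^ 2 / R ^ 2 * a) ≤
      (64 * Λ ^ 4 / μ ^ 2 + 128 * (1 / κ + 1) ^ 2) * (‖x - y‖ ^ 2 / R ^ 2 * (a + b)) := by
    intro a b ha hb
    gcongr <;> nlinarith [sq_nonneg (1 / κ + 1)]
  rcases le_or_gt ‖x - y‖ (κ * cellDiam t) with hn | hn
  · have hd : κ * cellDiam t ≤ R / 16 :=
      (mul_le_of_le_one_left (hF.diam_pos t ht).le hκ1).trans h1
    obtain ⟨c, hc0, hc1, hc⟩ := hF.commutatorBound_near hT hΩ hw hR hB hΛ0 hΛ ht hxt h1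
      (by rcases hor with h | h <;> linarith) hy hn
    exact ⟨c, hc0, hc1, hc.mono (hmono hZx hZy)⟩
  rcases le_or_gt ‖x - y‖ (κ * cellDiam t') with hn' | hn'
  · have hd : κ * cellDiam t' ≤ R / 16 :=
      (mul_le_of_le_one_left (hF.diam_pos t' ht').le hκ1).trans h2
    rw [norm_sub_rev] at hn'
    obtain ⟨c, hc0, hc1, hc⟩ := hF.commutatorBound_near hT hΩ hw hR hB hΛ0 hΛ ht' hyt h2
      (by rw [norm_sub_rev] at hn'; rcases hor with h | h <;> linarith) hx hn'
    refine ⟨c, hc0, hc1, hc.symm.mono ?_⟩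
    rw [norm_sub_rev y x, add_comm (nodalMajorant K hK x₀ R w x)]
    exact hmono hZy hZx
  · refine ⟨cutoff x₀ R x, cutoff_nonneg _ _ _, cutoff_le_one _ _ _,
      (commutatorBound_far hw hR hκ0 ht hxt h1 ht' hyt h2 hn.le hn'.le).mono ?_⟩
    gcongr
    have : 0 ≤ 64 * Λ ^ 4 / μ ^ 2 := by positivity
    linarith

end Caccioppoli

section CaccioppoliIntegrated

open FracFEM

set_option maxHeartbeats 1000000 in
/-- The discrete Caccioppoli inequality in dimension at least two: testing with the interpolant of
`η² w` and absorbing. -/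
theorem exists_caccioppoli_of_two_le {d : ℕ} (hd : 2 ≤ d) {s : ℝ} (hs0 : 0 < s) (hs1 : s < 1)
    {μ : ℝ} (hμ : 0 < μ) {C₀ : ℝ} (hC₀ : 0 ≤ C₀) : ∃ C : ℝ, 0 < C ∧
    ∀ (K : Geometry.SimplicialComplex ℝ (EuclideanSpace ℝ (Fin d))) (hK : K.faces.Finite)
      (Ω : Set (EuclideanSpace ℝ (Fin d))), IsTriangulation K Ω → IsOpen Ω → IsFat K hK μ →
    ∀ (x₀ : EuclideanSpace ℝ (Fin d)) (R : ℝ), 0 < R → ball x₀ R ⊆ Ω →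
      (∀ t ∈ cells K hK, ∀ z ∈ convexHull ℝ (t : Set (EuclideanSpace ℝ (Fin d))),
        z ∈ ball x₀ R → cellDiam t ≤ R / 16) →
    ∀ w ∈ feSpace K Ω, ∀ M : ℝ, 0 ≤ M →
      (∀ φ ∈ feSpaceOn K Ω (ball x₀ R), (∀ x, x ∉ ball x₀ (15 / 16 * R) → φ x = 0) →
        ∫ p in ball x₀ R ×ˢ ball x₀ R, (w p.1 - w p.2) * (φ p.1 - φ p.2) / kernelDenom s p.1 p.2 ≤
          1 / 8 * (∫ p in ball x₀ R ×ˢ ball x₀ R, (φ p.1 - φ p.2) ^ 2 / kernelDenom s p.1 p.2)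
          + M + C₀ * (R ^ (-(2 * s)) * ∫ x in ball x₀ R, φ x ^ 2)) →
      ∫ p in ball x₀ (R / 2) ×ˢ ball x₀ (R / 2), (w p.1 - w p.2) ^ 2 / kernelDenom s p.1 p.2 ≤
        C * (M + R ^ (-(2 * s)) * ∫ x in ball x₀ R, w x ^ 2) := by
  have hd1 : 1 ≤ d := by omega
  obtain ⟨C₂, hC₂, hE⟩ := exists_integral_norm_sq_div_mul_le
    (volume : Measure (EuclideanSpace ℝ (Fin d))) (by simpa using hd1) hs1
  set Λ₀ := (1 / μ) ^ (⌊(2 / μ) ^ d⌋₊) with hΛ₀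
  set Λ := max 1 Λ₀ with hΛd
  have hΛ0 : 0 < Λ := lt_max_of_lt_left one_pos
  set C₁ := 64 * Λ ^ 4 / μ ^ 2 + 128 * (1 / (μ / (2 * Λ * (d + 1))) + 1) ^ 2 with hC₁
  have hC₁0 : 0 < C₁ := by positivity
  set C₃ := 1 + 4 * Λ ^ d * (d + 1) ^ 2 * (2 / μ) ^ d / (μ / 4) ^ d with hC₃
  have hC₃0 : 0 < C₃ := by positivity
  refine ⟨4 / 3 * (1 + (C₀ + 3 * (C₁ * C₂)) * C₃), by positivity, ?_⟩
  intro K hK Ω hT hΩ hF x₀ R hR hB hh w hw M hM hLG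
  have hne : (cells K hK).Nonempty := by
    obtain ⟨t, ht, -⟩ := exists_cell_of_mem_closure (hK := hK) hT hΩ
      (subset_closure (hB (mem_ball_self hR)))
    exact ⟨t, ht⟩
  obtain ⟨t₀, ht₀⟩ := hne
  have hμ1 : μ ≤ 1 := hF.le_one hd1 ht₀
  have hκ1 : μ / (2 * Λ * (d + 1)) ≤ 1 := by
    rw [div_le_one (by positivity)]
    have h1 : (1 : ℝ) ≤ Λ := le_max_left _ _
    have h2 : (0 : ℝ) ≤ d := Nat.cast_nonneg _
    nlinarith
  have hΛ : ∀ p ∈ ball x₀ R, ∀ t ∈ cells K hK, p ∈ t → ∀ t' ∈ cells K hK, p ∈ t' →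
      cellDiam t ≤ Λ * cellDiam t' := fun p hp t ht hpt t' ht' hpt' =>
    (hF.cellDiam_le hd hT hΩ (hB hp) ht' hpt' ht hpt).trans
      (mul_le_mul_of_nonneg_right (le_max_right _ _) (hF.diam_pos t' ht').le)
  -- `P` is tested with; `Q` coincides with `w` on the half ball
  set η := cutoff x₀ R with hη
  set P := interp K hK (fun q => η q ^ 2 * w q) with hP
  set Q := interp K hK (fun q => η q * w q) with hQ
  set Z := nodalMajorant K hK x₀ R w with hZ
  set B := ball x₀ R with hBdef
  have hZ0 : ∀ x, 0 ≤ Z x := fun x => nodalMajorant_nonneg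
  obtain ⟨hZi, hZle⟩ := hF.integral_nodalMajorant_le hd1 hw hR hΛ0 hh hΛ
  have hη0 : ∀ q, q ∉ ball x₀ (11 / 16 * R) → η q = 0 := fun q hq => by
    rw [mem_ball, dist_eq_norm, not_lt] at hq
    exact cutoff_eq_zero hR hq
  have hhq : ∀ t ∈ cells K hK, ∀ q ∈ t, q ∈ ball x₀ R →
      diam (convexHull ℝ (t : Set (EuclideanSpace ℝ (Fin d)))) ≤ R / 16 := fun t ht q hq hqB =>
    hh t ht q (mem_convexHull_of_mem hq) hqB
  obtain ⟨hPmem, hP0⟩ := interp_mem_feSpaceOn (hK := hK) hT hΩ (r := 11 / 16 * R) (h := R / 16) hB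
    (by linarith) (by positivity) hhq (v := fun q => η q ^ 2 * w q)
    fun q hq => by simp [hη0 q hq]
  obtain ⟨hQmem, -⟩ := interp_mem_feSpaceOn (hK := hK) hT hΩ (r := 11 / 16 * R) (h := R / 16) hB
    (by linarith) (by positivity) hhq (v := fun q => η q * w q)
    fun q hq => by simp [hη0 q hq]
  have hwH := memHs_of_mem_feSpace hd1 hs0 hs1 hT hΩ hw
  have hPH := memHs_of_mem_feSpace hd1 hs0 hs1 hT hΩ hPmem.1
  have hQH := memHs_of_mem_feSpace hd1 hs0 hs1 hT hΩ hQmem.1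
  have iwP := (hwH.integrable_energy hPH).integrableOn (s := B ×ˢ B)
  have iPP := (hPH.integrable_energy hPH).integrableOn (s := B ×ˢ B)
  have iQQ := (hQH.integrable_energy hQH).integrableOn (s := B ×ˢ B)
  simp only [← sq] at iPP iQQ
  obtain ⟨iZ, hZE⟩ := hE x₀ R hR B measurableSet_ball le_rfl Z (fun x _ => hZ0 x) hZi
  simp only [finrank_euclideanSpace_fin] at iZ hZE
  set r : EuclideanSpace ℝ (Fin d) × EuclideanSpace ℝ (Fin d) → ℝ := fun p =>
    C₁ / R ^ 2 * (‖p.1 - p.2‖ ^ 2 / ‖p.1 - p.2‖ ^ ((d : ℝ) + 2 * s) * (Z p.1 + Z p.2)) with hr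
  have ir : IntegrableOn r (B ×ˢ B) := iZ.const_mul _
  have hmB : MeasurableSet (B ×ˢ B) := measurableSet_ball.prod measurableSet_ball
  -- the commutator bounds, with the interpolants of `(η - c)² w`, `(η - c) w` and `(η - c) η w` expanded
  -- in `P`, `Q` and `w`
  have hpt : ∀ p ∈ B ×ˢ B,
      (Q p.1 - Q p.2) ^ 2 / kernelDenom s p.1 p.2 ≤
        (w p.1 - w p.2) * (P p.1 - P p.2) / kernelDenom s p.1 p.2 + 2 * r p ∧
      (P p.1 - P p.2) ^ 2 / kernelDenom s p.1 p.2 ≤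
        2 * ((Q p.1 - Q p.2) ^ 2 / kernelDenom s p.1 p.2) + 2 * r p := by
    rintro ⟨x, y⟩ ⟨hx, hy⟩
    simp only at hx hy ⊢
    obtain ⟨c, hc0, hc1, hb1, hb2, hb3⟩ :=
      hF.exists_commutatorBound hT hΩ hw hR hB hΛ0 hΛ hh hκ1 hx hy
    rw [← hη, ← hZ, ← hC₁] at hb1 hb2 hb3
    have hk := kernelDenom_nonneg s x y
    have eP : ∀ z, z ∈ B → interp K hK (fun q => (η q - c) ^ 2 * w q) z =
        P z - 2 * c * Q z + c ^ 2 * w z := fun z hz => by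
      obtain ⟨t, ht, hzt⟩ := exists_cell_of_mem_closure (hK := hK) hT hΩ (subset_closure (hB hz))
      have e1 := interp_linear_comb (K := K) (hK := hK) (fun q => (η q - c) ^ 2 * w q)
        (fun q => η q ^ 2 * w q - 2 * c * (η q * w q)) w 1 (c ^ 2) (fun q => by ring) z
      have e2 := interp_linear_comb (K := K) (hK := hK)
        (fun q => η q ^ 2 * w q - 2 * c * (η q * w q)) (fun q => η q ^ 2 * w q)
        (fun q => η q * w q) 1 (-(2 * c)) (fun q => by ring) z
      rw [e1, e2, interp_self_of_mem_feSpace hw ht hzt, hP, hQ]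
      ring
    have eQ : ∀ z, z ∈ B → interp K hK (fun q => (η q - c) * w q) z = Q z - c * w z :=
      fun z hz => by
        obtain ⟨t, ht, hzt⟩ := exists_cell_of_mem_closure (hK := hK) hT hΩ (subset_closure (hB hz))
        have e1 := interp_linear_comb (K := K) (hK := hK) (fun q => (η q - c) * w q)
          (fun q => η q * w q) w 1 (-c) (fun q => by ring) z
        rw [e1, interp_self_of_mem_feSpace hw ht hzt, hQ]
        ring
    have eR : ∀ z, interp K hK (fun q => (η q - c) * η q * w q) z = P z - c * Q z := fun z => by
      have e1 := interp_linear_comb (K := K) (hK := hK) (fun q => (η q - c) * η q * w q)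
        (fun q => η q ^ 2 * w q) (fun q => η q * w q) 1 (-c) (fun q => by ring) z
      rw [e1, hP, hQ]
      ring
    rw [eP x hx, eP y hy] at hb1
    rw [eQ x hx, eQ y hy] at hb2
    rw [eR, eR] at hb3
    rw [← abs_mul] at hb1
    have hb1' := neg_le_of_abs_le hb1
    set D := C₁ * (‖x - y‖ ^ 2 / R ^ 2 * (Z x + Z y)) with hD
    have hrk : r (x, y) = D / kernelDenom s x y := by
      rw [hr, hD, kernelDenom]; ring
    rw [hrk, ← mul_div_assoc, ← mul_div_assoc, ← add_div, ← add_div]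
    constructor
    · refine div_le_div_of_nonneg_right ?_ hk
      have e : (Q x - Q y) ^ 2 = (w x - w y) * (P x - P y) -
          (w x - w y) * (P x - 2 * c * Q x + c ^ 2 * w x - (P y - 2 * c * Q y + c ^ 2 * w y)) +
          (Q x - c * w x - (Q y - c * w y)) ^ 2 := by ring
      rw [e]
      linarith
    · refine div_le_div_of_nonneg_right ?_ hk
      have h1 : (P x - P y) = c * (Q x - Q y) + (P x - c * Q x - (P y - c * Q y)) := by ring
      have h2 : (c * (Q x - Q y)) ^ 2 ≤ (Q x - Q y) ^ 2 := by
        rw [mul_pow]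
        exact mul_le_of_le_one_left (sq_nonneg _) (pow_le_one₀ hc0 hc1)
      rw [h1]
      refine add_sq_le.trans ?_
      linarith
  have hPZ : ∀ x ∈ B, P x ^ 2 ≤ Z x := by
    intro x hx
    obtain ⟨t, ht, hxt⟩ := exists_cell_of_mem_closure (hK := hK) hT hΩ (subset_closure (hB hx))
    have h1 := hh t ht x hxt hx
    have h2 := abs_interp_mul_le (x₀ := x₀) hw ht hxt h1 (θ := fun q => η q ^ 2) (A := 1)
      (fun q _ => by
        rw [abs_pow]; exact pow_le_one₀ (abs_nonneg _) (abs_cutoff_le_one _ _ _))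
      fun h => ⟨0, fun q hq => by
        have h3 := norm_sub_le_cellDiam hq hxt
        have h4 := norm_sub_le_norm_sub_add_norm_sub x q x₀
        rw [norm_sub_rev x q] at h4
        have : η q = 0 := cutoff_eq_zero hR (by linarith)
        rw [this]; ring⟩
    rw [one_mul] at h2
    rw [← sq_abs, ← Real.sq_sqrt (hZ0 x)]
    exact pow_le_pow_left₀ (abs_nonneg _) h2 2
  have hP2 : ∫ x in B, P x ^ 2 ≤ ∫ x in B, Z x := by
    refine setIntegral_mono_on ?_ hZi measurableSet_ball hPZ
    exact ((hPmem.1.1.pow 2).continuousOn.integrableOn_compact (isCompact_closedBall x₀ R)).mono_set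
      ball_subset_closedBall
  have hL1 : ∫ p in B ×ˢ B, (Q p.1 - Q p.2) ^ 2 / kernelDenom s p.1 p.2 ≤
      (∫ p in B ×ˢ B, (w p.1 - w p.2) * (P p.1 - P p.2) / kernelDenom s p.1 p.2) +
      2 * ∫ p in B ×ˢ B, r p := by
    rw [← integral_const_mul, ← integral_add iwP (ir.const_mul 2)]
    exact setIntegral_mono_on iQQ (iwP.add (ir.const_mul 2)) hmB fun p hp => (hpt p hp).1
  have hL2 : ∫ p in B ×ˢ B, (P p.1 - P p.2) ^ 2 / kernelDenom s p.1 p.2 ≤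
      2 * (∫ p in B ×ˢ B, (Q p.1 - Q p.2) ^ 2 / kernelDenom s p.1 p.2) +
      2 * ∫ p in B ×ˢ B, r p := by
    rw [← integral_const_mul, ← integral_const_mul,
      ← integral_add (iQQ.const_mul 2) (ir.const_mul 2)]
    exact setIntegral_mono_on iPP ((iQQ.const_mul 2).add (ir.const_mul 2)) hmB
      fun p hp => (hpt p hp).2
  have hL3 := hLG P hPmem fun x hx => hP0 x fun hx' => hx (ball_subset_ball (by linarith) hx')
  have hRs : R ^ (2 - 2 * s) / R ^ 2 = R ^ (-(2 * s)) := by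
    rw [← Real.rpow_natCast R 2, ← Real.rpow_sub hR]; congr 1; push_cast; ring
  have hr3 : ∫ p in B ×ˢ B, r p ≤ C₁ * C₂ * (R ^ (-(2 * s)) * ∫ x in B, Z x) := by
    rw [hr, integral_const_mul, ← hRs]
    calc _ ≤ C₁ / R ^ 2 * (C₂ * R ^ (2 - 2 * s) * ∫ x in B, Z x) :=
          mul_le_mul_of_nonneg_left hZE (by positivity)
      _ = _ := by ring
  have hRp : 0 < R ^ (-(2 * s)) := Real.rpow_pos_of_pos hR _
  have hC₀' : C₀ * (R ^ (-(2 * s)) * ∫ x in B, P x ^ 2) ≤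
      C₀ * (R ^ (-(2 * s)) * ∫ x in B, Z x) := by gcongr
  have hZ3 : R ^ (-(2 * s)) * ∫ x in B, Z x ≤ C₃ * (R ^ (-(2 * s)) * ∫ x in B, w x ^ 2) := by
    calc _ ≤ R ^ (-(2 * s)) * (C₃ * ∫ x in B, w x ^ 2) := mul_le_mul_of_nonneg_left hZle hRp.le
      _ = _ := by ring
  set N := R ^ (-(2 * s)) * ∫ x in B, w x ^ 2 with hN
  have hN0 : 0 ≤ N := mul_nonneg hRp.le (integral_nonneg fun _ => sq_nonneg _)
  set NZ := R ^ (-(2 * s)) * ∫ x in B, Z x with hNZ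
  set IQ := ∫ p in B ×ˢ B, (Q p.1 - Q p.2) ^ 2 / kernelDenom s p.1 p.2 with hIQ
  have hfin : 3 / 4 * IQ ≤ M + (C₀ + 3 * (C₁ * C₂)) * NZ := by
    have : 9 / 4 * ∫ p in B ×ˢ B, r p ≤ 3 * (C₁ * C₂ * NZ) := by
      have h0 : 0 ≤ C₁ * C₂ * NZ := by
        have : 0 ≤ NZ := mul_nonneg hRp.le (integral_nonneg hZ0)
        positivity
      linarith
    nlinarith
  have hsmall : ball x₀ (R / 2) ⊆ B := ball_subset_ball (by linarith)
  have hQw : ∀ x ∈ ball x₀ (R / 2), Q x = w x := by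
    intro x hx
    obtain ⟨t, ht, hxt⟩ := exists_cell_of_mem_closure (hK := hK) hT hΩ
      (subset_closure (hB (hsmall hx)))
    have h1 := hh t ht x hxt (hsmall hx)
    rw [← interp_self_of_mem_feSpace hw ht hxt, hQ]
    refine interp_congr ht hxt fun q hq => ?_
    have h3 := norm_sub_le_cellDiam hq hxt
    have h4 := norm_sub_le_norm_sub_add_norm_sub q x x₀
    rw [mem_ball, dist_eq_norm] at hx
    have : η q = 1 := cutoff_eq_one hR (by linarith)
    rw [this, one_mul]
  have hleft : ∫ p in ball x₀ (R / 2) ×ˢ ball x₀ (R / 2),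
      (w p.1 - w p.2) ^ 2 / kernelDenom s p.1 p.2 ≤ IQ := by
    rw [setIntegral_congr_fun (g := fun p => (Q p.1 - Q p.2) ^ 2 / kernelDenom s p.1 p.2)
      (measurableSet_ball.prod measurableSet_ball) fun p hp => by
        simp only [hQw p.1 hp.1, hQw p.2 hp.2]]
    exact setIntegral_mono_set iQQ
      (Filter.Eventually.of_forall fun p => div_nonneg (sq_nonneg _) (kernelDenom_nonneg _ _ _))
      (Set.prod_mono hsmall hsmall).eventuallyLE
  refine hleft.trans ?_
  have h5 : (C₀ + 3 * (C₁ * C₂)) * NZ ≤ (C₀ + 3 * (C₁ * C₂)) * (C₃ * N) :=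
    mul_le_mul_of_nonneg_left hZ3 (by positivity)
  have h6 : 0 ≤ (C₀ + 3 * (C₁ * C₂)) * C₃ * M := by positivity
  nlinarith

end CaccioppoliIntegrated

/-! ### Piecewise affine functions on the line -/

section Line

open Set

variable {s R ρ ρ' L : ℝ} {W : ℝ → ℝ} {b c : ℝ}

/-- The square of the Sobolev-Slobodeckij seminorm on the interval `(-ρ, ρ)`. -/
noncomputable def lineEnergy (s : ℝ) (W : ℝ → ℝ) (ρ : ℝ) : ℝ :=
  ∫ p in Ioo (-ρ) ρ ×ˢ Ioo (-ρ) ρ, (W p.1 - W p.2) ^ 2 / |p.1 - p.2| ^ (1 + 2 * s)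

/-- The energy of the interaction of `W` on `(b, R)` with the constant value `W b` to the left of `b`,
up to a factor. -/
noncomputable def endpointEnergy (s R : ℝ) (W : ℝ → ℝ) (b : ℝ) : ℝ :=
  ∫ y in Ioo b R, (W y - W b) ^ 2 * (y - b) ^ (-(2 * s))

/-- A finite family `𝒯` of nondegenerate intervals `[T.1, T.2]` of length at most `R / 16` without
overlaps that covers `(-R, R)`. -/
structure IsIntervalMesh (𝒯 : Finset (ℝ × ℝ)) (R : ℝ) : Prop where
  lt : ∀ T ∈ 𝒯, T.1 < T.2
  length_le : ∀ T ∈ 𝒯, T.2 - T.1 ≤ R / 16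
  disjoint : ∀ T ∈ 𝒯, ∀ T' ∈ 𝒯, T ≠ T' → Disjoint (Ioo T.1 T.2) (Ioo T'.1 T'.2)
  cover : ∀ x ∈ Ioo (-R) R, ∃ T ∈ 𝒯, x ∈ Icc T.1 T.2

/-- `W` is affine on the interval `[b, c]`. -/
def IsAffineOnIcc (W : ℝ → ℝ) (b c : ℝ) : Prop :=
  ∀ x ∈ Icc b c, W x = W b + (W c - W b) / (c - b) * (x - b)

theorem integral_affine_sq (α m : ℝ) (hbc : b ≤ c) :
    ∫ x in Ioo b c, (α + m * (x - b)) ^ 2 =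
      α ^ 2 * (c - b) + α * m * (c - b) ^ 2 + m ^ 2 * (c - b) ^ 3 / 3 := by
  rw [← integral_Ioc_eq_integral_Ioo, ← intervalIntegral.integral_of_le hbc]
  have h : ∀ x ∈ uIcc b c, HasDerivAt
      (fun x => α ^ 2 * (x - b) + α * m * (x - b) ^ 2 + m ^ 2 * (x - b) ^ 3 / 3)
      ((α + m * (x - b)) ^ 2) x := by
    intro x _
    have h1 : HasDerivAt (fun x : ℝ => x - b) 1 x := (hasDerivAt_id x).sub_const b
    have h2 := ((h1.const_mul (α ^ 2)).add ((h1.pow 2).const_mul (α * m))).add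
      (((h1.pow 3).const_mul (m ^ 2)).div_const 3)
    convert! h2 using 1
    push_cast
    ring
  rw [intervalIntegral.integral_eq_sub_of_hasDerivAt h
    ((by fun_prop : Continuous fun x : ℝ => (α + m * (x - b)) ^ 2).intervalIntegrable _ _)]
  ring

/-- Inverse estimate: the values of an affine function at the ends of an interval are controlled by its
`L²` norm. -/
theorem IsAffineOnIcc.sq_sub_le (h : IsAffineOnIcc W b c) (hbc : b < c) (a : ℝ) :
    (c - b) * (W b - a) ^ 2 ≤ 4 * ∫ x in Ioo b c, (W x - a) ^ 2 ∧
    (c - b) * (W c - a) ^ 2 ≤ 4 * ∫ x in Ioo b c, (W x - a) ^ 2 := by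
  have e : ∫ x in Ioo b c, (W x - a) ^ 2 =
      ∫ x in Ioo b c, ((W b - a) + (W c - W b) / (c - b) * (x - b)) ^ 2 :=
    setIntegral_congr_fun measurableSet_Ioo fun x hx => by
      simp only [h x (Ioo_subset_Icc_self hx)]; ring
  have hne : 0 < c - b := sub_pos.2 hbc
  rw [e, integral_affine_sq _ _ hbc.le]
  have e2 : (W b - a) ^ 2 * (c - b) + (W b - a) * ((W c - W b) / (c - b)) * (c - b) ^ 2 +
      ((W c - W b) / (c - b)) ^ 2 * (c - b) ^ 3 / 3 =
      (c - b) * (((W b - a) ^ 2 + (W b - a) * (W c - a) + (W c - a) ^ 2) / 3) := by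
    field_simp; ring
  rw [e2]
  constructor <;> rw [mul_left_comm] <;> refine mul_le_mul_of_nonneg_left ?_ hne.le
  · nlinarith [sq_nonneg (W b - a + 2 * (W c - a))]
  · nlinarith [sq_nonneg (2 * (W b - a) + (W c - a))]

theorem continuous_of_abs_sub_le (hL : ∀ x y, |W x - W y| ≤ L * |x - y|) : Continuous W := by
  have hL0 : 0 ≤ L := by
    have := (abs_nonneg _).trans (hL 1 0)
    simpa using this
  exact (LipschitzWith.of_dist_le_mul (K := ⟨L, hL0⟩) fun x y => by
    rw [Real.dist_eq, Real.dist_eq]; exact hL x y).continuous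

theorem sq_sub_le_of_abs_sub_le (hL : ∀ x y, |W x - W y| ≤ L * |x - y|) (x y : ℝ) :
    (W x - W y) ^ 2 ≤ L ^ 2 * |x - y| ^ 2 := by
  rw [← mul_pow, ← sq_abs]
  exact pow_le_pow_left₀ (abs_nonneg _) (hL x y) 2

theorem sq_mul_rpow_neg_le {a : ℝ} (ha : 0 ≤ a) {A : ℝ} (haA : a ≤ A) (hs1 : s < 1) :
    a ^ 2 * a ^ (-(2 * s)) ≤ A ^ (2 - 2 * s) := by
  rcases ha.eq_or_lt with rfl | ha
  · rw [zero_pow two_ne_zero, zero_mul]; exact Real.rpow_nonneg haA _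
  · rw [← Real.rpow_natCast a 2, ← Real.rpow_add ha]
    refine (Real.rpow_le_rpow ha.le haA (by push_cast; linarith)).trans (le_of_eq ?_)
    congr 1

theorem integrableOn_sq_sub_mul_rpow (hs1 : s < 1)
    (hL : ∀ x y, |W x - W y| ≤ L * |x - y|) (R : ℝ) :
    IntegrableOn (fun p : ℝ × ℝ => (W p.1 - W p.2) ^ 2 * |p.1 - p.2| ^ (-(2 * s)))
      (Ioo (-R) R ×ˢ Ioo (-R) R) := by
  have hW := (continuous_of_abs_sub_le hL).measurable
  refine Measure.integrableOn_of_bounded (M := L ^ 2 * (2 * R) ^ (2 - 2 * s)) ?_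
    (by fun_prop) ?_
  · rw [Measure.volume_eq_prod, Measure.prod_prod]
    exact ENNReal.mul_ne_top (by simp) (by simp)
  · refine (ae_restrict_mem (measurableSet_Ioo.prod measurableSet_Ioo)).mono fun p hp => ?_
    obtain ⟨⟨h1, h2⟩, h3, h4⟩ := hp
    have h5 : |p.1 - p.2| ≤ 2 * R := abs_le.2 ⟨by linarith, by linarith⟩
    rw [Real.norm_of_nonneg (mul_nonneg (sq_nonneg _) (Real.rpow_nonneg (abs_nonneg _) _))]
    calc _ ≤ L ^ 2 * |p.1 - p.2| ^ 2 * |p.1 - p.2| ^ (-(2 * s)) :=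
          mul_le_mul_of_nonneg_right (sq_sub_le_of_abs_sub_le hL _ _)
            (Real.rpow_nonneg (abs_nonneg _) _)
      _ ≤ _ := by
          rw [mul_assoc]
          exact mul_le_mul_of_nonneg_left (sq_mul_rpow_neg_le (abs_nonneg _) h5 hs1)
            (sq_nonneg _)

theorem integrableOn_endpoint (hs1 : s < 1)
    (hL : ∀ x y, |W x - W y| ≤ L * |x - y|) (b R : ℝ) :
    IntegrableOn (fun y => (W y - W b) ^ 2 * (y - b) ^ (-(2 * s))) (Ioo b R) := by
  have hW := (continuous_of_abs_sub_le hL).measurable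
  refine Measure.integrableOn_of_bounded (M := L ^ 2 * (R - b) ^ (2 - 2 * s)) (by simp)
    (by fun_prop) ?_
  refine (ae_restrict_mem measurableSet_Ioo).mono fun y hy => ?_
  have hy0 : 0 ≤ y - b := sub_nonneg.2 hy.1.le
  have h1 := sq_sub_le_of_abs_sub_le hL y b
  rw [abs_of_nonneg hy0] at h1
  rw [Real.norm_of_nonneg (mul_nonneg (sq_nonneg _) (Real.rpow_nonneg hy0 _))]
  calc _ ≤ L ^ 2 * (y - b) ^ 2 * (y - b) ^ (-(2 * s)) :=
        mul_le_mul_of_nonneg_right h1 (Real.rpow_nonneg hy0 _)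
    _ ≤ _ := by
        rw [mul_assoc]
        exact mul_le_mul_of_nonneg_left
          (sq_mul_rpow_neg_le hy0 (by linarith [hy.2]) hs1) (sq_nonneg _)

theorem endpointEnergy_nonneg (s R : ℝ) (W : ℝ → ℝ) (b : ℝ) : 0 ≤ endpointEnergy s R W b :=
  setIntegral_nonneg measurableSet_Ioo fun _ hy =>
    mul_nonneg (sq_nonneg _) (Real.rpow_nonneg (sub_nonneg.2 hy.1.le) _)

theorem exists_integral_sq_div_le (hs1 : s < 1) : ∃ C : ℝ, 0 < C ∧ ∀ R : ℝ, 0 < R →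
    IntegrableOn (fun p : ℝ × ℝ => |p.1 - p.2| ^ 2 / |p.1 - p.2| ^ (1 + 2 * s))
      (Ioo (-R) R ×ˢ Ioo (-R) R) ∧
    ∫ p in Ioo (-R) R ×ˢ Ioo (-R) R, |p.1 - p.2| ^ 2 / |p.1 - p.2| ^ (1 + 2 * s) ≤
      C * R ^ (3 - 2 * s) := by
  obtain ⟨C, hC, h⟩ := exists_integral_norm_sq_div_mul_le (volume : Measure ℝ) (by simp) hs1
  refine ⟨C, hC, fun R hR => ?_⟩
  have hb : ball (0 : ℝ) R = Ioo (-R) R := by rw [Real.ball_eq_Ioo]; simp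
  obtain ⟨h1, h2⟩ := h 0 R hR _ measurableSet_ball le_rfl (fun _ => 1 / 2) (fun _ _ => by norm_num)
    (integrableOn_const measure_ball_lt_top.ne)
  rw [hb] at h1 h2
  have e : (1 / 2 + 1 / 2 : ℝ) = 1 := by norm_num
  simp only [Module.finrank_self, Nat.cast_one, Real.norm_eq_abs, e, mul_one,
    ← Measure.volume_eq_prod] at h1 h2
  refine ⟨h1, h2.trans (le_of_eq ?_)⟩
  rw [setIntegral_const, Measure.real, Real.volume_Ioo, ENNReal.toReal_ofReal (by linarith),
    smul_eq_mul, show 3 - 2 * s = 2 - 2 * s + 1 by ring, Real.rpow_add_one hR.ne']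
  ring

theorem integrableOn_lineEnergy (hs1 : s < 1) (hL : ∀ x y, |W x - W y| ≤ L * |x - y|) (ρ : ℝ) :
    IntegrableOn (fun p : ℝ × ℝ => (W p.1 - W p.2) ^ 2 / |p.1 - p.2| ^ (1 + 2 * s))
      (Ioo (-ρ) ρ ×ˢ Ioo (-ρ) ρ) := by
  rcases le_or_gt ρ 0 with hρ | hρ
  · rw [Ioo_eq_empty (by linarith)]; simp
  have hW := (continuous_of_abs_sub_le hL).measurable
  obtain ⟨C, -, h⟩ := exists_integral_sq_div_le hs1
  refine ((h ρ hρ).1.const_mul (L ^ 2)).mono'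
    (Measurable.aestronglyMeasurable (by fun_prop)) (Filter.Eventually.of_forall fun p => ?_)
  rw [Real.norm_of_nonneg (div_nonneg (sq_nonneg _) (Real.rpow_nonneg (abs_nonneg _) _)),
    ← mul_div_assoc]
  exact div_le_div_of_nonneg_right (sq_sub_le_of_abs_sub_le hL _ _)
    (Real.rpow_nonneg (abs_nonneg _) _)

theorem lineEnergy_nonneg (s : ℝ) (W : ℝ → ℝ) (ρ : ℝ) : 0 ≤ lineEnergy s W ρ :=
  integral_nonneg fun _ => div_nonneg (sq_nonneg _) (Real.rpow_nonneg (abs_nonneg _) _)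

theorem lineEnergy_mono (hs1 : s < 1) (hL : ∀ x y, |W x - W y| ≤ L * |x - y|) (h : ρ ≤ ρ') :
    lineEnergy s W ρ ≤ lineEnergy s W ρ' := by
  have hsub : Ioo (-ρ) ρ ⊆ Ioo (-ρ') ρ' := Ioo_subset_Ioo (by linarith) h
  exact setIntegral_mono_set (integrableOn_lineEnergy hs1 hL ρ')
    (Filter.Eventually.of_forall fun _ =>
      div_nonneg (sq_nonneg _) (Real.rpow_nonneg (abs_nonneg _) _))
    (prod_mono hsub hsub).eventuallyLE

/-- The endpoint energy at the left end `b` of an interval on which `W` is affine, by an average over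
that interval. -/
theorem IsAffineOnIcc.endpointEnergy_le (hs0 : 0 < s) (hs1 : s < 1)
    (hL : ∀ x y, |W x - W y| ≤ L * |x - y|) (h : IsAffineOnIcc W b c) (hbc : b < c)
    (hb : -R ≤ b) (hc : c ≤ R) :
    (c - b) * endpointEnergy s R W b ≤
      16 * ∫ p in Ioo b c ×ˢ Ioo (-R) R, (W p.1 - W p.2) ^ 2 * |p.1 - p.2| ^ (-(2 * s)) := by
  have hW := continuous_of_abs_sub_le hL
  set f : ℝ × ℝ → ℝ := fun p => (W p.1 - W p.2) ^ 2 * |p.1 - p.2| ^ (-(2 * s)) with hf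
  have hf0 : ∀ p, 0 ≤ f p := fun p => mul_nonneg (sq_nonneg _) (Real.rpow_nonneg (abs_nonneg _) _)
  have hfi := integrableOn_sq_sub_mul_rpow hs1 hL R
  have hi1 : IntegrableOn f (Ioo b c ×ˢ Ioo (-R) R) :=
    hfi.mono_set (prod_mono (Ioo_subset_Ioo hb hc) le_rfl)
  have hi2 : IntegrableOn f (Ioo b c ×ˢ Ioo b R) :=
    hi1.mono_set (prod_mono le_rfl (Ioo_subset_Ioo_left hb))
  have hh : 0 < c - b := sub_pos.2 hbc
  set T := Ioo b c with hT
  have hTi : ∀ g : ℝ → ℝ, Continuous g → IntegrableOn g T := fun g hg =>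
    (hg.integrableOn_Icc).mono_set Ioo_subset_Icc_self
  have hslice : ∀ᵐ y ∂(volume.restrict (Ioo b R)), IntegrableOn (fun x => f (x, y)) T := by
    have := hi2
    rw [IntegrableOn, Measure.volume_eq_prod, ← Measure.prod_restrict] at this
    exact this.prod_left_ae
  have key : ∀ y ∈ Ioo b R, IntegrableOn (fun x => f (x, y)) T →
      (c - b) * ((W y - W b) ^ 2 * (y - b) ^ (-(2 * s))) ≤ 16 * ∫ x in T, f (x, y) := by
    intro y hy hyi
    have hyb : 0 < y - b := sub_pos.2 hy.1
    obtain ⟨ha, hb'⟩ := h.sq_sub_le hbc (W y)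
    have hI0 : 0 ≤ ∫ x in T, (W x - W y) ^ 2 := integral_nonneg fun _ => sq_nonneg _
    have hgi : IntegrableOn (fun x => (W x - W y) ^ 2) T := hTi _ (by fun_prop)
    rcases le_or_gt c y with hcy | hyc
    · have h1 : (∫ x in T, (W x - W y) ^ 2) * (y - b) ^ (-(2 * s)) ≤ ∫ x in T, f (x, y) := by
        rw [← integral_mul_const]
        refine setIntegral_mono_on (hgi.mul_const _) hyi measurableSet_Ioo fun x hx => ?_
        refine mul_le_mul_of_nonneg_left ?_ (sq_nonneg _)
        have hx' : 0 < y - x := by linarith [hx.2]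
        simp only
        rw [abs_sub_comm, abs_of_pos hx']
        exact Real.rpow_le_rpow_of_nonpos hx' (by linarith [hx.1]) (by linarith)
      have h2 : 0 ≤ (y - b) ^ (-(2 * s)) := Real.rpow_nonneg hyb.le _
      calc _ = (c - b) * (W b - W y) ^ 2 * (y - b) ^ (-(2 * s)) := by ring
        _ ≤ 4 * (∫ x in T, (W x - W y) ^ 2) * (y - b) ^ (-(2 * s)) := by gcongr
        _ ≤ 4 * ∫ x in T, f (x, y) := by rw [mul_assoc]; gcongr
        _ ≤ _ := by
          have : 0 ≤ ∫ x in T, f (x, y) := integral_nonneg fun x => hf0 _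
          linarith
    · -- here `y` lies in the interval itself and `W` is affine between `b` and `y`
      have h1 : (∫ x in T, (W x - W y) ^ 2) * (c - b) ^ (-(2 * s)) ≤ ∫ x in T, f (x, y) := by
        rw [← integral_mul_const]
        refine setIntegral_mono_on (hgi.mul_const _) hyi measurableSet_Ioo fun x hx => ?_
        rcases eq_or_ne x y with rfl | hne
        · simp [hf]
        refine mul_le_mul_of_nonneg_left ?_ (sq_nonneg _)
        refine Real.rpow_le_rpow_of_nonpos (abs_pos.2 (sub_ne_zero.2 hne)) ?_ (by linarith)
        exact abs_le.2 ⟨by linarith [hx.1], by linarith [hx.2, hy.1]⟩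
      have h2 : (W y - W b) ^ 2 * (y - b) ^ (-(2 * s)) ≤
          (W c - W b) ^ 2 * (c - b) ^ (-(2 * s)) := by
        have e1 : W y - W b = (W c - W b) / (c - b) * (y - b) := by
          rw [h y ⟨hy.1.le, hyc.le⟩]; ring
        have e2 : (W c - W b) ^ 2 * (c - b) ^ (-(2 * s)) =
            ((W c - W b) / (c - b)) ^ 2 * (c - b) ^ (2 - 2 * s) := by
          rw [show 2 - 2 * s = -(2 * s) + (2 : ℕ) by push_cast; ring, Real.rpow_add hh,
            Real.rpow_natCast]
          field_simp
        rw [e1, e2, mul_pow, mul_assoc]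
        exact mul_le_mul_of_nonneg_left
          (sq_mul_rpow_neg_le hyb.le (by linarith) hs1) (sq_nonneg _)
      have h3 : (c - b) * (W c - W b) ^ 2 ≤ 16 * ∫ x in T, (W x - W y) ^ 2 := by
        have : (W c - W b) ^ 2 ≤ 2 * (W c - W y) ^ 2 + 2 * (W b - W y) ^ 2 := by
          nlinarith [sq_nonneg ((W c - W y) + (W b - W y))]
        nlinarith
      have h4 : 0 ≤ (c - b) ^ (-(2 * s)) := Real.rpow_nonneg hh.le _
      calc _ ≤ (c - b) * ((W c - W b) ^ 2 * (c - b) ^ (-(2 * s))) := by gcongr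
        _ = ((c - b) * (W c - W b) ^ 2) * (c - b) ^ (-(2 * s)) := by ring
        _ ≤ (16 * ∫ x in T, (W x - W y) ^ 2) * (c - b) ^ (-(2 * s)) := by gcongr
        _ = 16 * ((∫ x in T, (W x - W y) ^ 2) * (c - b) ^ (-(2 * s))) := by ring
        _ ≤ _ := by gcongr
  have hi2' : Integrable f ((volume.restrict T).prod (volume.restrict (Ioo b R))) := by
    rw [Measure.prod_restrict]; exact hi2
  have hfub : ∫ p in T ×ˢ Ioo b R, f p = ∫ y in Ioo b R, ∫ x in T, f (x, y) := by
    rw [Measure.volume_eq_prod, ← Measure.prod_restrict, integral_prod_symm _ hi2']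
  calc (c - b) * endpointEnergy s R W b
      = ∫ y in Ioo b R, (c - b) * ((W y - W b) ^ 2 * (y - b) ^ (-(2 * s))) := by
        rw [endpointEnergy, integral_const_mul]
    _ ≤ ∫ y in Ioo b R, 16 * ∫ x in T, f (x, y) := by
        refine integral_mono_ae ((integrableOn_endpoint hs1 hL b R).const_mul _)
          (hi2'.integral_prod_right.const_mul _) ?_
        filter_upwards [hslice, ae_restrict_mem measurableSet_Ioo] with y h1 h2
        exact key y h2 h1
    _ = 16 * ∫ p in T ×ˢ Ioo b R, f p := by rw [integral_const_mul, hfub]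
    _ ≤ _ := by
        refine mul_le_mul_of_nonneg_left ?_ (by norm_num)
        exact setIntegral_mono_set hi1 (Filter.Eventually.of_forall hf0)
          (prod_mono le_rfl (Ioo_subset_Ioo_left hb)).eventuallyLE

end Line

/-! ### Nodes suitable for cutting off -/

section Selection

open Set

variable {s R ρ ρ' L : ℝ} {W : ℝ → ℝ} {b c : ℝ}

theorem sum_setIntegral_le_of_disjoint {α ι : Type*} [MeasurableSpace α] {ν : Measure α} {f : α → ℝ}
    (S : Finset ι) {A : ι → Set α} {D : Set α} (hA : ∀ i ∈ S, MeasurableSet (A i))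
    (hdis : ∀ i ∈ S, ∀ j ∈ S, i ≠ j → Disjoint (A i) (A j)) (hAD : ∀ i ∈ S, A i ⊆ D)
    (hf : IntegrableOn f D ν) (hf0 : ∀ x, 0 ≤ f x) :
    ∑ i ∈ S, ∫ x in A i, f x ∂ν ≤ ∫ x in D, f x ∂ν := by
  rw [← integral_biUnion_finset S hA (fun i hi j hj => hdis i hi j hj)
    (fun i hi => hf.mono_set (hAD i hi))]
  exact setIntegral_mono_set hf (Filter.Eventually.of_forall hf0)
    (iUnion₂_subset hAD).eventuallyLE

theorem rpow_neg_le_mul_div_sq {a : ℝ} (ha : 0 < a) (haR : a ≤ R) (hs1 : s < 1) :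
    a ^ (-(2 * s)) ≤ R ^ (-(2 * s)) * (R / a) ^ 2 := by
  have hR : 0 < R := ha.trans_le haR
  have h1 : 1 ≤ R / a := (one_le_div ha).2 haR
  have e : a ^ (-(2 * s)) = R ^ (-(2 * s)) * (R / a) ^ (2 * s) := by
    rw [Real.div_rpow hR.le ha.le, Real.rpow_neg hR.le, Real.rpow_neg ha.le]
    have := (Real.rpow_pos_of_pos hR (2 * s)).ne'
    field_simp
  rw [e, ← Real.rpow_natCast (R / a) 2]
  exact mul_le_mul_of_nonneg_left
    (Real.rpow_le_rpow_of_exponent_le h1 (by push_cast; linarith)) (Real.rpow_nonneg hR.le _)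

/-- A long interval of the mesh: its left end has small endpoint energy, by the inverse estimate. -/
theorem IsAffineOnIcc.endpointEnergy_le_of_le (hs0 : 0 < s) (hs1 : s < 1) (hR : 0 < R)
    (hL : ∀ x y, |W x - W y| ≤ L * |x - y|) (h : IsAffineOnIcc W b c) (hbc : b < c)
    (hb : 0 ≤ b) (hc : c ≤ R) {a : ℝ} (ha : 0 < a) (hac : a ≤ c - b) :
    endpointEnergy s R W b + R ^ (1 - 2 * s) * W b ^ 2 ≤
      54 * (R / a) ^ 3 * (R ^ (-(2 * s)) * ∫ x in Ioo (-R) R, W x ^ 2) ∧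
    ((W c - W b) / (c - b)) ^ 2 ≤ 16 * (R / a) ^ 3 * ((∫ x in Ioo (-R) R, W x ^ 2) / R ^ 3) := by
  have hW := continuous_of_abs_sub_le hL
  set N := ∫ x in Ioo (-R) R, W x ^ 2 with hN
  have hN0 : 0 ≤ N := integral_nonneg fun _ => sq_nonneg _
  set h' := c - b with hh'
  have hh0 : 0 < h' := sub_pos.2 hbc
  have hWi : IntegrableOn (fun x => W x ^ 2) (Ioo (-R) R) :=
    ((hW.pow 2).integrableOn_Icc).mono_set Ioo_subset_Icc_self
  have hTN : ∫ x in Ioo b c, (W x - 0) ^ 2 ≤ N := by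
    simp only [sub_zero]
    exact setIntegral_mono_set hWi (Filter.Eventually.of_forall fun _ => sq_nonneg _)
      (Ioo_subset_Ioo (by linarith) hc).eventuallyLE
  obtain ⟨hWb, hWc⟩ := h.sq_sub_le hbc 0
  rw [sub_zero] at hWb hWc
  rw [← hh'] at hWb hWc
  have hWb' : W b ^ 2 ≤ 4 * N / h' := by rw [le_div_iff₀ hh0]; linarith
  have hWc' : W c ^ 2 ≤ 4 * N / h' := by rw [le_div_iff₀ hh0]; linarith
  have hosc : (W c - W b) ^ 2 ≤ 16 * N / h' := by
    have h1 : (W c - W b) ^ 2 ≤ 2 * W c ^ 2 + 2 * W b ^ 2 := by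
      nlinarith [sq_nonneg (W c + W b)]
    have h2 : 16 * N / h' = 4 * (4 * N / h') := by ring
    linarith
  have hRa : (R / h') ^ 3 ≤ (R / a) ^ 3 := by gcongr
  have hhR : h' ≤ R := by linarith
  constructor
  · have hpt : ∀ y ∈ Ioo b R, (W y - W b) ^ 2 * (y - b) ^ (-(2 * s)) ≤
        h' ^ (-(2 * s)) * (2 * W y ^ 2 + 24 * N / h') := by
      intro y hy
      have hyb : 0 < y - b := sub_pos.2 hy.1
      rcases le_or_gt c y with hcy | hyc
      · have h1 : (y - b) ^ (-(2 * s)) ≤ h' ^ (-(2 * s)) :=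
          Real.rpow_le_rpow_of_nonpos hh0 (by linarith) (by linarith)
        have h2 : (W y - W b) ^ 2 ≤ 2 * W y ^ 2 + 2 * W b ^ 2 := by
          nlinarith [sq_nonneg (W y + W b)]
        have h3 : 24 * N / h' = 2 * (4 * N / h') + 16 * N / h' := by ring
        have h4 : 0 ≤ 16 * N / h' := by positivity
        rw [mul_comm]
        exact mul_le_mul h1 (by linarith) (sq_nonneg _) (Real.rpow_nonneg hh0.le _)
      · have e1 : W y - W b = (W c - W b) / h' * (y - b) := by
          rw [h y ⟨hy.1.le, hyc.le⟩]; ring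
        have e2 : (W c - W b) ^ 2 * h' ^ (-(2 * s)) =
            ((W c - W b) / h') ^ 2 * h' ^ (2 - 2 * s) := by
          rw [show 2 - 2 * s = -(2 * s) + (2 : ℕ) by push_cast; ring, Real.rpow_add hh0,
            Real.rpow_natCast]
          field_simp
        calc (W y - W b) ^ 2 * (y - b) ^ (-(2 * s)) ≤ (W c - W b) ^ 2 * h' ^ (-(2 * s)) := by
              rw [e1, e2, mul_pow, mul_assoc]
              exact mul_le_mul_of_nonneg_left
                (sq_mul_rpow_neg_le hyb.le (by linarith) hs1) (sq_nonneg _)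
          _ ≤ _ := by
              rw [mul_comm]
              refine mul_le_mul_of_nonneg_left ?_ (Real.rpow_nonneg hh0.le _)
              have h3 : 24 * N / h' = 2 * (4 * N / h') + 16 * N / h' := by ring
              have h4 : 0 ≤ 4 * N / h' := by positivity
              nlinarith [sq_nonneg (W y)]
    have hWib : IntegrableOn (fun x => W x ^ 2) (Ioo b R) :=
      hWi.mono_set (Ioo_subset_Ioo_left (by linarith))
    have hci : IntegrableOn (fun _ : ℝ => 24 * N / h') (Ioo b R) :=
      integrableOn_const (by simp)
    have hsi : IntegrableOn (fun y => 2 * W y ^ 2 + 24 * N / h') (Ioo b R) :=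
      (hWib.const_mul 2).add hci
    have hB : endpointEnergy s R W b ≤ h' ^ (-(2 * s)) * (2 * N + R * (24 * N / h')) := by
      calc endpointEnergy s R W b
          ≤ ∫ y in Ioo b R, h' ^ (-(2 * s)) * (2 * W y ^ 2 + 24 * N / h') :=
            setIntegral_mono_on (integrableOn_endpoint hs1 hL b R)
              (hsi.const_mul (h' ^ (-(2 * s)))) measurableSet_Ioo hpt
        _ = h' ^ (-(2 * s)) * (2 * (∫ y in Ioo b R, W y ^ 2) + (R - b) * (24 * N / h')) := by
            rw [integral_const_mul, integral_add (hWib.const_mul 2) hci, integral_const_mul,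
              setIntegral_const, Measure.real, Real.volume_Ioo, ENNReal.toReal_ofReal (by linarith),
              smul_eq_mul]
        _ ≤ _ := by
            have h1 : ∫ y in Ioo b R, W y ^ 2 ≤ N :=
              setIntegral_mono_set hWi (Filter.Eventually.of_forall fun _ => sq_nonneg _)
                (Ioo_subset_Ioo_left (by linarith)).eventuallyLE
            have h2 : 0 ≤ 24 * N / h' := by positivity
            have h3 : 0 ≤ h' ^ (-(2 * s)) := Real.rpow_nonneg hh0.le _
            gcongr
            linarith
    have h1 : h' ^ (-(2 * s)) ≤ R ^ (-(2 * s)) * (R / h') ^ 2 := rpow_neg_le_mul_div_sq hh0 hhR hs1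
    have hRp : 0 ≤ R ^ (-(2 * s)) := Real.rpow_nonneg hR.le _
    have h1R : 1 ≤ R / h' := (one_le_div hh0).2 hhR
    have h2 : 2 * N + R * (24 * N / h') ≤ 26 * (R / h') * N := by
      have : R * (24 * N / h') = 24 * (R / h') * N := by ring
      nlinarith
    have h3 : R ^ (1 - 2 * s) * W b ^ 2 ≤ 4 * (R / h') ^ 3 * (R ^ (-(2 * s)) * N) := by
      have e : R ^ (1 - 2 * s) = R ^ (-(2 * s)) * R := by
        rw [← Real.rpow_add_one hR.ne']; congr 1; ring
      have h4 : R / h' ≤ (R / h') ^ 3 := le_self_pow₀ h1R (by norm_num)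
      calc R ^ (1 - 2 * s) * W b ^ 2 ≤ R ^ (1 - 2 * s) * (4 * N / h') :=
            mul_le_mul_of_nonneg_left hWb' (Real.rpow_nonneg hR.le _)
        _ = 4 * (R / h') * (R ^ (-(2 * s)) * N) := by rw [e]; ring
        _ ≤ _ := by gcongr
    have h5 : endpointEnergy s R W b ≤ 26 * (R / h') ^ 3 * (R ^ (-(2 * s)) * N) := by
      calc _ ≤ _ := hB
        _ ≤ R ^ (-(2 * s)) * (R / h') ^ 2 * (26 * (R / h') * N) := by gcongr
        _ = _ := by ring
    calc _ ≤ 26 * (R / h') ^ 3 * (R ^ (-(2 * s)) * N) + 4 * (R / h') ^ 3 * (R ^ (-(2 * s)) * N) :=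
          add_le_add h5 h3
      _ = 30 * (R / h') ^ 3 * (R ^ (-(2 * s)) * N) := by ring
      _ ≤ 54 * (R / a) ^ 3 * (R ^ (-(2 * s)) * N) := by gcongr; norm_num
  · calc ((W c - W b) / h') ^ 2 = (W c - W b) ^ 2 / h' ^ 2 := div_pow _ _ _
      _ ≤ 16 * N / h' / h' ^ 2 := by gcongr
      _ = 16 * (R / h') ^ 3 * (N / R ^ 3) := by field_simp
      _ ≤ _ := by gcongr

/-- Interactions weighted with `|x - y|^{-2s}`, one power less singular than the energy. -/
theorem integral_sq_sub_mul_rpow_le (hs0 : 0 < s) (hs1 : s < 1)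
    (hL : ∀ x y, |W x - W y| ≤ L * |x - y|) {a : ℝ} (ha : 0 < a) {J : Set ℝ} (hJ : MeasurableSet J)
    (hρ' : ρ' ≤ R) (hJρ : ∀ x ∈ J, ∀ y, |x - y| < a → x ∈ Ioo (-ρ') ρ' ∧ y ∈ Ioo (-ρ') ρ')
    (hR : 0 < R) :
    ∫ p in J ×ˢ Ioo (-R) R, (W p.1 - W p.2) ^ 2 * |p.1 - p.2| ^ (-(2 * s)) ≤
      a * lineEnergy s W ρ' + 8 * R * a ^ (-(2 * s)) * ∫ x in Ioo (-R) R, W x ^ 2 := by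
  have hW := continuous_of_abs_sub_le hL
  set I := Ioo (-R) R with hI
  set I' := Ioo (-ρ') ρ' with hI'
  have hI'I : I' ⊆ I := Ioo_subset_Ioo (by linarith) hρ'
  have hJI : J ⊆ I := fun x hx => hI'I (hJρ x hx x (by simpa using ha)).1
  have hsub : J ×ˢ I ⊆ I ×ˢ I := prod_mono hJI le_rfl
  set e : ℝ × ℝ → ℝ := fun p => (W p.1 - W p.2) ^ 2 / |p.1 - p.2| ^ (1 + 2 * s) with he
  have he0 : ∀ p, 0 ≤ e p := fun p => div_nonneg (sq_nonneg _) (Real.rpow_nonneg (abs_nonneg _) _)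
  have hmI' : MeasurableSet (I' ×ˢ I') := measurableSet_Ioo.prod measurableSet_Ioo
  have hei : IntegrableOn ((I' ×ˢ I').indicator e) (I ×ˢ I) :=
    (integrableOn_lineEnergy hs1 hL R).indicator hmI'
  have hWi : IntegrableOn (fun x => W x ^ 2) I :=
    ((hW.pow 2).integrableOn_Icc).mono_set Ioo_subset_Icc_self
  have h1i : IntegrableOn (fun _ : ℝ => (1 : ℝ)) I := integrableOn_const (by simp [hI])
  have hgi1 : IntegrableOn (fun p : ℝ × ℝ => W p.1 ^ 2) (I ×ˢ I) := by
    have := Integrable.mul_prod (μ := volume.restrict I) (ν := volume.restrict I) hWi h1i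
    rw [Measure.prod_restrict, ← Measure.volume_eq_prod] at this
    simpa [IntegrableOn] using this
  have hgi2 : IntegrableOn (fun p : ℝ × ℝ => W p.2 ^ 2) (I ×ˢ I) := by
    have := Integrable.mul_prod (μ := volume.restrict I) (ν := volume.restrict I) h1i hWi
    rw [Measure.prod_restrict, ← Measure.volume_eq_prod] at this
    simpa [IntegrableOn] using this
  have hv : volume.real I = 2 * R := by
    rw [hI, Measure.real, Real.volume_Ioo, ENNReal.toReal_ofReal (by linarith)]; ring
  have hg1 : ∫ p in I ×ˢ I, W p.1 ^ 2 = 2 * R * ∫ x in I, W x ^ 2 := by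
    have := setIntegral_prod_mul (μ := volume) (ν := volume) (fun x => W x ^ 2)
      (fun _ : ℝ => (1 : ℝ)) I I
    rw [← Measure.volume_eq_prod] at this
    simp only [mul_one, setIntegral_const, smul_eq_mul, hv] at this
    rw [this, mul_comm]
  have hg2 : ∫ p in I ×ˢ I, W p.2 ^ 2 = 2 * R * ∫ x in I, W x ^ 2 := by
    have := setIntegral_prod_mul (μ := volume) (ν := volume)
      (fun _ : ℝ => (1 : ℝ)) (fun x => W x ^ 2) I I
    rw [← Measure.volume_eq_prod] at this
    simp only [one_mul, mul_one, setIntegral_const, smul_eq_mul, hv] at this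
    rw [this]
  have hgi : IntegrableOn (fun p : ℝ × ℝ => W p.1 ^ 2 + W p.2 ^ 2) (I ×ˢ I) := hgi1.add hgi2
  have hbi : IntegrableOn (fun p : ℝ × ℝ => a * (I' ×ˢ I').indicator e p +
      2 * a ^ (-(2 * s)) * (W p.1 ^ 2 + W p.2 ^ 2)) (I ×ˢ I) :=
    (hei.const_mul a).add (hgi.const_mul _)
  have hap : 0 ≤ a ^ (-(2 * s)) := Real.rpow_nonneg ha.le _
  have hb0 : ∀ p : ℝ × ℝ, 0 ≤ a * (I' ×ˢ I').indicator e p +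
      2 * a ^ (-(2 * s)) * (W p.1 ^ 2 + W p.2 ^ 2) := fun p => by
    have := indicator_nonneg (s := I' ×ˢ I') (fun p _ => he0 p) p
    positivity
  calc _ ≤ ∫ p in J ×ˢ I, (a * (I' ×ˢ I').indicator e p +
        2 * a ^ (-(2 * s)) * (W p.1 ^ 2 + W p.2 ^ 2)) := by
        refine setIntegral_mono_on ((integrableOn_sq_sub_mul_rpow hs1 hL R).mono_set hsub)
          (hbi.mono_set hsub) (hJ.prod measurableSet_Ioo) ?_
        rintro ⟨x, y⟩ ⟨hx, hy⟩
        simp only at hx hy ⊢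
        rcases lt_or_ge |x - y| a with hxy | hxy
        · have hmem : (x, y) ∈ I' ×ˢ I' := hJρ x hx y hxy
          rw [indicator_of_mem hmem]
          have h1 : (W x - W y) ^ 2 * |x - y| ^ (-(2 * s)) ≤ a * e (x, y) := by
            rcases eq_or_ne x y with rfl | hne
            · simp [he]
            have hp : 0 < |x - y| := abs_pos.2 (sub_ne_zero.2 hne)
            have e1 : |x - y| ^ (-(2 * s)) = |x - y| / |x - y| ^ (1 + 2 * s) := by
              rw [Real.rpow_add hp, Real.rpow_one, Real.rpow_neg hp.le]
              field_simp
            rw [e1, he]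
            calc (W x - W y) ^ 2 * (|x - y| / |x - y| ^ (1 + 2 * s)) =
                |x - y| * ((W x - W y) ^ 2 / |x - y| ^ (1 + 2 * s)) := by ring
              _ ≤ _ := mul_le_mul_of_nonneg_right hxy.le (he0 (x, y))
          have : 0 ≤ 2 * a ^ (-(2 * s)) * (W x ^ 2 + W y ^ 2) := by positivity
          linarith
        · have h1 : |x - y| ^ (-(2 * s)) ≤ a ^ (-(2 * s)) :=
            Real.rpow_le_rpow_of_nonpos ha hxy (by linarith)
          have h2 : (W x - W y) ^ 2 ≤ 2 * (W x ^ 2 + W y ^ 2) := by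
            nlinarith [sq_nonneg (W x + W y)]
          have h3 := mul_le_mul h2 h1 (Real.rpow_nonneg (abs_nonneg _) _) (by positivity)
          have h4 : 0 ≤ a * (I' ×ˢ I').indicator e (x, y) :=
            mul_nonneg ha.le (indicator_nonneg (fun p _ => he0 p) _)
          linarith
    _ ≤ ∫ p in I ×ˢ I, (a * (I' ×ˢ I').indicator e p +
        2 * a ^ (-(2 * s)) * (W p.1 ^ 2 + W p.2 ^ 2)) :=
        setIntegral_mono_set hbi (Filter.Eventually.of_forall hb0) hsub.eventuallyLE
    _ = _ := by
        rw [integral_add (hei.const_mul a) (hgi.const_mul _), integral_const_mul,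
          integral_const_mul, integral_add hgi1 hgi2, hg1, hg2, setIntegral_indicator hmI',
          inter_eq_self_of_subset_right (prod_mono hI'I hI'I)]
        simp only [lineEnergy, he, hI']
        ring

/-- Choice of a node at which `W` can be cut off: either the left end of a long interval of the mesh,
or the best node of a region in which all intervals are short, which is at most as bad as the average
one. -/
theorem exists_node_endpointEnergy_le (hs0 : 0 < s) (hs1 : s < 1) {κ : ℝ} (hκ0 : 0 < κ)
    (hκ : κ ≤ 1 / 4) (hR : 0 < R) {𝒯 : Finset (ℝ × ℝ)} (h𝒯 : IsIntervalMesh 𝒯 R)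
    (hWT : ∀ T ∈ 𝒯, IsAffineOnIcc W T.1 T.2) (hL : ∀ x y, |W x - W y| ≤ L * |x - y|)
    (hρ : R / 2 ≤ ρ) (hρρ' : ρ < ρ') (hρ' : ρ' ≤ 3 / 4 * R) :
    ∃ T ∈ 𝒯, 7 / 16 * R ≤ T.1 ∧ T.1 ≤ 3 / 4 * R ∧
      endpointEnergy s R W T.1 + R ^ (1 - 2 * s) * W T.1 ^ 2 ≤ 64 * κ * lineEnergy s W ρ' +
        528 / κ ^ 3 * (R / (ρ' - ρ)) ^ 3 * (R ^ (-(2 * s)) * ∫ x in Ioo (-R) R, W x ^ 2) ∧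
      ∀ x ∈ Icc T.1 ρ, ∀ y ∈ Icc T.1 ρ, (W x - W y) ^ 2 ≤
        528 / κ ^ 3 * (R / (ρ' - ρ)) ^ 3 * ((∫ x in Ioo (-R) R, W x ^ 2) / R ^ 3) *
          |x - y| ^ 2 := by
  classical
  have hW := continuous_of_abs_sub_le hL
  set N := ∫ x in Ioo (-R) R, W x ^ 2 with hN
  have hN0 : 0 ≤ N := integral_nonneg fun _ => sq_nonneg _
  have hE0 := lineEnergy_nonneg s W ρ'
  set r := ρ' - ρ with hr
  have hr0 : 0 < r := sub_pos.2 hρρ'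
  have hRr : 0 < R / r := by positivity
  have hRp : 0 < R ^ (-(2 * s)) := Real.rpow_pos_of_pos hR _
  have hpow : (R / (κ * r)) ^ 3 = 1 / κ ^ 3 * (R / r) ^ 3 := by field_simp
  set S : Finset (ℝ × ℝ) := {T ∈ 𝒯 | (Icc T.1 T.2 ∩ Ioo (ρ + r / 4) (ρ + r / 2)).Nonempty} with hS
  have hcovS : Ioo (ρ + r / 4) (ρ + r / 2) ⊆ ⋃ T ∈ S, Icc T.1 T.2 := by
    intro z hz
    obtain ⟨T, hT, hzT⟩ := h𝒯.cover z ⟨by linarith [hz.1], by linarith [hz.2]⟩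
    exact mem_iUnion₂.2 ⟨T, Finset.mem_filter.2 ⟨hT, z, hzT, hz⟩, hzT⟩
  by_cases hbig : ∃ T ∈ S, κ * r ≤ T.2 - T.1
  · -- one long interval: the inverse estimate bounds everything by the `L²` norm, and `W` is affine
    -- from the node up to `ρ`
    obtain ⟨T, hTS, hTr⟩ := hbig
    obtain ⟨hT, z, hzT, hzJ⟩ := Finset.mem_filter.1 hTS
    have hlen := h𝒯.length_le T hT
    obtain ⟨h1, h2⟩ := (hWT T hT).endpointEnergy_le_of_le hs0 hs1 hR hL (h𝒯.lt T hT)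
      (by linarith [hzT.2, hzJ.1]) (by linarith [hzT.1, hzJ.2]) (by positivity) hTr
    rw [hpow] at h1 h2
    have hc : (54 : ℝ) * (1 / κ ^ 3 * (R / r) ^ 3) ≤ 528 / κ ^ 3 * (R / r) ^ 3 := by
      rw [← mul_assoc, mul_one_div]; gcongr; norm_num
    have hc' : (16 : ℝ) * (1 / κ ^ 3 * (R / r) ^ 3) ≤ 528 / κ ^ 3 * (R / r) ^ 3 := by
      rw [← mul_assoc, mul_one_div]; gcongr; norm_num
    refine ⟨T, hT, by linarith [hzT.2, hzJ.1], by linarith [hzT.1, hzJ.2], ?_, ?_⟩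
    · have h3 : 54 * (1 / κ ^ 3 * (R / r) ^ 3) * (R ^ (-(2 * s)) * N) ≤
          528 / κ ^ 3 * (R / r) ^ 3 * (R ^ (-(2 * s)) * N) := by gcongr
      have h4 : 0 ≤ 64 * κ * lineEnergy s W ρ' := by positivity
      linarith
    · intro x hx y hy
      have hρT : ρ ≤ T.2 := by linarith [hzT.2, hzJ.1]
      rw [hWT T hT x ⟨hx.1, hx.2.trans hρT⟩, hWT T hT y ⟨hy.1, hy.2.trans hρT⟩]
      have e : (W T.1 + (W T.2 - W T.1) / (T.2 - T.1) * (x - T.1) -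
          (W T.1 + (W T.2 - W T.1) / (T.2 - T.1) * (y - T.1))) ^ 2 =
          ((W T.2 - W T.1) / (T.2 - T.1)) ^ 2 * |x - y| ^ 2 := by rw [sq_abs]; ring
      rw [e]
      refine mul_le_mul_of_nonneg_right (h2.trans ?_) (sq_nonneg _)
      gcongr
  · -- all intervals meeting `(ρ + r / 4, ρ + r / 2)` are short and lie in `(ρ, ρ + 3 r / 4)`: average
    -- over the nodes, weighted with the lengths of the intervals
    push Not at hbig
    set X := 64 * κ * lineEnergy s W ρ' + 528 / κ ^ 3 * (R / r) ^ 3 * (R ^ (-(2 * s)) * N) with hX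
    have hX0 : 0 ≤ X := by positivity
    have hgeo : ∀ T ∈ S, T ∈ 𝒯 ∧ T.1 < T.2 ∧ ρ ≤ T.1 ∧ T.2 ≤ ρ + 3 / 4 * r ∧
        T.1 ≤ ρ + r / 2 := by
      intro T hTS
      obtain ⟨hT, z, hzT, hzJ⟩ := Finset.mem_filter.1 hTS
      have h1 := hbig T hTS
      have h2 : κ * r ≤ r / 4 := by nlinarith
      exact ⟨hT, h𝒯.lt T hT, by linarith [hzT.2, hzJ.1], by linarith [hzT.1, hzJ.2],
        by linarith [hzT.1, hzJ.2]⟩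
    have hne : S.Nonempty := by
      obtain ⟨T, hT, -⟩ := mem_iUnion₂.1 (hcovS (a := ρ + 3 / 8 * r) ⟨by linarith, by linarith⟩)
      exact ⟨T, hT⟩
    have hsel : ∃ T ∈ S, endpointEnergy s R W T.1 + R ^ (1 - 2 * s) * W T.1 ^ 2 ≤ X := by
      by_contra hcon
      push Not at hcon
      have hlen : r / 4 ≤ ∑ T ∈ S, (T.2 - T.1) := by
        have h1 : volume (Ioo (ρ + r / 4) (ρ + r / 2)) ≤ ∑ T ∈ S, volume (Icc T.1 T.2) :=
          (measure_mono hcovS).trans (measure_biUnion_finset_le _ _)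
        simp only [Real.volume_Ioo, Real.volume_Icc] at h1
        rw [← ENNReal.ofReal_sum_of_nonneg fun T hT => (sub_pos.2 (hgeo T hT).2.1).le,
          ENNReal.ofReal_le_ofReal_iff
            (Finset.sum_nonneg fun T hT => (sub_pos.2 (hgeo T hT).2.1).le)] at h1
        linarith
      have hlt : ∑ T ∈ S, (T.2 - T.1) * X < ∑ T ∈ S, (T.2 - T.1) *
          (endpointEnergy s R W T.1 + R ^ (1 - 2 * s) * W T.1 ^ 2) :=
        Finset.sum_lt_sum_of_nonempty hne fun T hT =>
          mul_lt_mul_of_pos_left (hcon T hT) (sub_pos.2 (hgeo T hT).2.1)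
      set f : ℝ × ℝ → ℝ := fun p => (W p.1 - W p.2) ^ 2 * |p.1 - p.2| ^ (-(2 * s)) with hf
      have hf0 : ∀ p, 0 ≤ f p := fun p =>
        mul_nonneg (sq_nonneg _) (Real.rpow_nonneg (abs_nonneg _) _)
      set J := Ioo ρ (ρ + 3 / 4 * r) with hJ
      have hJR : J ⊆ Ioo (-R) R := Ioo_subset_Ioo (by linarith) (by linarith)
      have hWi : IntegrableOn (fun x => W x ^ 2) (Ioo (-R) R) :=
        ((hW.pow 2).integrableOn_Icc).mono_set Ioo_subset_Icc_self
      have hTJ : ∀ T ∈ S, Ioo T.1 T.2 ⊆ J := fun T hT =>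
        Ioo_subset_Ioo (hgeo T hT).2.2.1 (hgeo T hT).2.2.2.1
      have hsum1 : ∑ T ∈ S, ∫ p in Ioo T.1 T.2 ×ˢ Ioo (-R) R, f p ≤
          ∫ p in J ×ˢ Ioo (-R) R, f p := by
        refine sum_setIntegral_le_of_disjoint S
          (fun T _ => measurableSet_Ioo.prod measurableSet_Ioo) (fun T hT T' hT' hne => ?_)
          (fun T hT => prod_mono (hTJ T hT) le_rfl)
          ((integrableOn_sq_sub_mul_rpow hs1 hL R).mono_set (prod_mono hJR le_rfl)) hf0
        exact (h𝒯.disjoint T (hgeo T hT).1 T' (hgeo T' hT').1 hne).set_prod_left _ _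
      have hsum2 : ∑ T ∈ S, ∫ x in Ioo T.1 T.2, W x ^ 2 ≤ N :=
        sum_setIntegral_le_of_disjoint S (fun T _ => measurableSet_Ioo)
          (fun T hT T' hT' hne => h𝒯.disjoint T (hgeo T hT).1 T' (hgeo T' hT').1 hne)
          (fun T hT => (hTJ T hT).trans hJR) hWi fun _ => sq_nonneg _
      have hterm : ∀ T ∈ S, (T.2 - T.1) *
          (endpointEnergy s R W T.1 + R ^ (1 - 2 * s) * W T.1 ^ 2) ≤
          16 * (∫ p in Ioo T.1 T.2 ×ˢ Ioo (-R) R, f p) +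
            4 * R ^ (1 - 2 * s) * ∫ x in Ioo T.1 T.2, W x ^ 2 := by
        intro T hT
        obtain ⟨hTT, hlt, h1, h2, -⟩ := hgeo T hT
        have h3 := (hWT T hTT).endpointEnergy_le hs0 hs1 hL hlt (R := R) (by linarith)
          (by linarith)
        have h4 := ((hWT T hTT).sq_sub_le hlt 0).1
        simp only [sub_zero] at h4
        have h5 := mul_le_mul_of_nonneg_left h4 (Real.rpow_nonneg hR.le (1 - 2 * s))
        calc _ = (T.2 - T.1) * endpointEnergy s R W T.1 +
              R ^ (1 - 2 * s) * ((T.2 - T.1) * W T.1 ^ 2) := by ring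
          _ ≤ _ := add_le_add h3 (h5.trans (le_of_eq (by ring)))
      -- at distances below `κ r` the weight `|x - y|^{-2s}` is `κ r` times smaller than the kernel of
      -- the energy, at larger distances it is bounded
      have hJE := integral_sq_sub_mul_rpow_le (R := R) (ρ' := ρ') (a := κ * r) hs0 hs1 hL
        (by positivity) (J := J) measurableSet_Ioo (by linarith) (fun x hx y hxy => by
          have h2 : κ * r ≤ r / 4 := by nlinarith
          have h3 := abs_lt.1 hxy
          exact ⟨⟨by linarith [hx.1], by linarith [hx.2]⟩,
            by linarith [hx.1], by linarith [hx.1, hx.2]⟩) hR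
      rw [← hN] at hJE
      have hκr : (κ * r) ^ (-(2 * s)) ≤ R ^ (-(2 * s)) * (R / (κ * r)) ^ 2 :=
        rpow_neg_le_mul_div_sq (by positivity) (by nlinarith) hs1
      have e1 : R ^ (1 - 2 * s) = R ^ (-(2 * s)) * R := by
        rw [← Real.rpow_add_one hR.ne']; congr 1; ring
      have htot : ∑ T ∈ S, (T.2 - T.1) *
          (endpointEnergy s R W T.1 + R ^ (1 - 2 * s) * W T.1 ^ 2) ≤ X * (r / 4) := by
        calc _ ≤ ∑ T ∈ S, (16 * (∫ p in Ioo T.1 T.2 ×ˢ Ioo (-R) R, f p) +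
              4 * R ^ (1 - 2 * s) * ∫ x in Ioo T.1 T.2, W x ^ 2) := Finset.sum_le_sum hterm
          _ = 16 * (∑ T ∈ S, ∫ p in Ioo T.1 T.2 ×ˢ Ioo (-R) R, f p) +
              4 * R ^ (1 - 2 * s) * ∑ T ∈ S, ∫ x in Ioo T.1 T.2, W x ^ 2 := by
              rw [Finset.sum_add_distrib, Finset.mul_sum, Finset.mul_sum]
          _ ≤ 16 * (κ * r * lineEnergy s W ρ' + 8 * R * (κ * r) ^ (-(2 * s)) * N) +
              4 * R ^ (1 - 2 * s) * N := by
              have h1 := hsum1.trans hJE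
              have h2 : 0 ≤ R ^ (1 - 2 * s) := Real.rpow_nonneg hR.le _
              gcongr
          _ ≤ 16 * (κ * r * lineEnergy s W ρ' +
              8 * R * (R ^ (-(2 * s)) * (R / (κ * r)) ^ 2) * N) +
              4 * (R ^ (-(2 * s)) * R) * N := by rw [e1]; gcongr
          _ = 16 * κ * r * lineEnergy s W ρ' +
              (128 / κ ^ 2 * (R / r) ^ 3 + 4 * (R / r)) * (R ^ (-(2 * s)) * N) * r := by
              field_simp; ring
          _ ≤ 16 * κ * r * lineEnergy s W ρ' +
              (128 / κ ^ 3 * (R / r) ^ 3 + 4 / κ ^ 3 * (R / r) ^ 3) *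
                (R ^ (-(2 * s)) * N) * r := by
              have h1 : 1 ≤ R / r := (one_le_div hr0).2 (by linarith)
              have h2 : R / r ≤ (R / r) ^ 3 := le_self_pow₀ h1 (by norm_num)
              have hκ1 : κ ≤ 1 := by linarith
              have h3 : κ ^ 3 ≤ κ ^ 2 := pow_le_pow_of_le_one hκ0.le hκ1 (by norm_num)
              have h4 : κ ^ 3 ≤ 1 := pow_le_one₀ hκ0.le hκ1
              have h5 : (4 : ℝ) ≤ 4 / κ ^ 3 := by
                rw [le_div_iff₀ (by positivity)]; linarith
              gcongr
          _ = X * (r / 4) := by rw [hX]; field_simp; ring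
      rw [← Finset.sum_mul] at hlt
      have := mul_le_mul_of_nonneg_right hlen hX0
      linarith
    obtain ⟨T, hTS, hTX⟩ := hsel
    obtain ⟨hT, -, h1, h2, h3⟩ := hgeo T hTS
    refine ⟨T, hT, by linarith, by linarith, hTX, fun x hx y hy => ?_⟩
    -- the node is at least `ρ`, so the interval `[T.1, ρ]` has at most one point
    have hx' : x = y := by linarith [hx.1, hx.2, hy.1, hy.2]
    rw [hx']
    simp

end Selection

/-! ### Cutting off at two nodes -/

section Truncation

open Set

variable {s R ρ ρ' L L' : ℝ} {W V : ℝ → ℝ} {b b' c : ℝ}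

theorem lintegral_Iic_rpow_eq (hs0 : 0 < s) {y : ℝ} (hby : b < y) :
    ∫⁻ x in Iic b, ENNReal.ofReal (1 / |x - y| ^ (1 + 2 * s)) =
      ENNReal.ofReal ((y - b) ^ (-(2 * s)) / (2 * s)) := by
  have hc : 0 < y - b := sub_pos.2 hby
  have ha : -(1 + 2 * s) < -1 := by linarith
  have h1 := (Measure.measurePreserving_sub_left volume y).setLIntegral_comp_preimage
    (measurableSet_Iic (a := b)) (f := fun x => ENNReal.ofReal (1 / |x - y| ^ (1 + 2 * s)))
    (by fun_prop)
  have h2 : (fun t => y - t) ⁻¹' Iic b = Ici (y - b) := by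
    ext t; simp only [mem_preimage, mem_Iic, mem_Ici]; constructor <;> intro h <;> linarith
  rw [← h1, h2, setLIntegral_congr Ioi_ae_eq_Ici.symm]
  have h3 : ∫⁻ t in Ioi (y - b), ENNReal.ofReal (1 / |y - t - y| ^ (1 + 2 * s)) =
      ∫⁻ t in Ioi (y - b), ENNReal.ofReal (t ^ (-(1 + 2 * s))) := by
    refine setLIntegral_congr_fun measurableSet_Ioi fun t ht => ?_
    have ht0 : 0 < t := hc.trans ht
    rw [show y - t - y = -t by ring, abs_neg, abs_of_pos ht0, Real.rpow_neg ht0.le, one_div]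
  rw [h3, ← ofReal_integral_eq_lintegral_ofReal (integrableOn_Ioi_rpow_of_lt ha hc)
    ((ae_restrict_mem measurableSet_Ioi).mono fun t ht => Real.rpow_nonneg (hc.trans ht).le _),
    integral_Ioi_rpow_of_lt ha hc]
  congr 1
  rw [show -(1 + 2 * s) + 1 = -(2 * s) by ring, neg_div_neg_eq]

/-- The interaction of the values of `W` to the right of `b` with the value at `b`, taken over all
points to the left of `b`. -/
noncomputable def crossTerm (s : ℝ) (W : ℝ → ℝ) (b : ℝ) : ℝ × ℝ → ℝ :=
  {p : ℝ × ℝ | p.1 ≤ b ∧ b < p.2}.indicator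
    fun p => (W p.2 - W b) ^ 2 / |p.1 - p.2| ^ (1 + 2 * s)

theorem crossTerm_nonneg (s : ℝ) (W : ℝ → ℝ) (b : ℝ) (p : ℝ × ℝ) : 0 ≤ crossTerm s W b p :=
  indicator_nonneg (fun _ _ => div_nonneg (sq_nonneg _) (Real.rpow_nonneg (abs_nonneg _) _)) _

theorem measurable_crossTerm (hW : Continuous W) (s b : ℝ) : Measurable (crossTerm s W b) := by
  have hW' := hW.measurable
  refine Measurable.indicator (by fun_prop) ?_
  exact (measurableSet_le measurable_fst measurable_const).inter
    (measurableSet_lt measurable_const measurable_snd)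

/-- Integrating out the points to the left of `b` turns the interaction across `b` into the endpoint
energy, with a kernel less singular by one power. -/
theorem integral_crossTerm_le (hs0 : 0 < s) (hs1 : s < 1)
    (hL : ∀ x y, |W x - W y| ≤ L * |x - y|) (hbR : -R ≤ b) :
    IntegrableOn (crossTerm s W b) (Ioo (-R) R ×ˢ Ioo (-R) R) ∧
    ∫ p in Ioo (-R) R ×ˢ Ioo (-R) R, crossTerm s W b p ≤ endpointEnergy s R W b / (2 * s) := by
  have hW := continuous_of_abs_sub_le hL
  have hm := measurable_crossTerm hW s b
  refine integrable_and_integral_le_of_lintegral_le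
    (div_nonneg (endpointEnergy_nonneg _ _ _ _) (by positivity)) hm.aestronglyMeasurable
    (Filter.Eventually.of_forall (crossTerm_nonneg s W b)) ?_
  rw [Measure.volume_eq_prod, ← Measure.prod_restrict,
    lintegral_prod_symm _ hm.ennreal_ofReal.aemeasurable]
  have hinner : ∀ y, ∫⁻ x in Ioo (-R) R, ENNReal.ofReal (crossTerm s W b (x, y)) ≤
      (Ioi b).indicator (fun y => ENNReal.ofReal
        ((W y - W b) ^ 2 * (y - b) ^ (-(2 * s)) / (2 * s))) y := by
    intro y
    rcases le_or_gt y b with hy | hy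
    · rw [indicator_of_notMem (by simpa using hy)]
      refine le_of_eq (lintegral_eq_zero_of_ae_eq_zero (Filter.Eventually.of_forall fun x => ?_))
      have : (x, y) ∉ {p : ℝ × ℝ | p.1 ≤ b ∧ b < p.2} := fun h => hy.not_gt h.2
      simp [crossTerm, indicator_of_notMem this]
    · rw [indicator_of_mem (by exact hy)]
      calc _ ≤ ∫⁻ x, ENNReal.ofReal (crossTerm s W b (x, y)) := setLIntegral_le_lintegral _ _
        _ = ∫⁻ x, (Iic b).indicator (fun x => ENNReal.ofReal ((W y - W b) ^ 2) *
              ENNReal.ofReal (1 / |x - y| ^ (1 + 2 * s))) x := by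
            refine lintegral_congr fun x => ?_
            by_cases hx : x ≤ b
            · have : (x, y) ∈ {p : ℝ × ℝ | p.1 ≤ b ∧ b < p.2} := ⟨hx, hy⟩
              rw [indicator_of_mem (by exact hx), crossTerm, indicator_of_mem this,
                ← ENNReal.ofReal_mul (sq_nonneg _), mul_one_div]
            · have : (x, y) ∉ {p : ℝ × ℝ | p.1 ≤ b ∧ b < p.2} := fun h => hx h.1
              rw [indicator_of_notMem (by exact hx), crossTerm, indicator_of_notMem this,
                ENNReal.ofReal_zero]
        _ = ENNReal.ofReal ((W y - W b) ^ 2) *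
              ENNReal.ofReal ((y - b) ^ (-(2 * s)) / (2 * s)) := by
            rw [lintegral_indicator measurableSet_Iic, lintegral_const_mul _ (by fun_prop),
              lintegral_Iic_rpow_eq hs0 hy]
        _ ≤ _ := by rw [← ENNReal.ofReal_mul (sq_nonneg _), mul_div_assoc]
  calc _ ≤ ∫⁻ y in Ioo (-R) R, (Ioi b).indicator (fun y => ENNReal.ofReal
        ((W y - W b) ^ 2 * (y - b) ^ (-(2 * s)) / (2 * s))) y := lintegral_mono hinner
    _ = ∫⁻ y in Ioo b R, ENNReal.ofReal
        ((W y - W b) ^ 2 * (y - b) ^ (-(2 * s)) / (2 * s)) := by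
        rw [setLIntegral_indicator measurableSet_Ioi]
        congr 2
        ext y
        simp only [mem_inter_iff, mem_Ioi, mem_Ioo]
        constructor
        · rintro ⟨h1, h2⟩; exact ⟨h1, h2.2⟩
        · rintro ⟨h1, h2⟩; exact ⟨h1, by linarith, h2⟩
    _ = _ := by
        rw [endpointEnergy, ← integral_div, ofReal_integral_eq_lintegral_ofReal]
        · exact (integrableOn_endpoint hs1 hL b R).div_const _
        · refine (ae_restrict_mem measurableSet_Ioo).mono fun y hy => ?_
          exact div_nonneg (mul_nonneg (sq_nonneg _)
            (Real.rpow_nonneg (sub_nonneg.2 hy.1.le) _)) (by positivity)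

theorem integral_comp_symm {f : ℝ × ℝ → ℝ} {g : ℝ × ℝ → ℝ × ℝ} {D : Set (ℝ × ℝ)}
    (hg : MeasurePreserving g) (hg' : MeasurableEmbedding g) (hD : g ⁻¹' D = D)
    (hf : IntegrableOn f D) :
    IntegrableOn (fun p => f (g p)) D ∧ ∫ p in D, f (g p) = ∫ p in D, f p := by
  constructor
  · have := (hg.integrableOn_comp_preimage hg' (f := f) (s := D)).2 hf
    rwa [hD] at this
  · have := hg.setIntegral_preimage_emb hg' f D
    rwa [hD] at this

/-- `W` minus its affine interpolant at the nodes `b'` and `b`, extended by zero. The extension is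
encoded by clamping the argument to `[b', b]`, since the difference vanishes at both ends. -/
noncomputable def cutAffine (W : ℝ → ℝ) (b' b : ℝ) (x : ℝ) : ℝ :=
  W (max b' (min b x)) - (W b' + (W b - W b') / (b - b') * (max b' (min b x) - b'))

theorem cutAffine_of_mem {x : ℝ} (hx : x ∈ Icc b' b) :
    cutAffine W b' b x = W x - (W b' + (W b - W b') / (b - b') * (x - b')) := by
  rw [cutAffine, min_eq_right hx.2, max_eq_right hx.1]

theorem cutAffine_of_le (hbb : b' ≤ b) {x : ℝ} (hx : x ≤ b') : cutAffine W b' b x = 0 := by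
  rw [cutAffine, min_eq_right (hx.trans hbb), max_eq_left hx]; ring

theorem cutAffine_of_ge (hbb : b' < b) {x : ℝ} (hx : b ≤ x) : cutAffine W b' b x = 0 := by
  have : b - b' ≠ 0 := (sub_pos.2 hbb).ne'
  rw [cutAffine, min_eq_left hx, max_eq_right hbb.le]; field_simp; ring

theorem abs_cutAffine_sub_le (hL : ∀ x y, |W x - W y| ≤ L * |x - y|) (x y : ℝ) :
    |cutAffine W b' b x - cutAffine W b' b y| ≤
      (L + |(W b - W b') / (b - b')|) * |x - y| := by
  have hL0 : 0 ≤ L := by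
    have := (abs_nonneg _).trans (hL 1 0)
    simpa using this
  have h : |max b' (min b x) - max b' (min b y)| ≤ |x - y| := by
    refine (abs_max_sub_max_le_max _ _ _ _).trans (max_le (by simp) ?_)
    exact (abs_min_sub_min_le_max _ _ _ _).trans (max_le (by simp) le_rfl)
  set x' := max b' (min b x)
  set y' := max b' (min b y)
  have e : cutAffine W b' b x - cutAffine W b' b y =
      (W x' - W y') - (W b - W b') / (b - b') * (x' - y') := by
    simp only [cutAffine, x', y']; ring
  rw [e]
  calc _ ≤ |W x' - W y'| + |(W b - W b') / (b - b') * (x' - y')| := abs_sub _ _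
    _ ≤ L * |x' - y'| + |(W b - W b') / (b - b')| * |x' - y'| := by
        rw [abs_mul]; exact add_le_add_left (hL _ _) _
    _ = (L + |(W b - W b') / (b - b')|) * |x' - y'| := by ring
    _ ≤ _ := mul_le_mul_of_nonneg_left h (by positivity)

theorem integrableOn_sub_mul_sub_div (hs1 : s < 1) (hL : ∀ x y, |W x - W y| ≤ L * |x - y|)
    (hL' : ∀ x y, |V x - V y| ≤ L' * |x - y|) (hR : 0 < R) :
    IntegrableOn (fun p : ℝ × ℝ => (W p.1 - W p.2) * (V p.1 - V p.2) / |p.1 - p.2| ^ (1 + 2 * s))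
      (Ioo (-R) R ×ˢ Ioo (-R) R) := by
  have hW := (continuous_of_abs_sub_le hL).measurable
  have hV := (continuous_of_abs_sub_le hL').measurable
  have hL0 : 0 ≤ L := by
    have := (abs_nonneg _).trans (hL 1 0)
    simpa using this
  obtain ⟨C, -, h⟩ := exists_integral_sq_div_le hs1
  refine ((h R hR).1.const_mul (L * L')).mono'
    (Measurable.aestronglyMeasurable (by fun_prop)) (Filter.Eventually.of_forall fun p => ?_)
  rw [norm_div, Real.norm_of_nonneg (Real.rpow_nonneg (abs_nonneg _) _), ← mul_div_assoc]
  refine div_le_div_of_nonneg_right ?_ (Real.rpow_nonneg (abs_nonneg _) _)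
  rw [Real.norm_eq_abs, abs_mul]
  calc _ ≤ (L * |p.1 - p.2|) * (L' * |p.1 - p.2|) :=
        mul_le_mul (hL _ _) (hL' _ _) (abs_nonneg _) (mul_nonneg hL0 (abs_nonneg _))
    _ = _ := by ring

/-- The energy of the cut-off function tested against itself, compared with the mixed energy. Outside
`[b', b]` the difference of `W` and the cut-off function is `W` itself, and contributes through the
values at the two ends only. -/
theorem sq_cutAffine_sub_le (hbb : b' < b) (x y : ℝ) :
    3 / 4 * ((cutAffine W b' b x - cutAffine W b' b y) ^ 2 / |x - y| ^ (1 + 2 * s)) ≤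
      (W x - W y) * (cutAffine W b' b x - cutAffine W b' b y) / |x - y| ^ (1 + 2 * s) +
      2 * ((W b - W b') / (b - b')) ^ 2 * (|x - y| ^ 2 / |x - y| ^ (1 + 2 * s)) +
      2 * (crossTerm s W b (x, y) + crossTerm s W b (y, x) +
        crossTerm s (fun t => W (-t)) (-b') (-x, -y) +
        crossTerm s (fun t => W (-t)) (-b') (-y, -x)) := by
  set m := (W b - W b') / (b - b') with hm
  have hmb : W b' + m * (b - b') = W b := by
    have : b - b' ≠ 0 := (sub_pos.2 hbb).ne'
    rw [hm]; field_simp; ring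
  set φ := cutAffine W b' b with hφ
  have h1 := crossTerm_nonneg s W b (x, y)
  have h2 := crossTerm_nonneg s W b (y, x)
  have h3 := crossTerm_nonneg s (fun t => W (-t)) (-b') (-x, -y)
  have h4 := crossTerm_nonneg s (fun t => W (-t)) (-b') (-y, -x)
  set k := |x - y| ^ (1 + 2 * s) with hk
  have hk0 : 0 ≤ k := Real.rpow_nonneg (abs_nonneg _) _
  have hquot : 0 ≤ |x - y| ^ 2 / k := div_nonneg (sq_nonneg _) hk0
  have hfin : ∀ {A B : ℝ}, ((W x - φ x) - (W y - φ y)) ^ 2 ≤ 2 * m ^ 2 * |x - y| ^ 2 + 2 * A →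
      A / k ≤ B → 3 / 4 * ((φ x - φ y) ^ 2 / k) ≤ (W x - W y) * (φ x - φ y) / k +
        2 * m ^ 2 * (|x - y| ^ 2 / k) + 2 * B := by
    intro A B hA hB
    have e : 3 / 4 * (φ x - φ y) ^ 2 ≤
        (W x - W y) * (φ x - φ y) + 2 * m ^ 2 * |x - y| ^ 2 + 2 * A := by
      nlinarith [sq_nonneg ((φ x - φ y) / 2 + ((W x - φ x) - (W y - φ y)))]
    have e' := div_le_div_of_nonneg_right e hk0
    rw [add_div, add_div, mul_div_assoc, mul_div_assoc _ (|x - y| ^ 2), mul_div_assoc 2 A] at e'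
    linarith
  have hin : ∀ {z}, z ∈ Icc b' b → W z - φ z = W b' + m * (z - b') := fun hz => by
    rw [hφ, cutAffine_of_mem hz]; ring
  have hr : ∀ {z}, b ≤ z → φ z = 0 := fun hz => cutAffine_of_ge hbb hz
  have hl : ∀ {z}, z ≤ b' → φ z = 0 := fun hz => cutAffine_of_le hbb.le hz
  have hcr : ∀ {z z'}, z ≤ b → b < z' → |z - z'| = |x - y| →
      (W z' - W b) ^ 2 / k = crossTerm s W b (z, z') := fun hz hz' he => by
    have hmem : ((_, _) : ℝ × ℝ) ∈ {p : ℝ × ℝ | p.1 ≤ b ∧ b < p.2} := ⟨hz, hz'⟩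
    rw [crossTerm, indicator_of_mem hmem, hk, he]
  have hcl : ∀ {z z'}, b' ≤ z → z' < b' → |z - z'| = |x - y| →
      (W z' - W b') ^ 2 / k = crossTerm s (fun t => W (-t)) (-b') (-z, -z') :=
    fun {z z'} hz hz' he => by
    have hmem : ((-z, -z') : ℝ × ℝ) ∈ {p : ℝ × ℝ | p.1 ≤ -b' ∧ -b' < p.2} :=
      ⟨neg_le_neg hz, neg_lt_neg hz'⟩
    rw [crossTerm, indicator_of_mem hmem, hk, ← he, neg_neg, neg_neg,
      show -z - -z' = -(z - z') by ring, abs_neg]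
  have hsq : ∀ a d : ℝ, (a + d) ^ 2 ≤ 2 * a ^ 2 + 2 * d ^ 2 := fun a d => by
    nlinarith [sq_nonneg (a - d)]
  have hm2 : ∀ {a : ℝ}, |a| ≤ |x - y| → (m * a) ^ 2 ≤ m ^ 2 * |x - y| ^ 2 := fun {a} ha => by
    rw [mul_pow, ← sq_abs a]
    exact mul_le_mul_of_nonneg_left (pow_le_pow_left₀ (abs_nonneg _) ha 2) (sq_nonneg _)
  by_cases hx : x ∈ Icc b' b
  · by_cases hy : y ∈ Icc b' b
    · refine hfin (A := 0) ?_ (by rw [zero_div]; linarith)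
      rw [hin hx, hin hy, show W b' + m * (x - b') - (W b' + m * (y - b')) = m * (x - y) by ring]
      have := hm2 (a := x - y) le_rfl
      nlinarith [sq_nonneg (m * |x - y|)]
    · rcases lt_or_ge b y with hby | hyb
      · refine hfin (A := (W y - W b) ^ 2) ?_ (by rw [hcr hx.2 hby rfl]; linarith)
        rw [hin hx, hr hby.le, show W b' + m * (x - b') - (W y - 0) =
          m * (x - b) + (W b - W y) by rw [← hmb]; ring]
        have := hm2 (a := x - b) (by
          rw [abs_sub_comm, abs_sub_comm x, abs_of_nonneg (by linarith [hx.2]),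
            abs_of_nonneg (by linarith [hx.2])]; linarith)
        refine (hsq _ _).trans ?_
        rw [← neg_sq (W b - W y), neg_sub]
        linarith
      · have hyb' : y < b' := by
          by_contra hcon
          exact hy ⟨not_lt.1 hcon, hyb⟩
        refine hfin (A := (W y - W b') ^ 2) ?_ (by rw [hcl hx.1 hyb' rfl]; linarith)
        rw [hin hx, hl hyb'.le, show W b' + m * (x - b') - (W y - 0) =
          m * (x - b') + (W b' - W y) by ring]
        have := hm2 (a := x - b') (by
          rw [abs_of_nonneg (by linarith [hx.1]), abs_of_nonneg (by linarith [hx.1])]; linarith)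
        refine (hsq _ _).trans ?_
        rw [← neg_sq (W b' - W y), neg_sub]
        linarith
  · by_cases hy : y ∈ Icc b' b
    · rcases lt_or_ge b x with hbx | hxb
      · refine hfin (A := (W x - W b) ^ 2) ?_ (by rw [hcr hy.2 hbx (abs_sub_comm _ _)]; linarith)
        rw [hin hy, hr hbx.le, show W x - 0 - (W b' + m * (y - b')) =
          m * (b - y) + (W x - W b) by rw [← hmb]; ring]
        have := hm2 (a := b - y) (by
          rw [abs_of_nonneg (by linarith [hy.2]), abs_of_nonneg (by linarith [hy.2])]; linarith)
        refine (hsq _ _).trans ?_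
        linarith
      · have hxb' : x < b' := by
          by_contra hcon
          exact hx ⟨not_lt.1 hcon, hxb⟩
        refine hfin (A := (W x - W b') ^ 2) ?_ (by rw [hcl hy.1 hxb' (abs_sub_comm _ _)]; linarith)
        rw [hin hy, hl hxb'.le, show W x - 0 - (W b' + m * (y - b')) =
          m * (b' - y) + (W x - W b') by ring]
        have := hm2 (a := b' - y) (by
          rw [abs_sub_comm, abs_sub_comm x, abs_of_nonneg (by linarith [hy.1]),
            abs_of_nonneg (by linarith [hy.1])]; linarith)
        refine (hsq _ _).trans ?_
        linarith
    · have h0 : ∀ {z}, z ∉ Icc b' b → φ z = 0 := fun {z} hz => by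
        rcases le_or_gt z b' with h | h
        · exact hl h
        · exact hr (le_of_not_ge fun h' => hz ⟨h.le, h'⟩)
      rw [h0 hx, h0 hy]
      have : 0 ≤ 2 * m ^ 2 * (|x - y| ^ 2 / k) := by positivity
      simp only [sub_self, mul_zero, zero_div, ne_eq, OfNat.ofNat_ne_zero, not_false_eq_true,
        zero_pow, zero_add]
      linarith

end Truncation

/-! ### The discrete Caccioppoli inequality on the line -/

section LineCaccioppoli

open Set

variable {s R ρ ρ' L : ℝ} {W : ℝ → ℝ} {b b' : ℝ}

/-- The contribution of a right end `b` to the energy of the cut-off function. -/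
noncomputable def nodeEnergy (s R : ℝ) (W : ℝ → ℝ) (b : ℝ) : ℝ :=
  endpointEnergy s R W b + R ^ (1 - 2 * s) * W b ^ 2

theorem nodeEnergy_nonneg (s : ℝ) (hR : 0 < R) (W : ℝ → ℝ) (b : ℝ) : 0 ≤ nodeEnergy s R W b :=
  add_nonneg (endpointEnergy_nonneg _ _ _ _)
    (mul_nonneg (Real.rpow_nonneg hR.le _) (sq_nonneg _))

theorem abs_sub_le_comp_neg (hL : ∀ x y, |W x - W y| ≤ L * |x - y|) (x y : ℝ) :
    |W (-x) - W (-y)| ≤ L * |x - y| := by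
  have := hL (-x) (-y)
  rwa [show -x - -y = -(x - y) by ring, abs_neg] at this

theorem sq_slope_le (hR : 0 < R) (hb' : b' ≤ -(7 / 16 * R)) (hb : 7 / 16 * R ≤ b) :
    ((W b - W b') / (b - b')) ^ 2 ≤ 3 * (W b ^ 2 + W b' ^ 2) / R ^ 2 := by
  have h1 : 7 / 8 * R ≤ b - b' := by linarith
  have h2 : (7 / 8 * R) ^ 2 ≤ (b - b') ^ 2 := pow_le_pow_left₀ (by positivity) h1 2
  rw [div_pow, div_le_div_iff₀ (by nlinarith [sq_pos_of_pos hR]) (by positivity)]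
  have h3 : (W b - W b') ^ 2 ≤ 2 * (W b ^ 2 + W b' ^ 2) := by nlinarith [sq_nonneg (W b + W b')]
  have h4 : 0 ≤ W b ^ 2 + W b' ^ 2 := by positivity
  have h5 : 2 * R ^ 2 ≤ 3 * (b - b') ^ 2 := by nlinarith [sq_nonneg R]
  calc (W b - W b') ^ 2 * R ^ 2 ≤ 2 * (W b ^ 2 + W b' ^ 2) * R ^ 2 := by gcongr
    _ = (W b ^ 2 + W b' ^ 2) * (2 * R ^ 2) := by ring
    _ ≤ (W b ^ 2 + W b' ^ 2) * (3 * (b - b') ^ 2) := mul_le_mul_of_nonneg_left h5 h4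
    _ = _ := by ring

theorem sq_cutAffine_le (hbb : b' < b) (x : ℝ) :
    cutAffine W b' b x ^ 2 ≤ 2 * W x ^ 2 + 2 * (W b ^ 2 + W b' ^ 2) := by
  rcases lt_or_ge x b' with hx | hx
  · rw [cutAffine_of_le hbb.le hx.le, sq, zero_mul]; positivity
  rcases lt_or_ge b x with hx' | hx'
  · rw [cutAffine_of_ge hbb hx'.le, sq, zero_mul]; positivity
  have hd : 0 < b - b' := sub_pos.2 hbb
  rw [cutAffine_of_mem ⟨hx, hx'⟩]
  set θ := (x - b') / (b - b') with hθ
  have hθ0 : 0 ≤ θ := div_nonneg (by linarith) hd.le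
  have hθ1 : θ ≤ 1 := (div_le_one hd).2 (by linarith)
  have e : W b' + (W b - W b') / (b - b') * (x - b') = (1 - θ) * W b' + θ * W b := by
    rw [hθ]; field_simp; ring
  rw [e]
  have h1 : ((1 - θ) * W b' + θ * W b) ^ 2 ≤ (1 - θ) * W b' ^ 2 + θ * W b ^ 2 := by
    nlinarith [mul_nonneg (mul_nonneg hθ0 (sub_nonneg.2 hθ1)) (sq_nonneg (W b - W b'))]
  have h2 : (1 - θ) * W b' ^ 2 + θ * W b ^ 2 ≤ W b ^ 2 + W b' ^ 2 := by
    nlinarith [sq_nonneg (W b), sq_nonneg (W b')]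
  nlinarith [sq_nonneg (W x + ((1 - θ) * W b' + θ * W b))]

/-- The energy of the cut-off function, from the variational inequality tested with it. -/
theorem exists_lineEnergy_cutAffine_le (hs0 : 0 < s) (hs1 : s < 1) {C₀ : ℝ} (hC₀ : 0 ≤ C₀) :
    ∃ C : ℝ, 0 < C ∧ ∀ (R : ℝ), 0 < R → ∀ (W : ℝ → ℝ) (L : ℝ),
      (∀ x y, |W x - W y| ≤ L * |x - y|) → ∀ b' b : ℝ, -(3 / 4 * R) ≤ b' → b' ≤ -(7 / 16 * R) →
      7 / 16 * R ≤ b → b ≤ 3 / 4 * R → ∀ M : ℝ, 0 ≤ M →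
      (∫ p in Ioo (-R) R ×ˢ Ioo (-R) R, (W p.1 - W p.2) *
          (cutAffine W b' b p.1 - cutAffine W b' b p.2) / |p.1 - p.2| ^ (1 + 2 * s) ≤
        1 / 8 * lineEnergy s (cutAffine W b' b) R + M +
          C₀ * (R ^ (-(2 * s)) * ∫ x in Ioo (-R) R, cutAffine W b' b x ^ 2)) →
      lineEnergy s (cutAffine W b' b) R ≤
        C * (M + R ^ (-(2 * s)) * (∫ x in Ioo (-R) R, W x ^ 2) +
          (nodeEnergy s R W b + nodeEnergy s R (fun t => W (-t)) (-b'))) := by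
  obtain ⟨C₂, hC₂, hC₂E⟩ := exists_integral_sq_div_le hs1
  refine ⟨8 / 5 * (1 + 4 * C₀ + 6 * C₂ + 2 / s), by positivity, ?_⟩
  intro R hR W L hL b' b hb'1 hb'2 hb1 hb2 M hM hLG
  have hbb : b' < b := by linarith
  obtain ⟨i2, hE2⟩ := hC₂E R hR
  have hW := continuous_of_abs_sub_le hL
  have hLφ := fun x y => abs_cutAffine_sub_le (b := b) (b' := b') hL x y
  have hφ := continuous_of_abs_sub_le hLφ
  set φ := cutAffine W b' b with hφd
  set m := (W b - W b') / (b - b') with hm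
  set V : ℝ → ℝ := fun t => W (-t) with hV
  set I := Ioo (-R) R with hI
  set N := ∫ x in I, W x ^ 2 with hN
  have hN0 : 0 ≤ N := integral_nonneg fun _ => sq_nonneg _
  obtain ⟨ir, hr⟩ := integral_crossTerm_le (R := R) (b := b) hs0 hs1 hL (by linarith)
  obtain ⟨il, hl⟩ := integral_crossTerm_le (R := R) (b := -b') (W := V) hs0 hs1
    (abs_sub_le_comp_neg hL) (by linarith)
  have hneg : MeasurePreserving (fun p : ℝ × ℝ => -p) := Measure.measurePreserving_neg volume
  have hnegE : MeasurableEmbedding (fun p : ℝ × ℝ => -p) := (MeasurableEquiv.neg _).measurableEmbedding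
  have hswap : MeasurePreserving (fun p : ℝ × ℝ => p.swap) := by
    rw [Measure.volume_eq_prod]; exact Measure.measurePreserving_swap
  have hswapE : MeasurableEmbedding (fun p : ℝ × ℝ => p.swap) :=
    MeasurableEquiv.prodComm.measurableEmbedding
  have hnegI : (fun p : ℝ × ℝ => -p) ⁻¹' (I ×ˢ I) = I ×ˢ I := by
    ext p
    simp only [mem_preimage, mem_prod, hI, mem_Ioo, Prod.fst_neg, Prod.snd_neg]
    constructor <;> rintro ⟨⟨h1, h2⟩, h3, h4⟩ <;>
      exact ⟨⟨by linarith, by linarith⟩, by linarith, by linarith⟩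
  have hswapI : (fun p : ℝ × ℝ => p.swap) ⁻¹' (I ×ˢ I) = I ×ˢ I := by
    ext p; simp
  obtain ⟨ir', er'⟩ := integral_comp_symm hswap hswapE hswapI ir
  obtain ⟨il1, el1⟩ := integral_comp_symm hneg hnegE hnegI il
  obtain ⟨il2, el2⟩ := integral_comp_symm hswap hswapE hswapI il1
  have iWφ := integrableOn_sub_mul_sub_div hs1 hL hLφ hR
  have iφφ := integrableOn_lineEnergy hs1 hLφ R
  have hpt : ∀ p : ℝ × ℝ, 3 / 4 * ((φ p.1 - φ p.2) ^ 2 / |p.1 - p.2| ^ (1 + 2 * s)) ≤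
      ((W p.1 - W p.2) * (φ p.1 - φ p.2) / |p.1 - p.2| ^ (1 + 2 * s) +
      2 * m ^ 2 * (|p.1 - p.2| ^ 2 / |p.1 - p.2| ^ (1 + 2 * s))) +
      2 * (((crossTerm s W b p + crossTerm s W b p.swap) +
        crossTerm s V (-b') (-p)) + crossTerm s V (-b') (-p.swap)) := fun p =>
    sq_cutAffine_sub_le hbb p.1 p.2
  have i3 : IntegrableOn (fun p : ℝ × ℝ =>
      (W p.1 - W p.2) * (φ p.1 - φ p.2) / |p.1 - p.2| ^ (1 + 2 * s) +
      2 * m ^ 2 * (|p.1 - p.2| ^ 2 / |p.1 - p.2| ^ (1 + 2 * s))) (I ×ˢ I) :=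
    iWφ.add (i2.const_mul _)
  have i4 : IntegrableOn (fun p : ℝ × ℝ => crossTerm s W b p + crossTerm s W b p.swap) (I ×ˢ I) :=
    ir.add ir'
  have i5 : IntegrableOn (fun p : ℝ × ℝ => (crossTerm s W b p + crossTerm s W b p.swap) +
      crossTerm s V (-b') (-p)) (I ×ˢ I) := i4.add il1
  have i6 : IntegrableOn (fun p : ℝ × ℝ => ((crossTerm s W b p + crossTerm s W b p.swap) +
      crossTerm s V (-b') (-p)) + crossTerm s V (-b') (-p.swap)) (I ×ˢ I) := i5.add il2
  have hint := integral_mono (iφφ.const_mul (3 / 4)) (i3.add (i6.const_mul 2)) hpt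
  simp only [Pi.add_apply] at hint
  rw [integral_add i3 (i6.const_mul 2), integral_const_mul, integral_const_mul,
    integral_add iWφ (i2.const_mul _), integral_const_mul, integral_add i5 il2, integral_add i4 il1,
    integral_add ir ir', er', el2, el1] at hint
  change 3 / 4 * lineEnergy s φ R ≤ _ at hint
  set F := lineEnergy s φ R with hF
  have hWi : IntegrableOn (fun x => W x ^ 2) I :=
    ((hW.pow 2).integrableOn_Icc).mono_set Ioo_subset_Icc_self
  have hφi : IntegrableOn (fun x => φ x ^ 2) I :=
    ((hφ.pow 2).integrableOn_Icc).mono_set Ioo_subset_Icc_self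
  set P := W b ^ 2 + W b' ^ 2 with hP
  have hP0 : 0 ≤ P := by positivity
  have hci : IntegrableOn (fun _ : ℝ => 2 * P) I := integrableOn_const (by simp [hI])
  have hφ2 : ∫ x in I, φ x ^ 2 ≤ 2 * N + 4 * R * P := by
    calc _ ≤ ∫ x in I, (2 * W x ^ 2 + 2 * P) :=
          integral_mono hφi ((hWi.const_mul 2).add hci) fun x => sq_cutAffine_le hbb x
      _ = _ := by
          rw [integral_add (hWi.const_mul 2) hci, integral_const_mul, setIntegral_const, hI,
            Measure.real, Real.volume_Ioo, ENNReal.toReal_ofReal (by linarith), smul_eq_mul]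
          ring
  have hRp : 0 < R ^ (-(2 * s)) := Real.rpow_pos_of_pos hR _
  have e1 : R ^ (1 - 2 * s) = R ^ (-(2 * s)) * R := by
    rw [← Real.rpow_add_one hR.ne']; congr 1; ring
  have e3 : R ^ (3 - 2 * s) = R ^ (1 - 2 * s) * R ^ 2 := by
    rw [← Real.rpow_natCast R 2, ← Real.rpow_add hR]; congr 1; push_cast; ring
  have hR1 : 0 < R ^ (1 - 2 * s) := Real.rpow_pos_of_pos hR _
  have hm2 : m ^ 2 * R ^ (3 - 2 * s) ≤ 3 * (R ^ (1 - 2 * s) * P) := by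
    calc _ ≤ 3 * P / R ^ 2 * R ^ (3 - 2 * s) :=
          mul_le_mul_of_nonneg_right (sq_slope_le hR hb'2 hb1) (Real.rpow_nonneg hR.le _)
      _ = _ := by rw [e3]; field_simp
  have hnode : nodeEnergy s R W b + nodeEnergy s R V (-b') =
      (endpointEnergy s R W b + endpointEnergy s R V (-b')) + R ^ (1 - 2 * s) * P := by
    simp only [nodeEnergy, hV, hP, neg_neg]; ring
  rw [hnode]
  set Q := R ^ (1 - 2 * s) * P with hQ
  have hQ0 : 0 ≤ Q := by positivity
  set D := endpointEnergy s R W b + endpointEnergy s R V (-b') with hD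
  have hD0 : 0 ≤ D := add_nonneg (endpointEnergy_nonneg _ _ _ _) (endpointEnergy_nonneg _ _ _ _)
  have hterm1 : 2 * m ^ 2 * (∫ p in I ×ˢ I, |p.1 - p.2| ^ 2 / |p.1 - p.2| ^ (1 + 2 * s)) ≤
      6 * C₂ * Q := by
    calc _ ≤ 2 * m ^ 2 * (C₂ * R ^ (3 - 2 * s)) := mul_le_mul_of_nonneg_left hE2 (by positivity)
      _ = 2 * C₂ * (m ^ 2 * R ^ (3 - 2 * s)) := by ring
      _ ≤ 2 * C₂ * (3 * Q) := by gcongr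
      _ = _ := by ring
  have hterm2 : C₀ * (R ^ (-(2 * s)) * ∫ x in I, φ x ^ 2) ≤
      C₀ * (2 * (R ^ (-(2 * s)) * N) + 4 * Q) := by
    refine mul_le_mul_of_nonneg_left ?_ hC₀
    calc _ ≤ R ^ (-(2 * s)) * (2 * N + 4 * R * P) := mul_le_mul_of_nonneg_left hφ2 hRp.le
      _ = _ := by rw [hQ, e1]; ring
  have hterm3 : 2 * (endpointEnergy s R W b / (2 * s) + endpointEnergy s R W b / (2 * s) +
      endpointEnergy s R V (-b') / (2 * s) + endpointEnergy s R V (-b') / (2 * s)) =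
      2 / s * D := by rw [hD]; field_simp; ring
  set N' := R ^ (-(2 * s)) * N with hN'
  have hN'0 : 0 ≤ N' := by positivity
  have hfin : 5 / 8 * F ≤ M + C₀ * (2 * N' + 4 * Q) + 6 * C₂ * Q + 2 / s * D := by linarith
  have hs2 : 0 < 2 / s := by positivity
  have hle : M + C₀ * (2 * N' + 4 * Q) + 6 * C₂ * Q + 2 / s * D ≤
      (1 + 4 * C₀ + 6 * C₂ + 2 / s) * (M + N' + (D + Q)) := by
    have a1 : 0 ≤ C₀ * M := by positivity
    have a2 : 0 ≤ C₀ * N' := by positivity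
    have a3 : 0 ≤ C₀ * D := by positivity
    have a4 : 0 ≤ C₂ * M := by positivity
    have a5 : 0 ≤ C₂ * N' := by positivity
    have a6 : 0 ≤ C₂ * D := by positivity
    have a7 : 0 ≤ 2 / s * M := by positivity
    have a8 : 0 ≤ 2 / s * N' := by positivity
    have a9 : 0 ≤ 2 / s * Q := by positivity
    linarith
  linarith

/-- Lipschitz bounds on two adjacent intervals combine without loss. -/
theorem abs_sub_le_glue {f : ℝ → ℝ} {a c : ℝ}
    (h1 : ∀ x ∈ Icc a b, ∀ y ∈ Icc a b, |f x - f y| ≤ L * |x - y|)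
    (h2 : ∀ x ∈ Icc b c, ∀ y ∈ Icc b c, |f x - f y| ≤ L * |x - y|) :
    ∀ x ∈ Icc a c, ∀ y ∈ Icc a c, |f x - f y| ≤ L * |x - y| := by
  have key : ∀ x ∈ Icc a c, ∀ y ∈ Icc a c, x ≤ y → |f x - f y| ≤ L * |x - y| := by
    intro x hx y hy hxy
    rcases le_total y b with hyb | hby
    · exact h1 x ⟨hx.1, hxy.trans hyb⟩ y ⟨hy.1, hyb⟩
    rcases le_total b x with hbx | hxb
    · exact h2 x ⟨hbx, hx.2⟩ y ⟨hby, hy.2⟩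
    have e1 := h1 x ⟨hx.1, hxb⟩ b ⟨hx.1.trans hxb, le_rfl⟩
    have e2 := h2 b ⟨le_rfl, hby.trans hy.2⟩ y ⟨hby, hy.2⟩
    have e3 := abs_sub_le (f x) (f b) (f y)
    rw [abs_sub_comm x b, abs_of_nonneg (sub_nonneg.2 hxb)] at e1
    rw [abs_sub_comm b y, abs_of_nonneg (sub_nonneg.2 hby)] at e2
    rw [abs_sub_comm x y, abs_of_nonneg (sub_nonneg.2 hxy)]
    nlinarith
  intro x hx y hy
  rcases le_total x y with h | h
  · exact key x hx y hy h
  · rw [abs_sub_comm, abs_sub_comm x]; exact key y hy x hx h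

theorem IsIntervalMesh.neg {𝒯 : Finset (ℝ × ℝ)} (h : IsIntervalMesh 𝒯 R) :
    IsIntervalMesh (𝒯.image fun T => (-T.2, -T.1)) R := by
  constructor
  · intro T hT
    obtain ⟨T, hT₀, rfl⟩ := Finset.mem_image.1 hT
    exact neg_lt_neg (h.lt T hT₀)
  · intro T hT
    obtain ⟨T, hT₀, rfl⟩ := Finset.mem_image.1 hT
    have := h.length_le T hT₀
    simp only
    linarith
  · intro T hT T' hT' hne
    obtain ⟨T, hT₀, rfl⟩ := Finset.mem_image.1 hT
    obtain ⟨T', hT'₀, rfl⟩ := Finset.mem_image.1 hT'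
    have := h.disjoint T hT₀ T' hT'₀ fun e => hne (by rw [e])
    rw [Set.disjoint_left] at this ⊢
    rintro x ⟨h1, h2⟩ ⟨h3, h4⟩
    simp only at h1 h2 h3 h4
    exact this (a := -x) ⟨by linarith, by linarith⟩ ⟨by linarith, by linarith⟩
  · intro x hx
    obtain ⟨T, hT, hxT⟩ := h.cover (-x) ⟨by linarith [hx.2], by linarith [hx.1]⟩
    refine ⟨_, Finset.mem_image_of_mem _ hT, ?_⟩
    simp only
    exact ⟨by linarith [hxT.2], by linarith [hxT.1]⟩

theorem IsAffineOnIcc.comp_neg {c : ℝ} (hbc : b < c) (h : IsAffineOnIcc W b c) :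
    IsAffineOnIcc (fun t => W (-t)) (-c) (-b) := by
  intro x hx
  have h1 := h (-x) ⟨by linarith [hx.2], by linarith [hx.1]⟩
  have hne : c - b ≠ 0 := (sub_pos.2 hbc).ne'
  simp only [neg_neg]
  rw [h1, show -b - -c = c - b by ring]
  field_simp
  ring

theorem lineEnergy_comp_neg (s : ℝ) (W : ℝ → ℝ) (ρ : ℝ) :
    lineEnergy s (fun t => W (-t)) ρ = lineEnergy s W ρ := by
  have hneg : MeasurePreserving (fun p : ℝ × ℝ => -p) := Measure.measurePreserving_neg volume
  have hnegE : MeasurableEmbedding (fun p : ℝ × ℝ => -p) := (MeasurableEquiv.neg _).measurableEmbedding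
  have hnegI : (fun p : ℝ × ℝ => -p) ⁻¹' (Ioo (-ρ) ρ ×ˢ Ioo (-ρ) ρ) = Ioo (-ρ) ρ ×ˢ Ioo (-ρ) ρ := by
    ext p
    simp only [mem_preimage, mem_prod, mem_Ioo, Prod.fst_neg, Prod.snd_neg]
    constructor <;> rintro ⟨⟨h1, h2⟩, h3, h4⟩ <;>
      exact ⟨⟨by linarith, by linarith⟩, by linarith, by linarith⟩
  have h := hneg.setIntegral_preimage_emb hnegE
    (fun p => (W p.1 - W p.2) ^ 2 / |p.1 - p.2| ^ (1 + 2 * s)) (Ioo (-ρ) ρ ×ˢ Ioo (-ρ) ρ)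
  rw [hnegI] at h
  rw [lineEnergy, lineEnergy, ← h]
  congr 1
  ext p
  simp only [Prod.fst_neg, Prod.snd_neg]
  rw [show -p.1 - -p.2 = -(p.1 - p.2) by ring, abs_neg]

theorem setIntegral_Ioo_comp_neg (f : ℝ → ℝ) (R : ℝ) :
    ∫ x in Ioo (-R) R, f (-x) = ∫ x in Ioo (-R) R, f x := by
  have h := (Measure.measurePreserving_neg (volume : Measure ℝ)).setIntegral_preimage_emb
    (MeasurableEquiv.neg ℝ).measurableEmbedding f (Ioo (-R) R)
  rw [← h]
  congr 2
  ext x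
  simp only [mem_preimage, mem_Ioo]
  constructor <;> rintro ⟨h1, h2⟩ <;> exact ⟨by linarith, by linarith⟩

set_option maxHeartbeats 1000000 in
/-- The energy on `(-ρ, ρ)`, up to a small multiple of the energy on `(-ρ', ρ')`: cut off at two good
nodes, and bound the difference of `W` and the cut-off function on `(-ρ, ρ)` by its slope, which is that
of the interpolant between the nodes and that of `W` beyond them. -/
theorem exists_lineEnergy_le_add (hs0 : 0 < s) (hs1 : s < 1) {C₀ : ℝ} (hC₀ : 0 ≤ C₀) :
    ∃ C : ℝ, 0 < C ∧ ∀ (R : ℝ), 0 < R → ∀ (W : ℝ → ℝ) (L : ℝ),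
      (∀ x y, |W x - W y| ≤ L * |x - y|) → ∀ 𝒯 : Finset (ℝ × ℝ), IsIntervalMesh 𝒯 R →
      (∀ T ∈ 𝒯, IsAffineOnIcc W T.1 T.2) → ∀ M : ℝ, 0 ≤ M →
      (∀ T' ∈ 𝒯, ∀ T ∈ 𝒯, -(3 / 4 * R) ≤ T'.2 → T'.2 ≤ -(7 / 16 * R) →
        7 / 16 * R ≤ T.1 → T.1 ≤ 3 / 4 * R →
        ∫ p in Ioo (-R) R ×ˢ Ioo (-R) R, (W p.1 - W p.2) *
          (cutAffine W T'.2 T.1 p.1 - cutAffine W T'.2 T.1 p.2) / |p.1 - p.2| ^ (1 + 2 * s) ≤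
        1 / 8 * lineEnergy s (cutAffine W T'.2 T.1) R + M +
          C₀ * (R ^ (-(2 * s)) * ∫ x in Ioo (-R) R, cutAffine W T'.2 T.1 x ^ 2)) →
      ∀ κ : ℝ, 0 < κ → κ ≤ 1 / 4 → ∀ ρ ρ' : ℝ, R / 2 ≤ ρ → ρ < ρ' → ρ' ≤ 3 / 4 * R →
      lineEnergy s W ρ ≤ C * (κ * lineEnergy s W ρ' + M +
        1 / κ ^ 3 * (R / (ρ' - ρ)) ^ 3 * (R ^ (-(2 * s)) * ∫ x in Ioo (-R) R, W x ^ 2)) := by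
  obtain ⟨C₂, hC₂, hC₂E⟩ := exists_integral_sq_div_le hs1
  obtain ⟨C₁, hC₁, hcut⟩ := exists_lineEnergy_cutAffine_le hs0 hs1 hC₀
  refine ⟨(2 * C₁ + 12 * C₂) * 1057 + 4 * C₂ * 528, by positivity, ?_⟩
  intro R hR W L hL 𝒯 h𝒯 hWT M hM hLG κ hκ0 hκ ρ ρ' hρ hρρ' hρ'
  obtain ⟨T, hT, hb1, hb2, hbE, hbL⟩ := exists_node_endpointEnergy_le hs0 hs1 hκ0 hκ hR h𝒯 hWT hL
    hρ hρρ' hρ'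
  obtain ⟨T'', hT'', hb1', hb2', hbE', hbL'⟩ := exists_node_endpointEnergy_le hs0 hs1 hκ0 hκ hR
    h𝒯.neg (W := fun t => W (-t)) (fun T hT => by
      obtain ⟨T, hT₀, rfl⟩ := Finset.mem_image.1 hT
      exact (hWT T hT₀).comp_neg (h𝒯.lt T hT₀)) (abs_sub_le_comp_neg hL) hρ hρρ' hρ'
  obtain ⟨T', hT', rfl⟩ := Finset.mem_image.1 hT''
  simp only at hb1' hb2' hbE' hbL'
  have hNneg := setIntegral_Ioo_comp_neg (fun x => W x ^ 2) R
  rw [lineEnergy_comp_neg, hNneg] at hbE'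
  rw [hNneg] at hbL'
  set b := T.1 with hb
  set b' := T'.2 with hb'
  set N := ∫ x in Ioo (-R) R, W x ^ 2 with hN
  have hN0 : 0 ≤ N := integral_nonneg fun _ => sq_nonneg _
  have hbb : b' < b := by linarith
  have hF := hcut R hR W L hL b' b (by linarith) (by linarith) hb1 hb2 M hM
    (hLG T' hT' T hT (by linarith) (by linarith) hb1 hb2)
  have hLφ := fun x y => abs_cutAffine_sub_le (b := b) (b' := b') hL x y
  set φ := cutAffine W b' b with hφ
  set F := lineEnergy s φ R with hFd
  set m := (W b - W b') / (b - b') with hm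
  set E' := lineEnergy s W ρ' with hE'
  have hE'0 : 0 ≤ E' := lineEnergy_nonneg _ _ _
  set r := ρ' - ρ with hr
  have hr0 : 0 < r := sub_pos.2 hρρ'
  set A := 528 / κ ^ 3 * (R / r) ^ 3 * (N / R ^ 3) with hA
  have hA0 : 0 ≤ A := by positivity
  -- Lipschitz bound for the difference of `W` and the cut-off function on `(-ρ, ρ)`
  set g : ℝ → ℝ := fun x => W x - φ x with hg
  have hAsq : ∀ {u v a : ℝ}, (u - v) ^ 2 ≤ A * |a| ^ 2 → |u - v| ≤ (√A + |m|) * |a| := by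
    intro u v a h
    have h1 : |u - v| ≤ √A * |a| := by
      refine abs_le_of_sq_le_sq ?_ (by positivity)
      rwa [mul_pow, Real.sq_sqrt hA0]
    have h2 : 0 ≤ |m| * |a| := by positivity
    linarith
  have hg1 : ∀ x ∈ Icc b' b, ∀ y ∈ Icc b' b, |g x - g y| ≤ (√A + |m|) * |x - y| := by
    intro x hx y hy
    have e : g x - g y = m * (x - y) := by
      simp only [hg, hφ]; rw [cutAffine_of_mem hx, cutAffine_of_mem hy]; ring
    rw [e, abs_mul]
    exact mul_le_mul_of_nonneg_right (by linarith [Real.sqrt_nonneg A]) (abs_nonneg _)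
  have hg2 : ∀ x ∈ Icc b ρ, ∀ y ∈ Icc b ρ, |g x - g y| ≤ (√A + |m|) * |x - y| := by
    intro x hx y hy
    simp only [hg, hφ]
    rw [cutAffine_of_ge hbb hx.1, cutAffine_of_ge hbb hy.1, sub_zero, sub_zero]
    exact hAsq (hbL x hx y hy)
  have hg3 : ∀ x ∈ Icc (-ρ) b', ∀ y ∈ Icc (-ρ) b', |g x - g y| ≤ (√A + |m|) * |x - y| := by
    intro x hx y hy
    simp only [hg, hφ]
    rw [cutAffine_of_le hbb.le hx.2, cutAffine_of_le hbb.le hy.2, sub_zero, sub_zero]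
    have h := hbL' (-x) ⟨by linarith [hx.2], by linarith [hx.1]⟩ (-y)
      ⟨by linarith [hy.2], by linarith [hy.1]⟩
    rw [neg_neg, neg_neg, show -x - -y = -(x - y) by ring, abs_neg] at h
    exact hAsq h
  have hgl := abs_sub_le_glue hg3 (abs_sub_le_glue hg1 hg2)
  obtain ⟨i2, hE2⟩ := hC₂E R hR
  have iφ := integrableOn_lineEnergy hs1 hLφ R
  set I := Ioo (-R) R with hI
  have hρR : Ioo (-ρ) ρ ⊆ I := Ioo_subset_Ioo (by linarith) (by linarith)
  have i3 : IntegrableOn (fun p : ℝ × ℝ =>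
      2 * ((φ p.1 - φ p.2) ^ 2 / |p.1 - p.2| ^ (1 + 2 * s)) +
      4 * (A + m ^ 2) * (|p.1 - p.2| ^ 2 / |p.1 - p.2| ^ (1 + 2 * s))) (I ×ˢ I) :=
    (iφ.const_mul 2).add (i2.const_mul _)
  have h1 : lineEnergy s W ρ ≤ 2 * F + 4 * (A + m ^ 2) * (C₂ * R ^ (3 - 2 * s)) := by
    calc lineEnergy s W ρ ≤ ∫ p in Ioo (-ρ) ρ ×ˢ Ioo (-ρ) ρ,
          (2 * ((φ p.1 - φ p.2) ^ 2 / |p.1 - p.2| ^ (1 + 2 * s)) +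
          4 * (A + m ^ 2) * (|p.1 - p.2| ^ 2 / |p.1 - p.2| ^ (1 + 2 * s))) := by
          refine setIntegral_mono_on (integrableOn_lineEnergy hs1 hL ρ)
            (i3.mono_set (prod_mono hρR hρR)) (measurableSet_Ioo.prod measurableSet_Ioo) ?_
          rintro ⟨x, y⟩ ⟨hx, hy⟩
          simp only at hx hy ⊢
          have hk : 0 ≤ |x - y| ^ (1 + 2 * s) := Real.rpow_nonneg (abs_nonneg _) _
          rw [← mul_div_assoc, ← mul_div_assoc, ← add_div]
          refine div_le_div_of_nonneg_right ?_ hk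
          have hxy := hgl x (Ioo_subset_Icc_self hx) y (Ioo_subset_Icc_self hy)
          have hsq : (g x - g y) ^ 2 ≤ 2 * (A + m ^ 2) * |x - y| ^ 2 := by
            rw [← sq_abs (g x - g y)]
            refine (pow_le_pow_left₀ (abs_nonneg _) hxy 2).trans ?_
            rw [mul_pow]
            refine mul_le_mul_of_nonneg_right ?_ (sq_nonneg _)
            have := add_sq_le (a := √A) (b := |m|)
            rw [Real.sq_sqrt hA0, sq_abs] at this
            exact this
          have e : W x - W y = (φ x - φ y) + (g x - g y) := by simp only [hg]; ring
          rw [e]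
          refine add_sq_le.trans ?_
          linarith
      _ ≤ ∫ p in I ×ˢ I,
          (2 * ((φ p.1 - φ p.2) ^ 2 / |p.1 - p.2| ^ (1 + 2 * s)) +
          4 * (A + m ^ 2) * (|p.1 - p.2| ^ 2 / |p.1 - p.2| ^ (1 + 2 * s))) :=
          setIntegral_mono_set i3 (Filter.Eventually.of_forall fun p => by
            have : 0 ≤ |p.1 - p.2| ^ (1 + 2 * s) := Real.rpow_nonneg (abs_nonneg _) _
            simp only [Pi.zero_apply]
            positivity) (prod_mono hρR hρR).eventuallyLE
      _ ≤ _ := by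
          rw [integral_add (iφ.const_mul 2) (i2.const_mul _), integral_const_mul,
            integral_const_mul]
          exact add_le_add le_rfl (mul_le_mul_of_nonneg_left hE2 (by positivity))
  have e1 : R ^ (1 - 2 * s) = R ^ (-(2 * s)) * R := by
    rw [← Real.rpow_add_one hR.ne']; congr 1; ring
  have e3 : R ^ (3 - 2 * s) = R ^ (-(2 * s)) * R ^ 3 := by
    rw [← Real.rpow_natCast R 3, ← Real.rpow_add hR]; congr 1; push_cast; ring
  have hRp : 0 < R ^ (-(2 * s)) := Real.rpow_pos_of_pos hR _
  set G := 1 / κ ^ 3 * (R / r) ^ 3 * (R ^ (-(2 * s)) * N) with hG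
  have hG0 : 0 ≤ G := by positivity
  have hAR : A * R ^ (3 - 2 * s) = 528 * G := by
    rw [hA, e3, hG]; field_simp
  set S := nodeEnergy s R W b + nodeEnergy s R (fun t => W (-t)) (-b') with hS
  have hS1 : S ≤ 128 * κ * E' + 1056 * G := by
    have a1 : nodeEnergy s R W b ≤ 64 * κ * E' + 528 * G :=
      hbE.trans (le_of_eq (by rw [hG]; ring))
    have a2 : nodeEnergy s R (fun t => W (-t)) (-b') ≤ 64 * κ * E' + 528 * G :=
      hbE'.trans (le_of_eq (by rw [hG]; ring))
    linarith
  have hS0 : 0 ≤ S := add_nonneg (nodeEnergy_nonneg _ hR _ _) (nodeEnergy_nonneg _ hR _ _)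
  have hmR : m ^ 2 * R ^ (3 - 2 * s) ≤ 3 * S := by
    have a1 := sq_slope_le (W := W) hR (b' := b') (by linarith) hb1
    have a2 : R ^ (1 - 2 * s) * (W b ^ 2 + W b' ^ 2) ≤ S := by
      have c1 := endpointEnergy_nonneg s R W b
      have c2 := endpointEnergy_nonneg s R (fun t => W (-t)) (-b')
      simp only [hS, nodeEnergy, neg_neg]
      linarith
    calc _ ≤ 3 * (W b ^ 2 + W b' ^ 2) / R ^ 2 * R ^ (3 - 2 * s) :=
          mul_le_mul_of_nonneg_right a1 (Real.rpow_nonneg hR.le _)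
      _ = 3 * (R ^ (1 - 2 * s) * (W b ^ 2 + W b' ^ 2)) := by rw [e1, e3]; field_simp
      _ ≤ _ := by linarith
  have hNG : R ^ (-(2 * s)) * N ≤ G := by
    have c1 : 1 ≤ 1 / κ ^ 3 := by
      rw [le_div_iff₀ (by positivity), one_mul]; exact pow_le_one₀ hκ0.le (by linarith)
    have c2 : 1 ≤ (R / r) ^ 3 := one_le_pow₀ ((one_le_div hr0).2 (by linarith))
    have c3 : 0 ≤ R ^ (-(2 * s)) * N := by positivity
    exact le_mul_of_one_le_left c3 (one_le_mul_of_one_le_of_one_le c1 c2)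
  have hF' : F ≤ C₁ * (M + G + S) := hF.trans (by gcongr)
  have hκE : 0 ≤ κ * E' := by positivity
  have hX : M + G + S ≤ 1057 * (κ * E' + M + G) := by linarith
  have hS2 : S ≤ 1057 * (κ * E' + M + G) := by linarith
  calc lineEnergy s W ρ ≤ 2 * F + 4 * (A + m ^ 2) * (C₂ * R ^ (3 - 2 * s)) := h1
    _ = 2 * F + 4 * C₂ * (A * R ^ (3 - 2 * s)) + 4 * C₂ * (m ^ 2 * R ^ (3 - 2 * s)) := by ring
    _ ≤ 2 * (C₁ * (1057 * (κ * E' + M + G))) + 4 * C₂ * (528 * (κ * E' + M + G)) +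
        4 * C₂ * (3 * (1057 * (κ * E' + M + G))) := by
        rw [hAR]
        have c1 : F ≤ C₁ * (1057 * (κ * E' + M + G)) := hF'.trans (by gcongr)
        have c2 : G ≤ κ * E' + M + G := by linarith
        have c3 := hmR.trans (mul_le_mul_of_nonneg_left hS2 (by norm_num : (0 : ℝ) ≤ 3))
        gcongr
    _ = _ := by ring

/-- The discrete Caccioppoli inequality on the line, for arbitrary meshes. The energy on the right of
`exists_lineEnergy_le_add` is absorbed by varying the radii. -/
theorem exists_lineEnergy_half_le (hs0 : 0 < s) (hs1 : s < 1) {C₀ : ℝ} (hC₀ : 0 ≤ C₀) :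
    ∃ C : ℝ, 0 < C ∧ ∀ (R : ℝ), 0 < R → ∀ (W : ℝ → ℝ) (L : ℝ),
      (∀ x y, |W x - W y| ≤ L * |x - y|) → ∀ 𝒯 : Finset (ℝ × ℝ), IsIntervalMesh 𝒯 R →
      (∀ T ∈ 𝒯, IsAffineOnIcc W T.1 T.2) → ∀ M : ℝ, 0 ≤ M →
      (∀ T' ∈ 𝒯, ∀ T ∈ 𝒯, -(3 / 4 * R) ≤ T'.2 → T'.2 ≤ -(7 / 16 * R) →
        7 / 16 * R ≤ T.1 → T.1 ≤ 3 / 4 * R →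
        ∫ p in Ioo (-R) R ×ˢ Ioo (-R) R, (W p.1 - W p.2) *
          (cutAffine W T'.2 T.1 p.1 - cutAffine W T'.2 T.1 p.2) / |p.1 - p.2| ^ (1 + 2 * s) ≤
        1 / 8 * lineEnergy s (cutAffine W T'.2 T.1) R + M +
          C₀ * (R ^ (-(2 * s)) * ∫ x in Ioo (-R) R, cutAffine W T'.2 T.1 x ^ 2)) →
      lineEnergy s W (R / 2) ≤ C * (M + R ^ (-(2 * s)) * ∫ x in Ioo (-R) R, W x ^ 2) := by
  obtain ⟨C₁, hC₁, hstep⟩ := exists_lineEnergy_le_add hs0 hs1 hC₀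
  set κ := min (1 / 4) (1 / (16 * C₁)) with hκ
  have hκ0 : 0 < κ := lt_min (by norm_num) (by positivity)
  have hκC : C₁ * κ ≤ 1 / 16 := by
    calc C₁ * κ ≤ C₁ * (1 / (16 * C₁)) := mul_le_mul_of_nonneg_left (min_le_right _ _) hC₁.le
      _ = 1 / 16 := by field_simp
  refine ⟨128 * C₁ * (1 + 8 / κ ^ 3), by positivity, ?_⟩
  intro R hR W L hL 𝒯 h𝒯 hWT M hM hLG
  have hstep' := hstep R hR W L hL 𝒯 h𝒯 hWT M hM hLG κ hκ0 (min_le_left _ _)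
  set N := R ^ (-(2 * s)) * ∫ x in Ioo (-R) R, W x ^ 2 with hN
  have hN0 : 0 ≤ N :=
    mul_nonneg (Real.rpow_nonneg hR.le _) (integral_nonneg fun _ => sq_nonneg _)
  -- The weight `(3 R / 4 - ρ)³` matches the factor `(R / (ρ' - ρ))³` of the step. With
  -- `ρ' = (ρ + 3 R / 4) / 2` the weight drops by the factor `8`, and `8 C₁ κ ≤ 1 / 2`, so the largest
  -- weighted energy absorbs itself.
  set Q : Set ℝ := (fun ρ => lineEnergy s W ρ * (3 / 4 * R - ρ) ^ 3) '' Icc (R / 2) (3 / 4 * R)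
    with hQ
  have hbdd : BddAbove Q := by
    refine ⟨lineEnergy s W (3 / 4 * R) * R ^ 3, ?_⟩
    rintro _ ⟨ρ, hρ, rfl⟩
    have h1 : 0 ≤ 3 / 4 * R - ρ := by linarith [hρ.2]
    exact mul_le_mul (lineEnergy_mono hs1 hL hρ.2)
      (pow_le_pow_left₀ h1 (by linarith [hρ.1]) 3) (pow_nonneg h1 3) (lineEnergy_nonneg _ _ _)
  have hne : Q.Nonempty := ⟨_, R / 2, ⟨le_rfl, by linarith⟩, rfl⟩
  set A := C₁ * (M + 8 / κ ^ 3 * N) * R ^ 3 with hA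
  have hA0 : 0 ≤ A := by positivity
  have hself : ∀ q ∈ Q, q ≤ 1 / 2 * sSup Q + A := by
    rintro _ ⟨ρ, hρ, rfl⟩
    simp only
    have hS0 : 0 ≤ sSup Q := by
      refine le_csSup_of_le hbdd ⟨R / 2, ⟨le_rfl, by linarith⟩, rfl⟩ ?_
      exact mul_nonneg (lineEnergy_nonneg _ _ _) (pow_nonneg (by linarith) 3)
    rcases hρ.2.eq_or_lt with h | h
    · rw [h, sub_self]
      simp only [ne_eq, OfNat.ofNat_ne_zero, not_false_eq_true, zero_pow, mul_zero]
      positivity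
    set δ := 3 / 4 * R - ρ with hδ
    have hδ0 : 0 < δ := sub_pos.2 h
    have hδR : δ ≤ R := by linarith [hρ.1]
    have h1 := hstep' ρ (ρ + δ / 2) hρ.1 (by linarith) (by linarith)
    rw [show ρ + δ / 2 - ρ = δ / 2 by ring] at h1
    set E' := lineEnergy s W (ρ + δ / 2) with hE'
    have h2 : E' * (δ / 2) ^ 3 ≤ sSup Q := by
      refine le_csSup hbdd ⟨ρ + δ / 2, ⟨by linarith [hρ.1], by linarith⟩, ?_⟩
      simp only
      rw [show 3 / 4 * R - (ρ + δ / 2) = δ / 2 by rw [hδ]; ring]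
    have hE'0 : 0 ≤ E' := lineEnergy_nonneg _ _ _
    have hδ3 : δ ^ 3 ≤ R ^ 3 := pow_le_pow_left₀ hδ0.le hδR 3
    calc lineEnergy s W ρ * δ ^ 3
        ≤ C₁ * (κ * E' + M + 1 / κ ^ 3 * (R / (δ / 2)) ^ 3 * N) * δ ^ 3 := by gcongr
      _ = C₁ * κ * (8 * (E' * (δ / 2) ^ 3)) + C₁ * M * δ ^ 3 + C₁ * (8 / κ ^ 3 * N) * R ^ 3 := by
          field_simp; ring
      _ ≤ 1 / 16 * (8 * sSup Q) + C₁ * M * R ^ 3 + C₁ * (8 / κ ^ 3 * N) * R ^ 3 := by gcongr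
      _ = _ := by rw [hA]; ring
  have hsup : sSup Q ≤ 2 * A := by
    have := csSup_le hne hself
    linarith
  have h1 : lineEnergy s W (R / 2) * (R / 4) ^ 3 ≤ 2 * A := by
    refine le_trans (le_csSup hbdd ⟨R / 2, ⟨le_rfl, by linarith⟩, ?_⟩) hsup
    simp only
    rw [show 3 / 4 * R - R / 2 = R / 4 by ring]
  have h2 : lineEnergy s W (R / 2) ≤ 128 * C₁ * (M + 8 / κ ^ 3 * N) := by
    have hR3 : 0 < (R / 4) ^ 3 := by positivity
    refine le_of_mul_le_mul_right (h1.trans (le_of_eq ?_)) hR3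
    rw [hA]; ring
  refine h2.trans ?_
  rw [mul_assoc (128 * C₁)]
  refine mul_le_mul_of_nonneg_left ?_ (by positivity)
  have h3 : 0 ≤ 8 / κ ^ 3 * M := by positivity
  nlinarith

end LineCaccioppoli

/-! ### Meshes of one-dimensional domains -/

section OneDim

open FracFEM Set

/-- An isometry from the line, moved to another base point. -/
noncomputable def LinearIsometryEquiv.translate {E : Type*} [NormedAddCommGroup E] [NormedSpace ℝ E]
    (e : ℝ ≃ₗᵢ[ℝ] E) (x₀ : E) : ℝ ≃ᵃⁱ[ℝ] E :=
  e.toAffineIsometryEquiv.trans (AffineIsometryEquiv.constVAdd ℝ E x₀)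

/-- The standard isometry from the line to one-dimensional Euclidean space. -/
noncomputable def lineEquiv : ℝ ≃ₗᵢ[ℝ] EuclideanSpace ℝ (Fin 1) :=
  (OrthonormalBasis.singleton (Fin 1) ℝ).repr

/-- The isometry from the line to one-dimensional Euclidean space that maps `0` to `x₀`. -/
noncomputable def lineMapAt (x₀ : EuclideanSpace ℝ (Fin 1)) : ℝ ≃ᵃⁱ[ℝ] EuclideanSpace ℝ (Fin 1) :=
  lineEquiv.translate x₀

variable {x₀ : EuclideanSpace ℝ (Fin 1)} {R s : ℝ}

theorem lineMapAt_zero : lineMapAt x₀ 0 = x₀ := by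
  change x₀ + lineEquiv 0 = x₀
  rw [map_zero, add_zero]

theorem norm_lineMapAt_sub (a b : ℝ) : ‖lineMapAt x₀ a - lineMapAt x₀ b‖ = |a - b| := by
  rw [← dist_eq_norm, (lineMapAt x₀).dist_map, Real.dist_eq]

theorem lineMapAt_mem_ball {a r : ℝ} : lineMapAt x₀ a ∈ ball x₀ r ↔ a ∈ Ioo (-r) r := by
  rw [mem_ball, dist_eq_norm]
  conv_lhs => rw [← lineMapAt_zero (x₀ := x₀)]
  simp only [lineMapAt_zero]
  have := norm_lineMapAt_sub (x₀ := x₀) a 0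
  rw [lineMapAt_zero, sub_zero] at this
  rw [this, abs_lt, mem_Ioo]

theorem measurePreserving_lineMapAt (x₀ : EuclideanSpace ℝ (Fin 1)) :
    MeasurePreserving (lineMapAt x₀) :=
  (measurePreserving_add_left volume x₀).comp
    lineEquiv.measurePreserving

theorem measurableEmbedding_lineMapAt (x₀ : EuclideanSpace ℝ (Fin 1)) :
    MeasurableEmbedding (lineMapAt x₀) :=
  (lineMapAt x₀).toHomeomorph.measurableEmbedding

theorem setIntegral_ball_eq_Ioo (f : EuclideanSpace ℝ (Fin 1) → ℝ) (r : ℝ) :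
    ∫ x in ball x₀ r, f x = ∫ t in Ioo (-r) r, f (lineMapAt x₀ t) := by
  rw [← (measurePreserving_lineMapAt x₀).setIntegral_preimage_emb
    (measurableEmbedding_lineMapAt x₀)]
  congr 2
  ext t
  exact lineMapAt_mem_ball

theorem setIntegral_ball_prod_eq_Ioo
    (f : EuclideanSpace ℝ (Fin 1) × EuclideanSpace ℝ (Fin 1) → ℝ) (r : ℝ) :
    ∫ p in ball x₀ r ×ˢ ball x₀ r, f p =
      ∫ p in Ioo (-r) r ×ˢ Ioo (-r) r, f (lineMapAt x₀ p.1, lineMapAt x₀ p.2) := by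
  have h := (measurePreserving_lineMapAt x₀).prod (measurePreserving_lineMapAt x₀)
  rw [← Measure.volume_eq_prod, ← Measure.volume_eq_prod] at h
  rw [← h.setIntegral_preimage_emb ((measurableEmbedding_lineMapAt x₀).prodMap
    (measurableEmbedding_lineMapAt x₀))]
  congr 2
  ext p
  exact and_congr lineMapAt_mem_ball lineMapAt_mem_ball

theorem kernelDenom_lineMapAt (s a b : ℝ) :
    kernelDenom s (lineMapAt x₀ a) (lineMapAt x₀ b) = |a - b| ^ (1 + 2 * s) := by
  rw [kernelDenom, norm_lineMapAt_sub, Nat.cast_one]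

theorem lineMapAt_mem_convexHull {a b z : ℝ} (hab : a ≤ b) :
    lineMapAt x₀ z ∈ convexHull ℝ {lineMapAt x₀ a, lineMapAt x₀ b} ↔ z ∈ Icc a b := by
  have h := image_segment ℝ (lineMapAt x₀).toAffineEquiv.toAffineMap a b
  rw [segment_eq_Icc hab] at h
  have h' : (lineMapAt x₀) '' Icc a b = segment ℝ (lineMapAt x₀ a) (lineMapAt x₀ b) := h
  rw [convexHull_pair, ← h', (lineMapAt x₀).injective.mem_set_image]

variable {K : Geometry.SimplicialComplex ℝ (EuclideanSpace ℝ (Fin 1))} {hK : K.faces.Finite}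
  {Ω : Set (EuclideanSpace ℝ (Fin 1))}

theorem exists_eq_pair_of_mem_cells (x₀ : EuclideanSpace ℝ (Fin 1))
    {t : Finset (EuclideanSpace ℝ (Fin 1))} (ht : t ∈ cells K hK) :
    ∃ a b : ℝ, a < b ∧ t = {lineMapAt x₀ a, lineMapAt x₀ b} := by
  obtain ⟨p, q, hpq, rfl⟩ := Finset.card_eq_two.1 (mem_cells.1 ht).2
  obtain ⟨a, rfl⟩ := (lineMapAt x₀).surjective p
  obtain ⟨b, rfl⟩ := (lineMapAt x₀).surjective q
  rcases lt_trichotomy a b with h | h | h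
  · exact ⟨a, b, h, rfl⟩
  · exact absurd (by rw [h]) hpq
  · exact ⟨b, a, h, Finset.pair_comm _ _⟩

variable (K hK) in
/-- The elements that meet the ball `B(x₀, R)`, as intervals on the line. -/
noncomputable def intervalCells (x₀ : EuclideanSpace ℝ (Fin 1)) (R : ℝ) : Finset (ℝ × ℝ) :=
  open Classical in
  {T ∈ ((cells K hK).biUnion id).image (lineMapAt x₀).symm ×ˢ
      ((cells K hK).biUnion id).image (lineMapAt x₀).symm |
    T.1 < T.2 ∧ {lineMapAt x₀ T.1, lineMapAt x₀ T.2} ∈ cells K hK ∧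
      (Icc T.1 T.2 ∩ Ioo (-R) R).Nonempty}

theorem mem_intervalCells {T : ℝ × ℝ} : T ∈ intervalCells K hK x₀ R ↔
    T.1 < T.2 ∧ {lineMapAt x₀ T.1, lineMapAt x₀ T.2} ∈ cells K hK ∧
      (Icc T.1 T.2 ∩ Ioo (-R) R).Nonempty := by
  classical
  simp only [intervalCells, Finset.mem_filter, Finset.mem_product, Finset.mem_image,
    Finset.mem_biUnion, id_eq, and_iff_right_iff_imp]
  rintro ⟨-, h, -⟩
  exact ⟨⟨_, ⟨_, h, Finset.mem_insert_self _ _⟩, (lineMapAt x₀).symm_apply_apply _⟩,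
    ⟨_, ⟨_, h, Finset.mem_insert_of_mem (Finset.mem_singleton_self _)⟩,
      (lineMapAt x₀).symm_apply_apply _⟩⟩

theorem isIntervalMesh_intervalCells (hT : IsTriangulation K Ω) (hΩ : IsOpen Ω)
    (hB : ball x₀ R ⊆ Ω)
    (hh : ∀ t ∈ cells K hK, ∀ z ∈ convexHull ℝ (t : Set (EuclideanSpace ℝ (Fin 1))),
      z ∈ ball x₀ R → cellDiam t ≤ R / 16) : IsIntervalMesh (intervalCells K hK x₀ R) R := by
  classical
  constructor
  · exact fun T hT => (mem_intervalCells.1 hT).1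
  · intro T hT
    obtain ⟨h1, h2, z, hz, hzR⟩ := mem_intervalCells.1 hT
    have h3 := hh _ h2 (lineMapAt x₀ z) (by
      rw [Finset.coe_pair]; exact (lineMapAt_mem_convexHull h1.le).2 hz) (lineMapAt_mem_ball.2 hzR)
    refine le_trans ?_ h3
    have h4 := dist_le_diam_convexHull
      (mem_convexHull_of_mem (Finset.mem_insert_of_mem (Finset.mem_singleton_self _)))
      (mem_convexHull_of_mem (Finset.mem_insert_self (lineMapAt x₀ T.1) {lineMapAt x₀ T.2}))
    rw [norm_lineMapAt_sub, abs_of_pos (sub_pos.2 h1)] at h4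
    exact h4
  · intro T hT T' hT' hne
    obtain ⟨h1, h2, -⟩ := mem_intervalCells.1 hT
    obtain ⟨h1', h2', -⟩ := mem_intervalCells.1 hT'
    rw [Set.disjoint_left]
    intro z hz hz'
    have hzm : lineMapAt x₀ z ∈ convexHull ℝ
        (({lineMapAt x₀ T.1, lineMapAt x₀ T.2} : Finset _) : Set (EuclideanSpace ℝ (Fin 1))) := by
      rw [Finset.coe_pair]; exact (lineMapAt_mem_convexHull h1.le).2 (Ioo_subset_Icc_self hz)
    have hzm' : lineMapAt x₀ z ∈ convexHull ℝ
        (({lineMapAt x₀ T'.1, lineMapAt x₀ T'.2} : Finset _) : Set (EuclideanSpace ℝ (Fin 1))) := by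
      rw [Finset.coe_pair]; exact (lineMapAt_mem_convexHull h1'.le).2 (Ioo_subset_Icc_self hz')
    have hcap := K.inter_subset_convexHull (mem_cells.1 h2).1 (mem_cells.1 h2').1 ⟨hzm, hzm'⟩
    have hinj := (lineMapAt x₀).injective
    -- the vertices of the intersection, in terms of the coordinates
    have hsub : ∀ c : ℝ, z ≠ c → ¬ ((({lineMapAt x₀ T.1, lineMapAt x₀ T.2} : Finset _) :
        Set (EuclideanSpace ℝ (Fin 1))) ∩ (({lineMapAt x₀ T'.1, lineMapAt x₀ T'.2} : Finset _) :
        Set (EuclideanSpace ℝ (Fin 1))) ⊆ {lineMapAt x₀ c}) := by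
      intro c hc hs
      have := convexHull_mono hs hcap
      rw [convexHull_singleton, mem_singleton_iff] at this
      exact hc (hinj this)
    have hm1 : T.1 = T'.1 ∨ T.1 = T'.2 := by
      by_contra hcon
      push Not at hcon
      refine hsub T.2 hz.2.ne ?_
      rintro _ ⟨hp, hp'⟩
      simp only [Finset.coe_pair, mem_insert_iff, mem_singleton_iff] at hp hp' ⊢
      rcases hp with rfl | rfl
      · rcases hp' with h | h
        · exact absurd (hinj h) hcon.1
        · exact absurd (hinj h) hcon.2
      · rfl
    have hm2 : T.2 = T'.1 ∨ T.2 = T'.2 := by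
      by_contra hcon
      push Not at hcon
      refine hsub T.1 hz.1.ne' ?_
      rintro _ ⟨hp, hp'⟩
      simp only [Finset.coe_pair, mem_insert_iff, mem_singleton_iff] at hp hp' ⊢
      rcases hp with rfl | rfl
      · rfl
      · rcases hp' with h | h
        · exact absurd (hinj h) hcon.1
        · exact absurd (hinj h) hcon.2
    rcases hm1 with h | h <;> rcases hm2 with h' | h'
    · linarith
    · exact hne (Prod.ext h h')
    · linarith
    · linarith
  · intro z hz
    have hzB : lineMapAt x₀ z ∈ ball x₀ R := lineMapAt_mem_ball.2 hz
    obtain ⟨t, ht, hzt⟩ := exists_cell_of_mem_closure (hK := hK) hT hΩ (subset_closure (hB hzB))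
    obtain ⟨a, b, hab, rfl⟩ := exists_eq_pair_of_mem_cells x₀ ht
    rw [Finset.coe_pair, lineMapAt_mem_convexHull hab.le] at hzt
    exact ⟨(a, b), mem_intervalCells.2 ⟨hab, ht, z, hzt, hz⟩, hzt⟩

theorem AffineMap.eq_add_mul (F : ℝ →ᵃ[ℝ] ℝ) (b c x : ℝ) (hbc : b < c) :
    F x = F b + (F c - F b) / (c - b) * (x - b) := by
  have key : ∀ y, F y = F b + (y - b) * F.linear 1 := fun y => by
    have h := F.map_vadd b (y - b)
    simp only [vadd_eq_add, sub_add_cancel] at h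
    rw [h, show y - b = (y - b) • (1 : ℝ) by simp, map_smul, smul_eq_mul, smul_eq_mul, mul_one]
    ring
  have hne : c - b ≠ 0 := (sub_pos.2 hbc).ne'
  rw [key x, key c]
  field_simp
  ring

theorem isAffineOnIcc_of_mem_feSpace {w : EuclideanSpace ℝ (Fin 1) → ℝ} (hw : w ∈ feSpace K Ω)
    {T : ℝ × ℝ} (hT : T ∈ intervalCells K hK x₀ R) :
    IsAffineOnIcc (fun t => w (lineMapAt x₀ t)) T.1 T.2 := by
  obtain ⟨h1, h2, -⟩ := mem_intervalCells.1 hT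
  obtain ⟨f, hf⟩ := hw.2.2 _ (convexHull_mem_elements h2)
  rw [Finset.coe_pair] at hf
  have he : ∀ x ∈ Icc T.1 T.2, w (lineMapAt x₀ x) =
      (f.comp (lineMapAt x₀).toAffineEquiv.toAffineMap) x := fun x hx =>
    hf ((lineMapAt_mem_convexHull h1.le).2 hx)
  intro x hx
  simp only
  rw [he x hx, he T.1 ⟨le_rfl, h1.le⟩, he T.2 ⟨h1.le, le_rfl⟩]
  exact AffineMap.eq_add_mul _ _ _ _ h1

/-- In dimension one, cutting off at two nodes of the mesh stays in the discrete space. -/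
theorem cutAffine_mem_feSpaceOn {w : EuclideanSpace ℝ (Fin 1) → ℝ} (hw : w ∈ feSpace K Ω)
    (hB : ball x₀ R ⊆ Ω) (hR : 0 < R) {T' T : ℝ × ℝ} (hT' : T' ∈ intervalCells K hK x₀ R)
    (hT : T ∈ intervalCells K hK x₀ R) (hb' : -(3 / 4 * R) ≤ T'.2) (hbb : T'.2 < T.1)
    (hb : T.1 ≤ 3 / 4 * R) :
    (fun x => cutAffine (fun t => w (lineMapAt x₀ t)) T'.2 T.1 ((lineMapAt x₀).symm x)) ∈
      feSpaceOn K Ω (ball x₀ R) ∧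
    ∀ x, x ∉ ball x₀ (15 / 16 * R) →
      cutAffine (fun t => w (lineMapAt x₀ t)) T'.2 T.1 ((lineMapAt x₀).symm x) = 0 := by
  classical
  have hzero : ∀ x, x ∉ ball x₀ (15 / 16 * R) →
      cutAffine (fun t => w (lineMapAt x₀ t)) T'.2 T.1 ((lineMapAt x₀).symm x) = 0 := by
    intro x hx
    obtain ⟨z, rfl⟩ := (lineMapAt x₀).surjective x
    rw [lineMapAt_mem_ball, mem_Ioo, not_and_or, not_lt, not_lt] at hx
    rw [(lineMapAt x₀).symm_apply_apply]
    rcases hx with h | h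
    · exact cutAffine_of_le hbb.le (by linarith)
    · exact cutAffine_of_ge hbb (by linarith)
  have hsub : ball x₀ (15 / 16 * R) ⊆ ball x₀ R := ball_subset_ball (by linarith)
  refine ⟨⟨⟨?_, fun x hx => hzero x fun h => hx (hB (hsub h)), ?_⟩,
    fun x hx => hzero x fun h => hx (hsub h)⟩, hzero⟩
  · have h1 := hw.1
    have h2 : Continuous (lineMapAt x₀) := (lineMapAt x₀).continuous
    have h3 : Continuous (lineMapAt x₀).symm := (lineMapAt x₀).symm.continuous
    unfold cutAffine
    fun_prop
  · rintro _ ⟨t, ht, hcard, rfl⟩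
    have htc : t ∈ cells K hK := mem_cells.2 ⟨ht, hcard⟩
    obtain ⟨a, c, hac, rfl⟩ := exists_eq_pair_of_mem_cells x₀ htc
    obtain ⟨-, h2', -⟩ := mem_intervalCells.1 hT'
    obtain ⟨-, h2, -⟩ := mem_intervalCells.1 hT
    -- the nodes of the cut are not interior to the element
    have hnode : ∀ {v : ℝ} {t' : Finset (EuclideanSpace ℝ (Fin 1))}, t' ∈ cells K hK →
        lineMapAt x₀ v ∈ t' → v ≤ a ∨ c ≤ v := by
      intro v t' ht' hv
      by_contra hcon
      push Not at hcon
      have hm := mem_of_mem_convexHull_cells ht' htc hv (by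
        rw [Finset.coe_pair]
        exact (lineMapAt_mem_convexHull hac.le).2 ⟨hcon.1.le, hcon.2.le⟩)
      rw [Finset.mem_insert, Finset.mem_singleton] at hm
      rcases hm with h | h
      · exact hcon.1.ne' ((lineMapAt x₀).injective h)
      · exact hcon.2.ne ((lineMapAt x₀).injective h)
    have hn' := hnode h2' (v := T'.2) (Finset.mem_insert_of_mem (Finset.mem_singleton_self _))
    have hn := hnode h2 (v := T.1) (Finset.mem_insert_self _ _)
    rw [Finset.coe_pair]
    have hcases : c ≤ T'.2 ∨ T.1 ≤ a ∨ (T'.2 ≤ a ∧ c ≤ T.1) := by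
      rcases hn' with h | h
      · rcases hn with h' | h'
        · exact Or.inr (Or.inl h')
        · exact Or.inr (Or.inr ⟨h, h'⟩)
      · exact Or.inl h
    rcases hcases with h | h | ⟨h, h'⟩
    · refine ⟨AffineMap.const ℝ _ 0, fun x hx => ?_⟩
      obtain ⟨z, rfl⟩ := (lineMapAt x₀).surjective x
      rw [lineMapAt_mem_convexHull hac.le] at hx
      simp only [(lineMapAt x₀).symm_apply_apply, AffineMap.const_apply]
      exact cutAffine_of_le hbb.le (hx.2.trans h)
    · refine ⟨AffineMap.const ℝ _ 0, fun x hx => ?_⟩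
      obtain ⟨z, rfl⟩ := (lineMapAt x₀).surjective x
      rw [lineMapAt_mem_convexHull hac.le] at hx
      simp only [(lineMapAt x₀).symm_apply_apply, AffineMap.const_apply]
      exact cutAffine_of_ge hbb (h.trans hx.1)
    · obtain ⟨f, hf⟩ := hw.2.2 _ (convexHull_mem_elements htc)
      rw [Finset.coe_pair] at hf
      set W : ℝ → ℝ := fun t => w (lineMapAt x₀ t) with hW
      set m := (W T.1 - W T'.2) / (T.1 - T'.2) with hm
      refine ⟨f - (AffineMap.const ℝ ℝ (W T'.2) + m • (AffineMap.id ℝ ℝ -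
        AffineMap.const ℝ ℝ T'.2)).comp (lineMapAt x₀).symm.toAffineEquiv.toAffineMap,
        fun x hx => ?_⟩
      have hfx := hf hx
      obtain ⟨z, rfl⟩ := (lineMapAt x₀).surjective x
      rw [lineMapAt_mem_convexHull hac.le] at hx
      have e : ((lineMapAt x₀).symm.toAffineEquiv.toAffineMap : _ → ℝ) (lineMapAt x₀ z) = z :=
        (lineMapAt x₀).symm_apply_apply z
      simp only [(lineMapAt x₀).symm_apply_apply]
      rw [cutAffine_of_mem ⟨h.trans hx.1, hx.2.trans h'⟩]
      simp only [AffineMap.coe_sub, Pi.sub_apply, AffineMap.coe_comp, Function.comp_apply, e,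
        AffineMap.coe_add, Pi.add_apply, AffineMap.coe_smul, Pi.smul_apply, AffineMap.const_apply,
        AffineMap.id_apply, smul_eq_mul]
      rw [← hfx]

/-- The discrete Caccioppoli inequality in dimension one. -/
theorem exists_caccioppoli_one {s : ℝ} (hs0 : 0 < s) (hs1 : s < 1) {C₀ : ℝ} (hC₀ : 0 ≤ C₀) :
    ∃ C : ℝ, 0 < C ∧
    ∀ (K : Geometry.SimplicialComplex ℝ (EuclideanSpace ℝ (Fin 1))) (hK : K.faces.Finite)
      (Ω : Set (EuclideanSpace ℝ (Fin 1))), IsTriangulation K Ω → IsOpen Ω →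
    ∀ (x₀ : EuclideanSpace ℝ (Fin 1)) (R : ℝ), 0 < R → ball x₀ R ⊆ Ω →
      (∀ t ∈ cells K hK, ∀ z ∈ convexHull ℝ (t : Set (EuclideanSpace ℝ (Fin 1))),
        z ∈ ball x₀ R → cellDiam t ≤ R / 16) →
    ∀ w ∈ feSpace K Ω, ∀ M : ℝ, 0 ≤ M →
      (∀ φ ∈ feSpaceOn K Ω (ball x₀ R), (∀ x, x ∉ ball x₀ (15 / 16 * R) → φ x = 0) →
        ∫ p in ball x₀ R ×ˢ ball x₀ R, (w p.1 - w p.2) * (φ p.1 - φ p.2) / kernelDenom s p.1 p.2 ≤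
          1 / 8 * (∫ p in ball x₀ R ×ˢ ball x₀ R, (φ p.1 - φ p.2) ^ 2 / kernelDenom s p.1 p.2)
          + M + C₀ * (R ^ (-(2 * s)) * ∫ x in ball x₀ R, φ x ^ 2)) →
      ∫ p in ball x₀ (R / 2) ×ˢ ball x₀ (R / 2), (w p.1 - w p.2) ^ 2 / kernelDenom s p.1 p.2 ≤
        C * (M + R ^ (-(2 * s)) * ∫ x in ball x₀ R, w x ^ 2) := by
  obtain ⟨C, hC, h⟩ := exists_lineEnergy_half_le hs0 hs1 hC₀
  refine ⟨C, hC, ?_⟩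
  intro K hK Ω hT hΩ x₀ R hR hB hh w hw M hM hLG
  obtain ⟨L, -, hL⟩ := exists_lipschitz_of_mem_feSpace hT hΩ hw
  set W : ℝ → ℝ := fun t => w (lineMapAt x₀ t) with hW
  have key := h R hR W L (fun x y => by
      have := hL (lineMapAt x₀ x) (lineMapAt x₀ y)
      rwa [norm_lineMapAt_sub] at this)
    (intervalCells K hK x₀ R) (isIntervalMesh_intervalCells hT hΩ hB hh)
    (fun T hT => isAffineOnIcc_of_mem_feSpace hw hT) M hM
    (fun T' hT' T hT h1 h2 h3 h4 => by
      obtain ⟨hmem, hz⟩ := cutAffine_mem_feSpaceOn hw hB hR hT' hT h1 (by linarith) h4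
      have := hLG _ hmem hz
      rw [setIntegral_ball_prod_eq_Ioo, setIntegral_ball_prod_eq_Ioo, setIntegral_ball_eq_Ioo] at this
      simp only [kernelDenom_lineMapAt, (lineMapAt x₀).symm_apply_apply] at this
      exact this)
  rw [setIntegral_ball_prod_eq_Ioo, setIntegral_ball_eq_Ioo]
  simp only [kernelDenom_lineMapAt]
  exact key

end OneDim

/-! ### The local energy error estimate -/

section ErrorEstimate

open FracFEM

variable {d : ℕ} {s : ℝ}

theorem FracFEM.MemHs.sub {v w : EuclideanSpace ℝ (Fin d) → ℝ} (hv : MemHs s v) (hw : MemHs s w) :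
    MemHs s (v - w) := by
  refine ⟨hv.memLp.sub hw.memLp, ?_⟩
  have h : hsSeminormSq s Set.univ (v - w) ≤
      2 * hsSeminormSq s Set.univ v + 2 * hsSeminormSq s Set.univ w := by
    have hm : ∀ {v : EuclideanSpace ℝ (Fin d) → ℝ}, MemHs s v →
        AEMeasurable (fun p : EuclideanSpace ℝ (Fin d) × EuclideanSpace ℝ (Fin d) =>
          ENNReal.ofReal (|v p.1 - v p.2| ^ 2 / kernelDenom s p.1 p.2))
        ((volume : Measure (EuclideanSpace ℝ (Fin d) × EuclideanSpace ℝ (Fin d))).restrict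
          (Set.univ ×ˢ Set.univ)) := fun {v} hv => by
      have := (hv.integrable_energy hv).aestronglyMeasurable.aemeasurable.ennreal_ofReal
      simp only [← sq, ← sq_abs (v _ - v _)] at this
      exact this.restrict
    rw [hsSeminormSq, hsSeminormSq, hsSeminormSq, ← lintegral_const_mul'' _ (hm hv),
      ← lintegral_const_mul'' _ (hm hw), ← lintegral_add_left' ((hm hv).const_mul _)]
    refine lintegral_mono fun p => ?_
    have hk := kernelDenom_nonneg s p.1 p.2
    have h2 : (2 : ℝ≥0∞) = ENNReal.ofReal 2 := by simp
    rw [h2, ← ENNReal.ofReal_mul (by norm_num), ← ENNReal.ofReal_mul (by norm_num),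
      ← ENNReal.ofReal_add (by positivity) (by positivity), ← mul_div_assoc, ← mul_div_assoc,
      ← add_div]
    refine ENNReal.ofReal_le_ofReal (div_le_div_of_nonneg_right ?_ hk)
    simp only [sq_abs, Pi.sub_apply]
    nlinarith [sq_nonneg ((v p.1 - v p.2) + (w p.1 - w p.2))]
  refine h.trans_lt (ENNReal.add_lt_top.2 ⟨?_, ?_⟩)
  · exact ENNReal.mul_lt_top (by simp) hv.seminorm_lt_top
  · exact ENNReal.mul_lt_top (by simp) hw.seminorm_lt_top

theorem FracFEM.MemHs.integrableOn_sq_sub_div {v : EuclideanSpace ℝ (Fin d) → ℝ} (hv : MemHs s v)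
    (D : Set (EuclideanSpace ℝ (Fin d) × EuclideanSpace ℝ (Fin d))) :
    IntegrableOn (fun p => (v p.1 - v p.2) ^ 2 / kernelDenom s p.1 p.2) D := by
  have := (hv.integrable_energy hv).integrableOn (s := D)
  simpa only [← sq] using this

theorem FracFEM.MemHs.hsSeminormSq_eq {v : EuclideanSpace ℝ (Fin d) → ℝ} (hv : MemHs s v)
    (D : Set (EuclideanSpace ℝ (Fin d))) :
    hsSeminormSq s D v =
      ENNReal.ofReal (∫ p in D ×ˢ D, (v p.1 - v p.2) ^ 2 / kernelDenom s p.1 p.2) := by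
  rw [ofReal_integral_eq_lintegral_ofReal (hv.integrableOn_sq_sub_div _)
    (Filter.Eventually.of_forall fun p => div_nonneg (sq_nonneg _) (kernelDenom_nonneg _ _ _)),
    hsSeminormSq]
  simp only [sq_abs]

theorem FracFEM.MemHs.integrableOn_sq {v : EuclideanSpace ℝ (Fin d) → ℝ} (hv : MemHs s v)
    (D : Set (EuclideanSpace ℝ (Fin d))) : IntegrableOn (fun x => v x ^ 2) D :=
  hv.memLp.integrable_sq.integrableOn

theorem FracFEM.MemHs.l2NormSq_eq {v : EuclideanSpace ℝ (Fin d) → ℝ} (hv : MemHs s v)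
    (D : Set (EuclideanSpace ℝ (Fin d))) :
    l2NormSq D v = ENNReal.ofReal (∫ x in D, v x ^ 2) := by
  rw [ofReal_integral_eq_lintegral_ofReal (hv.integrableOn_sq D)
    (Filter.Eventually.of_forall fun _ => sq_nonneg _), l2NormSq,
    eLpNorm_eq_lintegral_rpow_enorm_toReal (by norm_num) (by norm_num), ENNReal.toReal_ofNat,
    ← ENNReal.rpow_natCast, ← ENNReal.rpow_mul]
  norm_num
  refine lintegral_congr fun x => ?_
  rw [Real.enorm_eq_ofReal_abs, ← ENNReal.ofReal_pow (abs_nonneg _), sq_abs]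

variable {K : Geometry.SimplicialComplex ℝ (EuclideanSpace ℝ (Fin d))} {hK : K.faces.Finite}
  {Ω : Set (EuclideanSpace ℝ (Fin d))} {x₀ : EuclideanSpace ℝ (Fin d)} {R : ℝ}

theorem sub_mem_feSpace {v w : EuclideanSpace ℝ (Fin d) → ℝ} (hv : v ∈ feSpace K Ω)
    (hw : w ∈ feSpace K Ω) : v - w ∈ feSpace K Ω := by
  refine ⟨hv.1.sub hw.1, fun x hx => by simp [hv.2.1 x hx, hw.2.1 x hx], fun T hT => ?_⟩
  obtain ⟨f, hf⟩ := hv.2.2 T hT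
  obtain ⟨g, hg⟩ := hw.2.2 T hT
  exact ⟨f - g, fun x hx => by simp [hf hx, hg hx]⟩

/-- The supremum defining `localMeshSize` bounds the elements meeting the ball: it is over a finite
set. -/
theorem cellDiam_le_localMeshSize {t : Finset (EuclideanSpace ℝ (Fin d))} (ht : t ∈ cells K hK)
    {z : EuclideanSpace ℝ (Fin d)} (hz : z ∈ convexHull ℝ (t : Set (EuclideanSpace ℝ (Fin d))))
    (hzB : z ∈ ball x₀ R) : cellDiam t ≤ localMeshSize K x₀ R := by
  refine le_csSup ?_ ⟨_, convexHull_mem_elements ht, ⟨z, hz, hzB⟩, rfl⟩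
  have hfin : {ℓ : ℝ | ∃ T ∈ elements K, (T ∩ ball x₀ R).Nonempty ∧ ℓ = diam T}.Finite := by
    refine (hK.image fun t : Finset (EuclideanSpace ℝ (Fin d)) =>
      diam (convexHull ℝ (t : Set (EuclideanSpace ℝ (Fin d))))).subset ?_
    rintro _ ⟨_, ⟨t, ht, -, rfl⟩, -, rfl⟩
    exact ⟨t, ht, rfl⟩
  exact hfin.bddAbove

/-- The discrete Caccioppoli inequality in every dimension. -/
theorem exists_caccioppoli (hd : 1 ≤ d) (hs0 : 0 < s) (hs1 : s < 1) (σ : ℝ) {C₀ : ℝ}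
    (hC₀ : 0 ≤ C₀) : ∃ C : ℝ, 0 < C ∧
    ∀ (K : Geometry.SimplicialComplex ℝ (EuclideanSpace ℝ (Fin d)))
      (Ω : Set (EuclideanSpace ℝ (Fin d))), IsTriangulation K Ω → IsOpen Ω → IsShapeRegular K σ →
    ∀ (x₀ : EuclideanSpace ℝ (Fin d)) (R : ℝ), 0 < R → ball x₀ R ⊆ Ω →
      16 * localMeshSize K x₀ R ≤ R →
    ∀ w ∈ feSpace K Ω, ∀ M : ℝ, 0 ≤ M →
      (∀ φ ∈ feSpaceOn K Ω (ball x₀ R), (∀ x, x ∉ ball x₀ (15 / 16 * R) → φ x = 0) →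
        ∫ p in ball x₀ R ×ˢ ball x₀ R, (w p.1 - w p.2) * (φ p.1 - φ p.2) / kernelDenom s p.1 p.2 ≤
          1 / 8 * (∫ p in ball x₀ R ×ˢ ball x₀ R, (φ p.1 - φ p.2) ^ 2 / kernelDenom s p.1 p.2)
          + M + C₀ * (R ^ (-(2 * s)) * ∫ x in ball x₀ R, φ x ^ 2)) →
      ∫ p in ball x₀ (R / 2) ×ˢ ball x₀ (R / 2), (w p.1 - w p.2) ^ 2 / kernelDenom s p.1 p.2 ≤
        C * (M + R ^ (-(2 * s)) * ∫ x in ball x₀ R, w x ^ 2) := by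
  have hh : ∀ {K : Geometry.SimplicialComplex ℝ (EuclideanSpace ℝ (Fin d))} {hK : K.faces.Finite}
      {x₀ : EuclideanSpace ℝ (Fin d)} {R : ℝ}, 16 * localMeshSize K x₀ R ≤ R →
      ∀ t ∈ cells K hK, ∀ z ∈ convexHull ℝ (t : Set (EuclideanSpace ℝ (Fin d))),
        z ∈ ball x₀ R → cellDiam t ≤ R / 16 := fun hloc t ht z hz hzB => by
    have := cellDiam_le_localMeshSize ht hz hzB
    linarith
  rcases hd.eq_or_lt with rfl | hd2
  · obtain ⟨C, hC, h⟩ := exists_caccioppoli_one hs0 hs1 hC₀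
    exact ⟨C, hC, fun K Ω hT hΩ _ x₀ R hR hB hloc => h K hT.finite_faces Ω hT hΩ x₀ R hR hB (hh hloc)⟩
  · rcases le_or_gt σ 0 with hσ | hσ
    · -- there are no shape-regular meshes with such a parameter
      refine ⟨1, one_pos, fun K Ω hT hΩ hreg x₀ R hR hB => ?_⟩
      obtain ⟨t, ht, -⟩ := exists_cell_of_mem_closure (hK := hT.finite_faces) hT hΩ
        (subset_closure (hB (mem_ball_self hR)))
      exact absurd (IsShapeRegular.isFat hd hreg ⟨t, ht⟩).1 hσ.not_gt
    · obtain ⟨C, hC, h⟩ := exists_caccioppoli_of_two_le hd2 hs0 hs1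
        (μ := 1 / (4 * σ)) (by positivity) hC₀
      refine ⟨C, hC, fun K Ω hT hΩ hreg x₀ R hR hB hloc => ?_⟩
      obtain ⟨t, ht, -⟩ := exists_cell_of_mem_closure (hK := hT.finite_faces) hT hΩ
        (subset_closure (hB (mem_ball_self hR)))
      exact h K hT.finite_faces Ω hT hΩ (IsShapeRegular.isFat hd hreg ⟨t, ht⟩).2 x₀ R hR hB (hh hloc)

end ErrorEstimate

theorem theorem5p3 (d : ℕ) (hd : 1 ≤ d) (s : ℝ) (hs0 : 0 < s) (hs1 : s < 1) (σ : ℝ) :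
    ∃ C : ℝ, 0 < C ∧
      ∀ (Ω : Set (EuclideanSpace ℝ (Fin d))), IsOpen Ω →
      ∀ (K : Geometry.SimplicialComplex ℝ (EuclideanSpace ℝ (Fin d))),
        FracFEM.IsTriangulation K Ω → FracFEM.IsShapeRegular K σ →
      ∀ (x₀ : EuclideanSpace ℝ (Fin d)) (R : ℝ), 0 < R → Metric.ball x₀ R ⊆ Ω →
        16 * FracFEM.localMeshSize K x₀ R ≤ R →
      ∀ u : EuclideanSpace ℝ (Fin d) → ℝ, FracFEM.MemHsTilde s Ω u →
      ∀ uh ∈ FracFEM.feSpace K Ω,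
        (∀ φ ∈ FracFEM.feSpaceOn K Ω (Metric.ball x₀ R), FracFEM.energyForm s (u - uh) φ = 0) →
      ∀ vh ∈ FracFEM.feSpace K Ω,
        FracFEM.hsSeminormSq s (Metric.ball x₀ (R / 2)) (u - uh) ≤
          ENNReal.ofReal C *
            (FracFEM.hsSeminormSq s (Metric.ball x₀ R) (u - vh)
              + ENNReal.ofReal (R ^ (-(2 * s))) * FracFEM.l2NormSq (Metric.ball x₀ R) (u - vh)
              + ENNReal.ofReal (R ^ ((d : ℝ) + 2 * s)) * FracFEM.tail s x₀ R (u - vh) ^ 2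
              + ENNReal.ofReal (R ^ (-(2 * s))) * FracFEM.l2NormSq (Metric.ball x₀ R) (u - uh)
              + ENNReal.ofReal (R ^ ((d : ℝ) + 2 * s)) * FracFEM.tail s x₀ R (u - uh) ^ 2) := by
  obtain ⟨C₀, hC₀, hLG⟩ := exists_energy_ball_le_of_orthogonal hd hs0
  obtain ⟨C₁, hC₁, hCac⟩ := exists_caccioppoli hd hs0 hs1 σ hC₀.le
  refine ⟨2 + 2 * C₁ * (4 + C₀), by positivity, ?_⟩
  intro Ω hΩ K hT hreg x₀ R hR hB hloc u hu uh huh horth vh hvh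
  have hRt : 0 < R ^ ((d : ℝ) + 2 * s) := Real.rpow_pos_of_pos hR _
  have hRs : 0 < R ^ (-(2 * s)) := Real.rpow_pos_of_pos hR _
  -- the estimate is trivial if the tail of `u - uh` is infinite; otherwise real integrals can be used
  by_cases htail : FracFEM.tail s x₀ R (u - uh) = ∞
  · have h1 : ENNReal.ofReal (R ^ ((d : ℝ) + 2 * s)) * FracFEM.tail s x₀ R (u - uh) ^ 2 = ∞ := by
      rw [htail, ENNReal.top_pow two_ne_zero]
      exact ENNReal.mul_top (ENNReal.ofReal_pos.2 hRt).ne'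
    rw [h1, add_top, ENNReal.mul_top (ENNReal.ofReal_pos.2 (by positivity)).ne']
    exact le_top
  have huhH := memHs_of_mem_feSpace hd hs0 hs1 hT hΩ huh
  have hvhH := memHs_of_mem_feSpace hd hs0 hs1 hT hΩ hvh
  have hw : uh - vh ∈ FracFEM.feSpace K Ω := sub_mem_feSpace huh hvh
  have hwH := memHs_of_mem_feSpace hd hs0 hs1 hT hΩ hw
  have heH := hu.memHs.sub huhH
  have hfH := hu.memHs.sub hvhH
  have hef : (u - uh) + (uh - vh) = u - vh := sub_add_sub_cancel _ _ _
  set e := u - uh with he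
  set w := uh - vh with hwd
  set f := u - vh with hf
  set B := Metric.ball x₀ R with hBd
  set F := ∫ p in B ×ˢ B, (f p.1 - f p.2) ^ 2 / FracFEM.kernelDenom s p.1 p.2 with hF
  have hF0 : 0 ≤ F := integral_nonneg fun p =>
    div_nonneg (sq_nonneg _) (kernelDenom_nonneg _ _ _)
  set τ := (FracFEM.tail s x₀ R e).toReal with hτ
  set Ne := R ^ (-(2 * s)) * ∫ x in B, e x ^ 2 with hNe
  set Nf := R ^ (-(2 * s)) * ∫ x in B, f x ^ 2 with hNf
  have hNe0 : 0 ≤ Ne := mul_nonneg hRs.le (integral_nonneg fun _ => sq_nonneg _)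
  have hNf0 : 0 ≤ Nf := mul_nonneg hRs.le (integral_nonneg fun _ => sq_nonneg _)
  set Tt := R ^ ((d : ℝ) + 2 * s) * τ ^ 2 with hTt
  have hTt0 : 0 ≤ Tt := by positivity
  have hLG' := fun φ hφ hφ0 => hLG x₀ R hR e w φ heH hwH
    (memHs_of_mem_feSpace hd hs0 hs1 hT hΩ (w := φ) hφ) hφ0
  have hmain := hCac K Ω hT hΩ hreg x₀ R hR hB hloc w hw (2 * F + C₀ * (Ne + Tt)) (by positivity)
    (fun φ hφ hφ0 => by
      have := hLG' φ hφ.1 hφ0 (horth φ hφ) htail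
      rw [hef] at this
      exact this)
  set B' := Metric.ball x₀ (R / 2) with hB'
  have hB'B : B' ⊆ B := Metric.ball_subset_ball (by linarith)
  have hdiff : ∀ x, e x = f x - w x := fun x => by
    rw [← hef]; simp
  have hwdiff : ∀ x, w x = f x - e x := fun x => by
    rw [← hef]; simp
  have hl2 : ∫ x in B, w x ^ 2 ≤ 2 * (∫ x in B, f x ^ 2) + 2 * ∫ x in B, e x ^ 2 := by
    rw [← integral_const_mul, ← integral_const_mul,
      ← integral_add ((hfH.integrableOn_sq B).const_mul 2) ((heH.integrableOn_sq B).const_mul 2)]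
    refine integral_mono (hwH.integrableOn_sq B)
      (((hfH.integrableOn_sq B).const_mul 2).add ((heH.integrableOn_sq B).const_mul 2)) fun x => ?_
    beta_reduce
    rw [hwdiff x]
    nlinarith [sq_nonneg (f x + e x)]
  have hNw : R ^ (-(2 * s)) * ∫ x in B, w x ^ 2 ≤ 2 * Nf + 2 * Ne := by
    calc _ ≤ R ^ (-(2 * s)) * (2 * (∫ x in B, f x ^ 2) + 2 * ∫ x in B, e x ^ 2) :=
          mul_le_mul_of_nonneg_left hl2 hRs.le
      _ = _ := by rw [hNf, hNe]; ring
  have hen : ∫ p in B' ×ˢ B', (e p.1 - e p.2) ^ 2 / FracFEM.kernelDenom s p.1 p.2 ≤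
      2 * (∫ p in B' ×ˢ B', (f p.1 - f p.2) ^ 2 / FracFEM.kernelDenom s p.1 p.2) +
      2 * ∫ p in B' ×ˢ B', (w p.1 - w p.2) ^ 2 / FracFEM.kernelDenom s p.1 p.2 := by
    have i1 := hfH.integrableOn_sq_sub_div (B' ×ˢ B')
    have i2 := hwH.integrableOn_sq_sub_div (B' ×ˢ B')
    rw [← integral_const_mul, ← integral_const_mul,
      ← integral_add (i1.const_mul 2) (i2.const_mul 2)]
    refine integral_mono (heH.integrableOn_sq_sub_div _) ((i1.const_mul 2).add (i2.const_mul 2))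
      fun p => ?_
    beta_reduce
    rw [← mul_div_assoc, ← mul_div_assoc, ← add_div]
    refine div_le_div_of_nonneg_right ?_ (kernelDenom_nonneg _ _ _)
    rw [hdiff, hdiff]
    nlinarith [sq_nonneg ((f p.1 - f p.2) + (w p.1 - w p.2))]
  have hF' : ∫ p in B' ×ˢ B', (f p.1 - f p.2) ^ 2 / FracFEM.kernelDenom s p.1 p.2 ≤ F :=
    setIntegral_mono_set (hfH.integrableOn_sq_sub_div _)
      (Filter.Eventually.of_forall fun p => div_nonneg (sq_nonneg _) (kernelDenom_nonneg _ _ _))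
      (Set.prod_mono hB'B hB'B).eventuallyLE
  have hreal : ∫ p in B' ×ˢ B', (e p.1 - e p.2) ^ 2 / FracFEM.kernelDenom s p.1 p.2 ≤
      (2 + 2 * C₁ * (4 + C₀)) * (F + Nf + Ne + Tt) := by
    have h1 : C₁ * (2 * F + C₀ * (Ne + Tt) + R ^ (-(2 * s)) * ∫ x in B, w x ^ 2) ≤
        C₁ * ((4 + C₀) * (F + Nf + Ne + Tt)) := by
      refine mul_le_mul_of_nonneg_left ?_ hC₁.le
      have h2 : 0 ≤ C₀ * F := by positivity
      have h3 : 0 ≤ C₀ * Nf := by positivity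
      nlinarith
    calc _ ≤ 2 * F + 2 * (C₁ * ((4 + C₀) * (F + Nf + Ne + Tt))) := by linarith
      _ ≤ _ := by linarith
  rw [heH.hsSeminormSq_eq, hfH.hsSeminormSq_eq, hfH.l2NormSq_eq, heH.l2NormSq_eq]
  calc _ ≤ ENNReal.ofReal ((2 + 2 * C₁ * (4 + C₀)) * (F + Nf + Ne + Tt)) :=
        ENNReal.ofReal_le_ofReal hreal
    _ = ENNReal.ofReal (2 + 2 * C₁ * (4 + C₀)) * (ENNReal.ofReal F +
        ENNReal.ofReal (R ^ (-(2 * s))) * ENNReal.ofReal (∫ x in B, f x ^ 2) +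
        ENNReal.ofReal (R ^ (-(2 * s))) * ENNReal.ofReal (∫ x in B, e x ^ 2) +
        ENNReal.ofReal (R ^ ((d : ℝ) + 2 * s)) * FracFEM.tail s x₀ R e ^ 2) := by
        rw [ENNReal.ofReal_mul (by positivity), ENNReal.ofReal_add (by positivity) hTt0,
          ENNReal.ofReal_add (by positivity) hNe0, ENNReal.ofReal_add hF0 hNf0, hNf, hNe, hTt,
          ENNReal.ofReal_mul hRs.le, ENNReal.ofReal_mul hRs.le, ENNReal.ofReal_mul hRt.le,
          ENNReal.ofReal_pow ENNReal.toReal_nonneg, ENNReal.ofReal_toReal htail]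
    _ ≤ _ := mul_le_mul' le_rfl (add_le_add (add_le_add le_self_add le_rfl) le_rfl)
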